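/- Let $d\in\mathbb N$ and $\tfrac12\le\theta<1$. For smooth $f:\mathbb R^d\to\mathbb C$ and $C>0$ put $$\|f\|_{\theta,C}=\sup_{\alpha,\beta\in\mathbb N^d}\sup_{x\in\mathbb R^d} C^{-|\alpha|-|\beta|}(\alpha!)^{-\theta}(\beta!)^{-\theta}|x^\alpha\partial^\beta f(x)|\in[0,\infty].$$ Let $\mathcal S_\theta(\mathbb R^d)$ be the space of all smooth $f$ with $\|f\|_{\theta,C}<\infty$ for some $C>0$, and $\mathcal S'_\theta(\mathbb R^d)$ its dual, i.e. the space of linear forms $u$ on $\mathcal S_\theta(\mathbb R^d)$ such that for every $\varepsilon>0$ there is $C_\varepsilon>0$ with $|\langle u,f\rangle|\le C_\varepsilon\|f\|_{\theta,\varepsilon}$ for all $f\in\mathcal S_\theta(\mathbb R^d)$, with the weak topology. A function $f\in\mathcal S_\theta(\mathbb R^d)$ is identified with the ultradistribution $g\mapsto\int fg\,dx$. Let $\varphi(z,y)=\frac12\langle Az,z\rangle+\langle Bz,y\rangle+\frac12\langle Cy,y\rangle$ ($z\in\mathbb C^d$, $y\in\mathbb R^d$, with bilinear brackets) be an FBI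 phase, i.e. $A,B,C$ are complex $d\times d$ matrices, $A$ and $C$ are symmetric, $\det B\ne0$ and $\operatorname{Im}C>0$. Put $\Phi(z)=\max_{y\in\mathbb R^d}(-\operatorname{Im}\varphi(z,y))$ and, for $u\in\mathcal S'_\theta(\mathbb R^d)$, $$T_\varphi u(z)=c_\varphi\langle u_y,e^{i\varphi(z,y)}\rangle,\qquad c_\varphi=2^{-d/2}\pi^{-3d/4}(\det\operatorname{Im}C)^{-1/4}|\det B|,$$ and let $\chi^b_\varphi(x,\xi)$ be the unique $z\in\mathbb C^d$ with $\xi=-\varphi'_y(z,x)=-(Bz+Cx)$. A point $p\in T^*\mathbb R^d\setminus0=\mathbb R^{2d}\setminus\{0\}$ is said not to belong to the wave front set $\mathrm{WF}^\theta_{\mathrm{gl}}(u)$ (taken with respect to $\varphi$) if there are an open conic neighbourhood $L$ of $\chi^b_\varphi(p)$ and $C,\varepsilon>0$ with $|T_\varphi u(z)|\le Ce^{-\varepsilon|z|^{1/\theta}+\Phi(z)}$ for all $z\in L$. Let $\Gamma$ be a closed sub-cone of $T^*\mathbb R^d\setminus0$ and $\mathcal S'_{\theta,\Gamma}(\mathbb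 R^d)=\{u\in\mathcal S'_\theta(\mathbb R^d):\mathrm{WF}^\theta_{\mathrm{gl}}(u)\subset\Gamma\}$, with the following notion of convergence: $u_n\to u$ in $\mathcal S'_{\theta,\Gamma}(\mathbb R^d)$ if all $u_n$ and $u$ belong to this space and $v_n=u_n-u$ satisfies (1) $v_n\to0$ in $\mathcal S'_\theta(\mathbb R^d)$, and (2) for every $p\in(T^*\mathbb R^d\setminus0)\setminus\Gamma$ there are an open conic neighbourhood $L$ of $\chi^b_\varphi(p)$ and $C,\varepsilon>0$ such that $|T_\varphi v_n(z)|\le Ce^{-\varepsilon|z|^{1/\theta}+\Phi(z)}$ for all $n\in\mathbb N$ and $z\in L$. **Proposition.** $\mathcal S_\theta(\mathbb R^d)$ is dense in $\mathcal S'_{\theta,\Gamma}(\mathbb R^d)$: one has $\mathcal S_\theta(\mathbb R^d)\subset\mathcal S'_{\theta,\Gamma}(\mathbb R^d)$, and every $u\in\mathcal S'_{\theta,\Gamma}(\mathbb R^d)$ is the limit in $\mathcal S'_{\theta,\Gamma}(\mathbb R^d)$ of a sequence in $\mathcal S_\theta(\mathbb R^d)$. More precisely, for $\varepsilon>0$ let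 $a_\varepsilon(x,\xi)=e^{-\frac\varepsilon2|x|^2}e^{-\frac\varepsilon2|\xi|^2}$ and $a_\varepsilon(x,D)u(x)=\langle u,K_\varepsilon(x,\cdot)\rangle$ with $K_\varepsilon(x,y)=(2\pi)^{-d}\int e^{i\langle x-y,\xi\rangle}a_\varepsilon(x,\xi)\,d\xi$. Then for every $u\in\mathcal S'_{\theta,\Gamma}(\mathbb R^d)$ one has $a_\varepsilon(x,D)u\in\mathcal S_\theta(\mathbb R^d)$ for all $\varepsilon>0$, and $a_{\varepsilon_n}(x,D)u\to u$ in $\mathcal S'_{\theta,\Gamma}(\mathbb R^d)$ for every sequence $\varepsilon_n>0$ with $\varepsilon_n\to0$. -/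

import Mathlib

open Filter Topology MeasureTheory
open scoped ContDiff ENNReal

noncomputable section

namespace GSWF

/-- The Euclidean space `ℝ^d`. -/
abbrev RSp (d : ℕ) : Type := EuclideanSpace ℝ (Fin d)

/-- The Euclidean space `ℂ^d`. -/
abbrev CSp (d : ℕ) : Type := EuclideanSpace ℂ (Fin d)

/-! ### Gelfand-Shilov functions and ultradistributions -/

/-- The partial derivative `∂_i f`. -/
def partialD {d : ℕ} (i : Fin d) (f : RSp d → ℂ) : RSp d → ℂ :=
  fun x => fderiv ℝ f x (EuclideanSpace.single i (1 : ℝ))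

/-- The derivative `∂^β f = ∂_1^{β_1} ⋯ ∂_d^{β_d} f` for a multi-index `β`. -/
def multiD {d : ℕ} (β : Fin d → ℕ) (f : RSp d → ℂ) : RSp d → ℂ :=
  (List.finRange d).foldr (fun i g => (partialD i)^[β i] g) f

/-- The weight `C^(|α| + |β|) (α!)^θ (β!)^θ`. -/
def gsWeight {d : ℕ} (θ C : ℝ) (α β : Fin d → ℕ) : ℝ :=
  C ^ (∑ i, α i + ∑ i, β i) * (∏ i, ((α i).factorial : ℝ)) ^ θ *
    (∏ i, ((β i).factorial : ℝ)) ^ θ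

/-- The (possibly infinite) norm
`sup_{α, β, x} C^(-|α| - |β|) (α!)^(-θ) (β!)^(-θ) |x^α ∂^β f(x)|`. -/
def gsNorm {d : ℕ} (θ C : ℝ) (f : RSp d → ℂ) : ℝ≥0∞ :=
  ⨆ (α : Fin d → ℕ) (β : Fin d → ℕ) (x : RSp d),
    ENNReal.ofReal ((∏ i, |x i| ^ α i) * ‖multiD β f x‖ / gsWeight θ C α β)

lemma contDiff_partialD {d : ℕ} (i : Fin d) {f : RSp d → ℂ} (hf : ContDiff ℝ ∞ f) :
    ContDiff ℝ ∞ (partialD i f) :=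
  (hf.fderiv_right (m := ∞) (by simp)).clm_apply contDiff_const

lemma contDiff_partialD_iterate {d : ℕ} (i : Fin d) (k : ℕ) {f : RSp d → ℂ}
    (hf : ContDiff ℝ ∞ f) : ContDiff ℝ ∞ ((partialD i)^[k] f) := by
  induction k with
  | zero => simpa using hf
  | succ k ih => rw [Function.iterate_succ_apply']; exact contDiff_partialD i ih

lemma partialD_add {d : ℕ} (i : Fin d) {f g : RSp d → ℂ} (hf : ContDiff ℝ ∞ f)
    (hg : ContDiff ℝ ∞ g) : partialD i (f + g) = partialD i f + partialD i g := by
  funext x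
  simp only [partialD, Pi.add_apply]
  rw [fderiv_add (hf.differentiable (by simp)).differentiableAt
    (hg.differentiable (by simp)).differentiableAt]
  rfl

lemma partialD_smul {d : ℕ} (i : Fin d) (c : ℂ) {f : RSp d → ℂ} (hf : ContDiff ℝ ∞ f) :
    partialD i (c • f) = c • partialD i f := by
  funext x
  simp only [partialD, Pi.smul_apply]
  rw [fderiv_const_smul (hf.differentiable (by simp)).differentiableAt]
  rfl

lemma partialD_iterate_add {d : ℕ} (i : Fin d) (k : ℕ) {f g : RSp d → ℂ}
    (hf : ContDiff ℝ ∞ f) (hg : ContDiff ℝ ∞ g) :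
    (partialD i)^[k] (f + g) = (partialD i)^[k] f + (partialD i)^[k] g := by
  induction k with
  | zero => rfl
  | succ k ih =>
    simp only [Function.iterate_succ_apply', ih]
    exact partialD_add i (contDiff_partialD_iterate i k hf) (contDiff_partialD_iterate i k hg)

lemma partialD_iterate_smul {d : ℕ} (i : Fin d) (k : ℕ) (c : ℂ) {f : RSp d → ℂ}
    (hf : ContDiff ℝ ∞ f) : (partialD i)^[k] (c • f) = c • (partialD i)^[k] f := by
  induction k with
  | zero => rfl
  | succ k ih =>
    simp only [Function.iterate_succ_apply', ih]
    exact partialD_smul i c (contDiff_partialD_iterate i k hf)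

lemma contDiff_foldr {d : ℕ} (β : Fin d → ℕ) (l : List (Fin d)) {f : RSp d → ℂ}
    (hf : ContDiff ℝ ∞ f) :
    ContDiff ℝ ∞ (l.foldr (fun i g => (partialD i)^[β i] g) f) := by
  induction l with
  | nil => exact hf
  | cons i l ih => exact contDiff_partialD_iterate i _ ih

lemma multiD_add {d : ℕ} (β : Fin d → ℕ) {f g : RSp d → ℂ} (hf : ContDiff ℝ ∞ f)
    (hg : ContDiff ℝ ∞ g) : multiD β (f + g) = multiD β f + multiD β g := by
  unfold multiD
  induction List.finRange d with
  | nil => rfl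
  | cons i l ih =>
    simp only [List.foldr_cons, ih]
    exact partialD_iterate_add i _ (contDiff_foldr β l hf) (contDiff_foldr β l hg)

lemma multiD_smul {d : ℕ} (β : Fin d → ℕ) (c : ℂ) {f : RSp d → ℂ} (hf : ContDiff ℝ ∞ f) :
    multiD β (c • f) = c • multiD β f := by
  unfold multiD
  induction List.finRange d with
  | nil => rfl
  | cons i l ih =>
    simp only [List.foldr_cons, ih]
    exact partialD_iterate_smul i _ c (contDiff_foldr β l hf)

lemma gsWeight_pos {d : ℕ} (θ : ℝ) {C : ℝ} (hC : 0 < C) (α β : Fin d → ℕ) :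
    0 < gsWeight θ C α β := by
  unfold gsWeight
  have h : ∀ γ : Fin d → ℕ, 0 < ∏ i, ((γ i).factorial : ℝ) := fun γ =>
    Finset.prod_pos fun i _ => by exact_mod_cast Nat.factorial_pos _
  exact mul_pos (mul_pos (pow_pos hC _) (Real.rpow_pos_of_pos (h α) _))
    (Real.rpow_pos_of_pos (h β) _)

lemma gsNorm_anti {d : ℕ} (θ : ℝ) {C C' : ℝ} (hC : 0 < C) (h : C ≤ C') (f : RSp d → ℂ) :
    gsNorm θ C' f ≤ gsNorm θ C f := by
  refine iSup_mono fun α => iSup_mono fun β => iSup_mono fun x => ENNReal.ofReal_le_ofReal ?_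
  refine div_le_div_of_nonneg_left (by positivity) (gsWeight_pos θ hC α β) ?_
  unfold gsWeight
  gcongr

lemma gsNorm_add_le {d : ℕ} (θ : ℝ) {C : ℝ} (hC : 0 < C) {f g : RSp d → ℂ}
    (hf : ContDiff ℝ ∞ f) (hg : ContDiff ℝ ∞ g) :
    gsNorm θ C (f + g) ≤ gsNorm θ C f + gsNorm θ C g := by
  refine iSup_le fun α => iSup_le fun β => iSup_le fun x => ?_
  have hw := gsWeight_pos θ hC α β
  have h1 : ∀ h : RSp d → ℂ, ENNReal.ofReal
      ((∏ i, |x i| ^ α i) * ‖multiD β h x‖ / gsWeight θ C α β) ≤ gsNorm θ C h := fun h =>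
    le_iSup_of_le α (le_iSup_of_le β (le_iSup_of_le x le_rfl))
  refine le_trans ?_ (add_le_add (h1 f) (h1 g))
  rw [← ENNReal.ofReal_add (by positivity) (by positivity), multiD_add β hf hg]
  refine ENNReal.ofReal_le_ofReal ?_
  rw [← add_div, ← mul_add]
  gcongr
  exact norm_add_le _ _

lemma gsNorm_smul_le {d : ℕ} (θ : ℝ) {C : ℝ} (hC : 0 < C) (c : ℂ) {f : RSp d → ℂ}
    (hf : ContDiff ℝ ∞ f) :
    gsNorm θ C (c • f) ≤ ENNReal.ofReal ‖c‖ * gsNorm θ C f := by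
  refine iSup_le fun α => iSup_le fun β => iSup_le fun x => ?_
  have hw := gsWeight_pos θ hC α β
  have h1 : ENNReal.ofReal
      ((∏ i, |x i| ^ α i) * ‖multiD β f x‖ / gsWeight θ C α β) ≤ gsNorm θ C f :=
    le_iSup_of_le α (le_iSup_of_le β (le_iSup_of_le x le_rfl))
  refine le_trans ?_ (mul_le_mul_right h1 _)
  rw [← ENNReal.ofReal_mul (norm_nonneg _), multiD_smul β c hf]
  refine ENNReal.ofReal_le_ofReal (le_of_eq ?_)
  rw [Pi.smul_apply, norm_smul]
  ring

lemma gsNorm_zero {d : ℕ} (θ C : ℝ) : gsNorm θ C (0 : RSp d → ℂ) = 0 := by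
  have h : ∀ β : Fin d → ℕ, multiD β (0 : RSp d → ℂ) = 0 := fun β => by
    have := multiD_smul β (0 : ℂ) (f := (0 : RSp d → ℂ)) contDiff_const
    simpa using this
  simp [gsNorm, h]

/-- The Gelfand-Shilov space `S_θ(ℝ^d)`: smooth functions with `gsNorm θ C f < ⊤` for
some `C > 0`. -/
def GS (d : ℕ) (θ : ℝ) : Submodule ℂ (RSp d → ℂ) where
  carrier := {f | ContDiff ℝ ∞ f ∧ ∃ C : ℝ, 0 < C ∧ gsNorm θ C f < ⊤}
  zero_mem' := ⟨contDiff_const, 1, one_pos, by rw [gsNorm_zero]; exact ENNReal.zero_lt_top⟩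
  add_mem' := by
    rintro f g ⟨hf, C, hC, hfC⟩ ⟨hg, C', hC', hgC⟩
    have hm : 0 < max C C' := lt_max_of_lt_left hC
    refine ⟨hf.add hg, max C C', hm, (gsNorm_add_le θ hm hf hg).trans_lt ?_⟩
    exact ENNReal.add_lt_top.2 ⟨(gsNorm_anti θ hC (le_max_left _ _) f).trans_lt hfC,
      (gsNorm_anti θ hC' (le_max_right _ _) g).trans_lt hgC⟩
  smul_mem' := by
    rintro c f ⟨hf, C, hC, hfC⟩
    exact ⟨hf.const_smul c, C, hC, (gsNorm_smul_le θ hC c hf).trans_lt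
      (ENNReal.mul_lt_top ENNReal.ofReal_lt_top hfC)⟩

/-- The space `S'_θ(ℝ^d)` of tempered ultradistributions: the linear forms `u` on `S_θ(ℝ^d)` such
that for every `ε > 0` there is `C > 0` with `|u(f)| ≤ C * gsNorm θ ε f` for all `f`. -/
def Ultra (d : ℕ) (θ : ℝ) : Submodule ℂ (GS d θ →ₗ[ℂ] ℂ) where
  carrier := {u | ∀ ε : ℝ, 0 < ε → ∃ C : ℝ, 0 < C ∧ ∀ f : GS d θ,
    ENNReal.ofReal ‖u f‖ ≤ ENNReal.ofReal C * gsNorm θ ε (f : RSp d → ℂ)}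
  zero_mem' := fun _ _ => ⟨1, one_pos, fun f => by simp⟩
  add_mem' := by
    intro u v hu hv ε hε
    obtain ⟨C, hC, h⟩ := hu ε hε
    obtain ⟨C', hC', h'⟩ := hv ε hε
    refine ⟨C + C', add_pos hC hC', fun f => ?_⟩
    rw [ENNReal.ofReal_add hC.le hC'.le, add_mul]
    refine le_trans ?_ (add_le_add (h f) (h' f))
    rw [← ENNReal.ofReal_add (norm_nonneg _) (norm_nonneg _)]
    exact ENNReal.ofReal_le_ofReal (norm_add_le _ _)
  smul_mem' := by
    intro c u hu ε hε
    obtain ⟨C, hC, h⟩ := hu ε hε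
    refine ⟨(‖c‖ + 1) * C, by positivity, fun f => ?_⟩
    rw [ENNReal.ofReal_mul (by positivity), mul_assoc]
    refine le_trans ?_ (mul_le_mul_right (h f) _)
    rw [← ENNReal.ofReal_mul (by positivity)]
    refine ENNReal.ofReal_le_ofReal ?_
    rw [LinearMap.smul_apply, norm_smul]
    gcongr
    linarith

open Classical in
/-- The pairing `⟨u, f⟩ = u(f)` of `u ∈ S'_θ` with `f ∈ S_θ`. It is written as a function of an
arbitrary function `f` (with the value `0` if `f ∉ S_θ`) and is used below only for Gaussians
`f(y) = e^{q(y)}`, `q` a quadratic polynomial with `Re q → -∞` at infinity, which lie in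
`S_{1/2} ⊆ S_θ`. -/
def pair {d : ℕ} {θ : ℝ} (u : Ultra d θ) (f : RSp d → ℂ) : ℂ :=
  if h : f ∈ GS d θ then (u : GS d θ →ₗ[ℂ] ℂ) ⟨f, h⟩ else 0

lemma norm_le_of_gsNorm {d : ℕ} {θ C : ℝ} (hC : 0 < C) {f : RSp d → ℂ}
    (h : gsNorm θ C f < ⊤) (α β : Fin d → ℕ) (x : RSp d) :
    (∏ i, |x i| ^ α i) * ‖multiD β f x‖ ≤ (gsNorm θ C f).toReal * gsWeight θ C α β := by
  rw [← div_le_iff₀ (gsWeight_pos θ hC α β), ← ENNReal.ofReal_le_iff_le_toReal h.ne]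
  exact le_iSup_of_le α (le_iSup_of_le β (le_iSup_of_le x le_rfl))

lemma multiD_zero {d : ℕ} (f : RSp d → ℂ) : multiD 0 f = f := by
  unfold multiD
  simp

lemma integrable_of_mem {d : ℕ} {θ : ℝ} {f : RSp d → ℂ} (hf : f ∈ GS d θ) :
    Integrable f := by
  obtain ⟨hs, C, hC, hfC⟩ := hf
  have hcoord : ∀ i : Fin d, ∃ K : ℝ, ∀ x : RSp d, |x i| ^ (d + 1) * ‖f x‖ ≤ K := fun i => by
    refine ⟨(gsNorm θ C f).toReal * gsWeight θ C (Pi.single i (d + 1)) 0, fun x => ?_⟩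
    have := norm_le_of_gsNorm hC hfC (Pi.single i (d + 1)) 0 x
    rw [multiD_zero, Finset.prod_eq_single i (fun j _ hj => by simp [hj]) (by simp)] at this
    simpa using this
  choose K hK using hcoord
  obtain ⟨K0, hK0⟩ : ∃ K0 : ℝ, ∀ x : RSp d, ‖f x‖ ≤ K0 := by
    refine ⟨(gsNorm θ C f).toReal * gsWeight θ C (0 : Fin d → ℕ) 0, fun x => ?_⟩
    have := norm_le_of_gsNorm hC hfC 0 0 x
    rw [multiD_zero] at this
    simpa using this
  have hint : Integrable (fun x : RSp d =>
      (2 ^ d * (K0 + d ^ d * ∑ i, K i)) * (1 + ‖x‖) ^ (-((d : ℝ) + 1))) :=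
    (integrable_one_add_norm (by simp)).const_mul _
  refine hint.mono' hs.continuous.aestronglyMeasurable (Eventually.of_forall fun x => ?_)
  have h0 : 0 < 1 + ‖x‖ := by positivity
  have e : ((d : ℝ) + 1) = ((d + 1 : ℕ) : ℝ) := by push_cast; ring
  rw [e, Real.rpow_neg h0.le, Real.rpow_natCast, ← div_eq_mul_inv, le_div_iff₀ (by positivity)]
  have hn : ‖x‖ ^ (d + 1) ≤ d ^ d * ∑ i, |x i| ^ (d + 1) := by
    have h1 : ‖x‖ ≤ ∑ i, |x i| := by
      rw [EuclideanSpace.norm_eq, Real.sqrt_le_left (Finset.sum_nonneg fun i _ => abs_nonneg _)]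
      simpa using Finset.sum_sq_le_sq_sum_of_nonneg
        (s := Finset.univ) (f := fun i => |x i|) (fun i _ => abs_nonneg _)
    have h2 := pow_sum_div_card_le_sum_pow (s := Finset.univ) (f := fun i => |x i|)
      (fun i _ => abs_nonneg _) d
    rcases Nat.eq_zero_or_pos d with rfl | hd
    · simpa using h1
    · simp only [Finset.card_univ, Fintype.card_fin] at h2
      rw [div_le_iff₀ (by positivity), mul_comm] at h2
      exact (pow_le_pow_left₀ (norm_nonneg _) h1 _).trans h2
  have hp : (1 + ‖x‖) ^ (d + 1) ≤ 2 ^ d * (1 + ‖x‖ ^ (d + 1)) := by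
    simpa using add_pow_le (zero_le_one (α := ℝ)) (norm_nonneg x) (d + 1)
  calc ‖f x‖ * (1 + ‖x‖) ^ (d + 1)
      ≤ ‖f x‖ * (2 ^ d * (1 + d ^ d * ∑ i, |x i| ^ (d + 1))) := by gcongr; exact hp.trans (by gcongr)
    _ = 2 ^ d * (‖f x‖ + d ^ d * ∑ i, |x i| ^ (d + 1) * ‖f x‖) := by rw [← Finset.sum_mul]; ring
    _ ≤ 2 ^ d * (K0 + d ^ d * ∑ i, K i) := by
        gcongr with i
        · exact hK0 x
        · exact hK i x

lemma integrable_mul_of_mem {d : ℕ} {θ : ℝ} {f g : RSp d → ℂ} (hf : f ∈ GS d θ)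
    (hg : g ∈ GS d θ) : Integrable (fun x => f x * g x) := by
  obtain ⟨hs, C, hC, hgC⟩ := id hg
  refine (integrable_of_mem hf).mul_bdd (c := (gsNorm θ C g).toReal * gsWeight θ C (0 : Fin d → ℕ) 0)
    hs.continuous.aestronglyMeasurable (Eventually.of_forall fun x => ?_)
  have := norm_le_of_gsNorm hC hgC 0 0 x
  rw [multiD_zero] at this
  simpa using this

/-- The embedding `S_θ(ℝ^d) ⊆ S'_θ(ℝ^d)`: a function `f` is identified with the ultradistribution
`g ↦ ∫ f g dx`. -/
def toUltra {d : ℕ} {θ : ℝ} (f : GS d θ) : Ultra d θ :=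
  ⟨{ toFun := fun g => ∫ x, (f : RSp d → ℂ) x * (g : RSp d → ℂ) x
     map_add' := fun g h => by
       simp only [Submodule.coe_add, Pi.add_apply, mul_add]
       exact integral_add (integrable_mul_of_mem f.2 g.2) (integrable_mul_of_mem f.2 h.2)
     map_smul' := fun c g => by
       simp only [Submodule.coe_smul, Pi.smul_apply, smul_eq_mul, RingHom.id_apply]
       rw [← integral_const_mul]
       congr 1; funext x; ring }, by
    intro ε hε
    have h0 : 0 ≤ ∫ x, ‖(f : RSp d → ℂ) x‖ := integral_nonneg fun _ => norm_nonneg _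
    refine ⟨(∫ x, ‖(f : RSp d → ℂ) x‖) + 1, by linarith, fun g => ?_⟩
    by_cases hg : gsNorm θ ε (g : RSp d → ℂ) < ⊤
    · rw [← ENNReal.ofReal_toReal hg.ne, ← ENNReal.ofReal_mul (by linarith)]
      refine ENNReal.ofReal_le_ofReal ?_
      simp only [LinearMap.coe_mk, AddHom.coe_mk]
      have hb : ∀ x, ‖(g : RSp d → ℂ) x‖ ≤ (gsNorm θ ε (g : RSp d → ℂ)).toReal := fun x => by
        have := norm_le_of_gsNorm hε hg 0 0 x
        rw [multiD_zero] at this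
        simpa [gsWeight] using this
      calc ‖∫ x, (f : RSp d → ℂ) x * (g : RSp d → ℂ) x‖
          ≤ ∫ x, ‖(f : RSp d → ℂ) x‖ * (gsNorm θ ε (g : RSp d → ℂ)).toReal := by
            refine norm_integral_le_of_norm_le ((integrable_of_mem f.2).norm.mul_const _)
              (Eventually.of_forall fun x => ?_)
            rw [norm_mul]
            exact mul_le_mul_of_nonneg_left (hb x) (norm_nonneg _)
        _ = (∫ x, ‖(f : RSp d → ℂ) x‖) * (gsNorm θ ε (g : RSp d → ℂ)).toReal :=
            integral_mul_const _ _
        _ ≤ _ := by gcongr; linarith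
    · rw [not_lt, top_le_iff] at hg
      rw [hg, ENNReal.mul_top (by
        rw [Ne, ENNReal.ofReal_eq_zero, not_le]; linarith)]
      exact le_top⟩

/-! ### FBI transforms -/

/-- An FBI phase `φ(z, y) = ½⟨Az, z⟩ + ⟨Bz, y⟩ + ½⟨Cy, y⟩` on `ℂ^d × ℝ^d`, where `A`, `C` are
symmetric, `det B ≠ 0` and `Im C` is positive definite. -/
structure FBIPhase (d : ℕ) where
  A : Matrix (Fin d) (Fin d) ℂ
  B : Matrix (Fin d) (Fin d) ℂ
  C : Matrix (Fin d) (Fin d) ℂ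
  symm_A : A.IsSymm
  symm_C : C.IsSymm
  det_B_ne_zero : B.det ≠ 0
  posDef_im_C : (C.map Complex.im).PosDef

namespace FBIPhase

variable {d : ℕ} (φ : FBIPhase d)

/-- The real vector `y` as an element of `ℂ^d` (in coordinates). -/
def ofR (y : RSp d) : Fin d → ℂ := fun i => (y i : ℂ)

/-- The value `φ(z, y)`; the brackets `⟨·, ·⟩` are bilinear. -/
def eval (z : CSp d) (y : RSp d) : ℂ :=
  (1 / 2) * (φ.A.mulVec z.ofLp ⬝ᵥ z.ofLp) + φ.B.mulVec z.ofLp ⬝ᵥ ofR y +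
    (1 / 2) * (φ.C.mulVec (ofR y) ⬝ᵥ ofR y)

/-- The weight `Φ(z) = max_y (- Im φ(z, y))`. -/
def weight (z : CSp d) : ℝ := ⨆ y : RSp d, -(φ.eval z y).im

/-- The constant `c_φ = 2^{-d/2} π^{-3d/4} (det Im C)^{-1/4} |det B|`. -/
def const : ℝ :=
  (2 : ℝ) ^ (-(d : ℝ) / 2) * Real.pi ^ (-(3 * (d : ℝ)) / 4) *
    (φ.C.map Complex.im).det ^ (-(1 : ℝ) / 4) * ‖φ.B.det‖

/-- The FBI transform `T_φ u(z) = c_φ ⟨u_y, e^{iφ(z, y)}⟩`. -/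
def transform {θ : ℝ} (u : Ultra d θ) (z : CSp d) : ℂ :=
  (φ.const : ℂ) * pair u (fun y => Complex.exp (Complex.I * φ.eval z y))

/-- The base component `χ^b_φ : T^*ℝ^d → ℂ^d` of the canonical transformation
`(y, -φ'_y(z, y)) ↦ (z, φ'_z(z, y))`: as `φ'_y(z, y) = Bz + Cy`, the point `z = χ^b_φ(x, ξ)` is the
unique solution of `ξ = -(Bz + Cx)`, see `chi_eq_iff`. -/
def chi (p : RSp d × RSp d) : CSp d :=
  WithLp.toLp 2 (-(φ.B⁻¹.mulVec (ofR p.2 + φ.C.mulVec (ofR p.1))))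

lemma chi_eq_iff (p : RSp d × RSp d) (z : CSp d) :
    φ.chi p = z ↔ ofR p.2 = -(φ.B.mulVec z.ofLp + φ.C.mulVec (ofR p.1)) := by
  have hB : IsUnit φ.B.det := isUnit_iff_ne_zero.2 φ.det_B_ne_zero
  constructor
  · rintro rfl
    simp [chi, Matrix.mulVec_neg, Matrix.mulVec_mulVec, Matrix.mul_nonsing_inv _ hB]
  · intro h
    apply (WithLp.ofLp_injective 2)
    simp [chi, h, Matrix.mulVec_neg, Matrix.mulVec_mulVec, Matrix.nonsing_inv_mul _ hB]

end FBIPhase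

/-! ### The global wave front set and the spaces `S'_{θ,Γ}` -/

/-- `L` is an open conic neighbourhood of `z` in `ℂ^d \ {0}`. -/
def IsOpenConicNhd {d : ℕ} (L : Set (CSp d)) (z : CSp d) : Prop :=
  IsOpen L ∧ z ∈ L ∧ (0 : CSp d) ∉ L ∧ ∀ w ∈ L, ∀ t : ℝ, 0 < t → t • w ∈ L

/-- `Γ` is a closed sub-cone of `T^*ℝ^d \ 0`; a subset `Γ` of `T^*ℝ^d \ 0` is relatively closed iff
`Γ ∪ {0}` is closed in `T^*ℝ^d`. -/
def IsClosedCone {d : ℕ} (Γ : Set (RSp d × RSp d)) : Prop :=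
  (0 : RSp d × RSp d) ∉ Γ ∧ IsClosed (Γ ∪ {0}) ∧ ∀ p ∈ Γ, ∀ t : ℝ, 0 < t → t • p ∈ Γ

/-- The global wave front set of `u ∈ S'_θ(ℝ^d)` (with respect to the FBI phase `φ`): a point
`p ≠ 0` is not in it iff `|T_φ u(z)| ≤ C e^{-ε|z|^{1/θ} + Φ(z)}` holds on an open conic neighbourhood
of `χ^b_φ(p)`, for some `C, ε > 0`. -/
def WF {d : ℕ} {θ : ℝ} (φ : FBIPhase d) (u : Ultra d θ) : Set (RSp d × RSp d) :=
  {p | p ≠ 0 ∧ ¬ ∃ L : Set (CSp d), IsOpenConicNhd L (φ.chi p) ∧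
    ∃ ε : ℝ, 0 < ε ∧ ∃ C : ℝ, 0 < C ∧ ∀ z ∈ L,
      ‖φ.transform u z‖ ≤ C * Real.exp (-ε * ‖z‖ ^ (1 / θ) + φ.weight z)}

/-- The space `S'_{θ,Γ}(ℝ^d)` of ultradistributions with wave front set in `Γ`. -/
def UltraIn {d : ℕ} {θ : ℝ} (φ : FBIPhase d) (Γ : Set (RSp d × RSp d)) : Set (Ultra d θ) :=
  {u | WF φ u ⊆ Γ}

/-- Convergence `u_n → 0` in `S'_{θ,Γ}(ℝ^d)`: weak convergence in `S'_θ(ℝ^d)`, and for every point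
`p` of the complement of `Γ` a bound for `T_φ u_n` on an open conic neighbourhood of `χ^b_φ(p)`,
uniformly in `n`. -/
def TendstoZeroIn {d : ℕ} {θ : ℝ} (φ : FBIPhase d) (Γ : Set (RSp d × RSp d))
    (u : ℕ → Ultra d θ) : Prop :=
  (∀ f : GS d θ, Tendsto (fun n => (u n : GS d θ →ₗ[ℂ] ℂ) f) atTop (𝓝 0)) ∧
  ∀ p : RSp d × RSp d, p ≠ 0 → p ∉ Γ →
    ∃ L : Set (CSp d), IsOpenConicNhd L (φ.chi p) ∧
      ∃ C : ℝ, 0 < C ∧ ∃ ε : ℝ, 0 < ε ∧ ∀ n : ℕ, ∀ z ∈ L,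
        ‖φ.transform (u n) z‖ ≤ C * Real.exp (-ε * ‖z‖ ^ (1 / θ) + φ.weight z)

/-- Convergence `u_n → u` in `S'_{θ,Γ}(ℝ^d)`. -/
def TendstoIn {d : ℕ} {θ : ℝ} (φ : FBIPhase d) (Γ : Set (RSp d × RSp d))
    (u : ℕ → Ultra d θ) (v : Ultra d θ) : Prop :=
  (∀ n, u n ∈ UltraIn φ Γ) ∧ v ∈ UltraIn φ Γ ∧ TendstoZeroIn φ Γ (fun n => u n - v)

/-! ### Regularizing pseudodifferential operators -/

/-- The Gaussian symbol `a_ε(x, ξ) = e^{-ε|x|²/2} e^{-ε|ξ|²/2}`. -/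
def gaussSymbol {d : ℕ} (ε : ℝ) (x ξ : RSp d) : ℂ :=
  ((Real.exp (-(ε / 2) * ‖x‖ ^ 2) * Real.exp (-(ε / 2) * ‖ξ‖ ^ 2) : ℝ) : ℂ)

/-- The Schwartz kernel `K(x, y) = (2π)^{-d} ∫ e^{i⟨x - y, ξ⟩} a(x, ξ) dξ` of the operator
`a(x, D)`, i.e. `a(x, D) f(x) = (2π)^{-d} ∬ e^{i⟨x - y, ξ⟩} a(x, ξ) f(y) dy dξ`. -/
def pdoKernel {d : ℕ} (a : RSp d → RSp d → ℂ) (x y : RSp d) : ℂ :=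
  ((2 * Real.pi : ℝ) ^ d : ℂ)⁻¹ *
    ∫ ξ : RSp d, Complex.exp (Complex.I * ((inner ℝ (x - y) ξ : ℝ) : ℂ)) * a x ξ

/-- The function `a(x, D)u(x) = ⟨u, K(x, ·)⟩` for an ultradistribution `u` and a regularizing
symbol `a`. -/
def pdo {d : ℕ} {θ : ℝ} (a : RSp d → RSp d → ℂ) (u : Ultra d θ) (x : RSp d) : ℂ :=
  pair u (pdoKernel a x)

end GSWF

end

noncomputable section

namespace GSWF

open FBIPhase (ofR)

variable {d : ℕ}

/-! ### Multi-indices -/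

/-! Everything is read off from the wave packets `e^{-i⟨ξ,y⟩ + (i/2)⟨C(y-x),y-x⟩}`, `p = (x,ξ)`.
With `C` taken from the phase and `z = χ^b_φ(p)`, completing the square turns `e^{iφ(z,y)}` into the
packet at `p` times a constant of modulus `e^{Φ(z)}`. Hence `|T_φ u(z)| = c_φ e^{Φ(z)}
|u(packet_p)|` (`FBIPhase.norm_transform_chi`). As `χ^b_φ` is a real linear isomorphism, wave front
sets and condition (2) become statements about decay `e^{-ε|p|^{1/θ}}` of `p ↦ u(packet_p)` in cones
of phase space.

Three facts make packets usable. Their Gelfand-Shilov norms are bounded by `K e^{δ|p|^{1/θ}}` for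
every `δ > 0`, with a suitable norm parameter `D` depending on `δ` (`gsNorm_packet_bounds`, by
Cauchy estimates), so every ultradistribution has arbitrarily slow growth of this type on packets.
The packet transform of an `f ∈ S_θ` decays like `e^{-ε|p|^{1/θ}}` on all of phase space
(`exists_decay_packet_transform`). Finally, `f` is a superposition of packets with coefficients
given by a dual window (`integral_coef_mul_packet`), and `u` may be applied under that integral
(`apply_eq_integral_coef`), which is justified by Bochner integration in a Banach space and
Hahn-Banach.

The Gaussian operator has kernel `e^{-ε|x|²/2}` times a heat kernel, itself a multiple of a packet.
Expanding the heat kernels by the reproducing formula gives `a_ε(x,D)u` as a superposition of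
packets with Gaussian coefficients, so it lies in `S_θ` (`pdo_mem`). For the limit, pair `a_ε(x,D)u`
with `packet_q`: the result is `∫ k_ε(p,q) u(packet_p) dp` up to a constant
(`integral_pdo_mul_packet`), and the crucial estimate is `|k_ε(p,q)| ≤ K e^{-c|p-q|²}` uniformly for
`0 < ε ≤ M` (`exists_norm_coef_smear_le`). Since `1/θ ≤ 2`, this Gaussian dominates the growth of
`u` off the diagonal.

Dominated convergence then gives convergence on packets, and, through the reproducing formula for a
test function, weak convergence (`tendsto_integral_pdo_mul`). If `u(packet_p)` decays in a cone and
`q` lies in a smaller one, then either `p` is in the large cone or `|p-q| ≥ r|q|` and the kernel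
itself is small; this yields cone decay uniform in `ε` (`norm_integral_pdo_mul_packet_le_of_cone`),
which is condition (2). -/

lemma partialD_comm (i j : Fin d) {f : RSp d → ℂ} (hf : ContDiff ℝ ∞ f) :
    partialD i (partialD j f) = partialD j (partialD i f) := by
  funext x
  have hd : DifferentiableAt ℝ (fderiv ℝ f) x :=
    ((hf.fderiv_right (m := ∞) (by simp)).differentiable (by simp)).differentiableAt
  have key : ∀ v w : RSp d, fderiv ℝ (fun y => fderiv ℝ f y v) x w
      = fderiv ℝ (fderiv ℝ f) x w v := fun v w => by
    rw [fderiv_clm_apply hd (differentiableAt_const v)]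
    simp
  have hs : IsSymmSndFDerivAt ℝ f x := (contDiff_infty.1 hf 2).contDiffAt.isSymmSndFDerivAt (by simp)
  exact ((key _ _).trans (hs _ _)).trans (key _ _).symm

lemma partialD_iterate_comm (i j : Fin d) (k : ℕ) {f : RSp d → ℂ} (hf : ContDiff ℝ ∞ f) :
    partialD i ((partialD j)^[k] f) = (partialD j)^[k] (partialD i f) := by
  induction k with
  | zero => rfl
  | succ k ih =>
    rw [Function.iterate_succ_apply', partialD_comm i j (contDiff_partialD_iterate j k hf), ih,
      Function.iterate_succ_apply']

lemma contDiff_multiD (β : Fin d → ℕ) {f : RSp d → ℂ} (hf : ContDiff ℝ ∞ f) :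
    ContDiff ℝ ∞ (multiD β f) := contDiff_foldr β _ hf

/-- The extra derivative has to travel through the ordered product to its own slot, which
commutation of partials permits; `Nodup` ensures that the slot is met only once. -/
lemma partialD_foldr (i : Fin d) (β : Fin d → ℕ) (l : List (Fin d)) (hl : l.Nodup)
    {f : RSp d → ℂ} (hf : ContDiff ℝ ∞ f) :
    l.foldr (fun j g => (partialD j)^[(β + Pi.single i 1 : Fin d → ℕ) j] g) f =
      if i ∈ l then partialD i (l.foldr (fun j g => (partialD j)^[β j] g) f)
      else l.foldr (fun j g => (partialD j)^[β j] g) f := by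
  induction l with
  | nil => simp
  | cons j l ih =>
    rw [List.nodup_cons] at hl
    simp only [List.foldr_cons, ih hl.2, List.mem_cons]
    by_cases hij : i = j
    · subst hij
      simp only [hl.1, if_false, true_or, if_true, Pi.add_apply, Pi.single_eq_same]
      rw [Function.iterate_succ_apply']
    · have hji : j ≠ i := fun h => hij h.symm
      simp only [hij, false_or, Pi.add_apply, Pi.single_eq_of_ne hji, add_zero]
      split_ifs with h
      · rw [partialD_iterate_comm i j _ (contDiff_foldr β l hf)]
      · rfl

lemma partialD_multiD (i : Fin d) (β : Fin d → ℕ) {f : RSp d → ℂ} (hf : ContDiff ℝ ∞ f) :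
    partialD i (multiD β f) = multiD (β + Pi.single i 1) f := by
  have := partialD_foldr i β (List.finRange d) (List.nodup_finRange d) hf
  rw [if_pos (List.mem_finRange i)] at this
  exact this.symm

lemma multiD_single (i : Fin d) (k : ℕ) {f : RSp d → ℂ} (hf : ContDiff ℝ ∞ f) :
    multiD (Pi.single i k) f = (partialD i)^[k] f := by
  induction k with
  | zero => rw [Pi.single_zero, multiD_zero]; rfl
  | succ k ih =>
    rw [Function.iterate_succ_apply', ← ih, partialD_multiD i _ hf, ← Pi.single_add]

lemma fderiv_eq_sum_partialD (f : RSp d → ℂ) (x : RSp d) :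
    fderiv ℝ f x = ∑ i, (EuclideanSpace.proj i : RSp d →L[ℝ] ℝ).smulRight (partialD i f x) := by
  ext v
  have hv : v = ∑ i, v i • EuclideanSpace.single i (1 : ℝ) := by
    ext j
    simp [Finset.sum_apply, Pi.single_apply]
  conv_lhs => rw [hv]
  simp [partialD, map_sum]

/-! ### Derivatives along lines -/

/-- Restriction to a coordinate line makes the one-variable Leibniz rule available for iterated
partials. -/
lemma iteratedDeriv_line (i : Fin d) (k : ℕ) {f : RSp d → ℂ} (hf : ContDiff ℝ ∞ f) (x : RSp d) :
    iteratedDeriv k (fun s : ℝ => f (x + s • EuclideanSpace.single i (1 : ℝ)))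
      = fun s : ℝ => (partialD i)^[k] f (x + s • EuclideanSpace.single i (1 : ℝ)) := by
  induction k with
  | zero => simp
  | succ k ih =>
    rw [iteratedDeriv_succ, ih]
    funext s
    rw [Function.iterate_succ_apply']
    have h1 : HasFDerivAt ((partialD i)^[k] f) (fderiv ℝ ((partialD i)^[k] f)
        (x + s • EuclideanSpace.single i (1 : ℝ))) (x + s • EuclideanSpace.single i (1 : ℝ)) :=
      ((contDiff_partialD_iterate i k hf).differentiable (by simp)).differentiableAt.hasFDerivAt
    have h2 : HasDerivAt (fun s : ℝ => x + s • EuclideanSpace.single i (1 : ℝ))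
        (EuclideanSpace.single i (1 : ℝ) : RSp d) s := by
      simpa using ((hasDerivAt_id s).smul_const (EuclideanSpace.single i (1 : ℝ))).const_add x
    exact (h1.comp_hasDerivAt s h2).deriv

lemma partialD_iterate_mul (i : Fin d) (k : ℕ) {f g : RSp d → ℂ} (hf : ContDiff ℝ ∞ f)
    (hg : ContDiff ℝ ∞ g) (x : RSp d) :
    (partialD i)^[k] (fun y => f y * g y) x = ∑ j ∈ Finset.range (k + 1),
      (k.choose j : ℂ) * (partialD i)^[j] f x * (partialD i)^[k - j] g x := by
  have h1 : ∀ {f : RSp d → ℂ}, ContDiff ℝ ∞ f → ∀ n, (partialD i)^[n] f x =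
      iteratedDeriv n (fun s : ℝ => f (x + s • EuclideanSpace.single i (1 : ℝ))) 0 := by
    intro f hf n
    rw [iteratedDeriv_line i n hf]
    simp
  have hl : ∀ {f : RSp d → ℂ}, ContDiff ℝ ∞ f → ContDiff ℝ ∞
      (fun s : ℝ => f (x + s • EuclideanSpace.single i (1 : ℝ))) := fun hf =>
    hf.comp (contDiff_const.add (contDiff_id.smul contDiff_const))
  rw [h1 (hf.mul hg), iteratedDeriv_fun_mul ((hl hf).contDiffAt.of_le (by exact_mod_cast le_top))
    ((hl hg).contDiffAt.of_le (by exact_mod_cast le_top))]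
  refine Finset.sum_congr rfl fun j _ => ?_
  rw [h1 hf, h1 hg]

/-! ### Cauchy estimates -/

/-- The complex partial derivative. -/
def cPartial (i : Fin d) (F : (Fin d → ℂ) → ℂ) : (Fin d → ℂ) → ℂ :=
  fun z => fderiv ℂ F z (Pi.single i 1)

lemma contDiff_cPartial (i : Fin d) {F : (Fin d → ℂ) → ℂ} (hF : ContDiff ℂ ∞ F) :
    ContDiff ℂ ∞ (cPartial i F) :=
  (hF.fderiv_right (m := ∞) (by simp)).clm_apply contDiff_const

lemma contDiff_cPartial_iterate (i : Fin d) (k : ℕ) {F : (Fin d → ℂ) → ℂ}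
    (hF : ContDiff ℂ ∞ F) : ContDiff ℂ ∞ ((cPartial i)^[k] F) := by
  induction k with
  | zero => simpa using hF
  | succ k ih => rw [Function.iterate_succ_apply']; exact contDiff_cPartial i ih

lemma contDiff_cPartial_foldr (β : Fin d → ℕ) (l : List (Fin d)) {F : (Fin d → ℂ) → ℂ}
    (hF : ContDiff ℂ ∞ F) :
    ContDiff ℂ ∞ (l.foldr (fun i g => (cPartial i)^[β i] g) F) := by
  induction l with
  | nil => exact hF
  | cons i l ih => exact contDiff_cPartial_iterate i _ ih

lemma iteratedDeriv_complex_line (i : Fin d) (k : ℕ) {F : (Fin d → ℂ) → ℂ}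
    (hF : ContDiff ℂ ∞ F) (z : Fin d → ℂ) :
    iteratedDeriv k (fun s : ℂ => F (z + s • Pi.single i (1 : ℂ)))
      = fun s : ℂ => (cPartial i)^[k] F (z + s • Pi.single i (1 : ℂ)) := by
  induction k with
  | zero => simp
  | succ k ih =>
    rw [iteratedDeriv_succ, ih]
    funext s
    rw [Function.iterate_succ_apply']
    have h1 : HasFDerivAt ((cPartial i)^[k] F) (fderiv ℂ ((cPartial i)^[k] F)
        (z + s • Pi.single i (1 : ℂ))) (z + s • Pi.single i (1 : ℂ)) :=
      ((contDiff_cPartial_iterate i k hF).differentiable (by simp)).differentiableAt.hasFDerivAt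
    have h2 : HasDerivAt (fun s : ℂ => z + s • (Pi.single i (1 : ℂ) : Fin d → ℂ))
        (Pi.single i (1 : ℂ) : Fin d → ℂ) s := by
      simpa using ((hasDerivAt_id s).smul_const (Pi.single i (1 : ℂ) : Fin d → ℂ)).const_add z
    exact (h1.comp_hasDerivAt s h2).deriv

lemma norm_cPartial_iterate_le (i : Fin d) (k : ℕ) {F : (Fin d → ℂ) → ℂ}
    (hF : ContDiff ℂ ∞ F) (z : Fin d → ℂ) {r M : ℝ} (hr : 0 < r)
    (hM : ∀ s : ℂ, ‖s‖ = r → ‖F (z + s • Pi.single i (1 : ℂ))‖ ≤ M) :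
    ‖(cPartial i)^[k] F z‖ ≤ M * (k.factorial / r ^ k) := by
  have h1 : (cPartial i)^[k] F z
      = iteratedDeriv k (fun s : ℂ => F (z + s • Pi.single i (1 : ℂ))) 0 := by
    rw [iteratedDeriv_complex_line i k hF]
    simp
  have hl : ContDiff ℂ ∞ (fun s : ℂ => F (z + s • Pi.single i (1 : ℂ))) :=
    hF.comp (contDiff_const.add (contDiff_id.smul contDiff_const))
  rw [h1]
  refine (Complex.norm_iteratedDeriv_le_of_forall_mem_sphere_norm_le (C := M) k hr
    (hl.differentiable (by simp)).diffContOnCl fun s hs => hM s (by simpa using hs)).trans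
    (le_of_eq (by ring))

/-- Cauchy's estimate on a polydisc, obtained by applying the one-variable estimate in one
coordinate at a time. The displacement `w` is supported on the coordinates still in the list, so
that the circle used for `i` and the polydisc of the tail combine. -/
lemma norm_cPartial_foldr_le (β : Fin d → ℕ) (r : Fin d → ℝ) (hr : ∀ i, 0 < r i)
    {F : (Fin d → ℂ) → ℂ} (hF : ContDiff ℂ ∞ F) {M : ℝ} (l : List (Fin d)) (hl : l.Nodup)
    (z : Fin d → ℂ)
    (hM : ∀ w : Fin d → ℂ, (∀ i ∈ l, ‖w i‖ ≤ r i) → (∀ i ∉ l, w i = 0) → ‖F (z + w)‖ ≤ M) :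
    ‖l.foldr (fun i g => (cPartial i)^[β i] g) F z‖ ≤
      M * (l.map fun i => ((β i).factorial : ℝ) / r i ^ β i).prod := by
  induction l generalizing z with
  | nil => simpa using hM 0 (by simp) (by simp)
  | cons i l ih =>
    rw [List.nodup_cons] at hl
    rw [List.foldr_cons, List.map_cons, List.prod_cons, mul_comm (((β i).factorial : ℝ) / _),
      ← mul_assoc]
    refine norm_cPartial_iterate_le i _ (contDiff_cPartial_foldr β l hF) z (hr i) fun s hs => ?_
    refine ih hl.2 _ fun w hw hw' => ?_
    rw [add_assoc]
    refine hM _ (fun j hj => ?_) fun j hj => ?_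
    · by_cases hji : j = i
      · subst hji
        simp [hw' j hl.1, hs]
      · rcases List.mem_cons.1 hj with h | h
        · exact absurd h hji
        · simpa [hji] using hw j h
    · rw [List.mem_cons, not_or] at hj
      simp [hj.1, hw' j hj.2]

/-- `ofR` as a continuous `ℝ`-linear map. -/
def ofRL : RSp d →L[ℝ] (Fin d → ℂ) :=
  ContinuousLinearMap.pi fun i => Complex.ofRealCLM.comp (EuclideanSpace.proj i)

lemma ofRL_apply (x : RSp d) : ofRL x = ofR x := rfl

lemma ofR_add (x y : RSp d) : ofR (x + y) = ofR x + ofR y := map_add ofRL x y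

lemma ofR_sub (x y : RSp d) : ofR (x - y) = ofR x - ofR y := map_sub ofRL x y

lemma contDiff_comp_ofR {F : (Fin d → ℂ) → ℂ} (hF : ContDiff ℂ ∞ F) :
    ContDiff ℝ ∞ (fun x : RSp d => F (ofR x)) :=
  (hF.restrict_scalars ℝ).comp (ofRL (d := d)).contDiff

lemma partialD_comp_ofR (i : Fin d) {F : (Fin d → ℂ) → ℂ} (hF : ContDiff ℂ ∞ F) :
    partialD i (fun x => F (ofR x)) = fun x => cPartial i F (ofR x) := by
  funext x
  have h1 : HasFDerivAt F ((fderiv ℂ F (ofRL x)).restrictScalars ℝ) (ofRL x) :=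
    (hF.differentiable (by simp)).differentiableAt.hasFDerivAt.restrictScalars ℝ
  have h2 := (h1.comp x (ofRL (d := d)).hasFDerivAt).fderiv
  have h3 : ofRL (EuclideanSpace.single i (1 : ℝ)) = Pi.single i (1 : ℂ) := by
    funext j
    by_cases hj : j = i
    · subst hj; simp [ofRL_apply, ofR]
    · simp [ofRL_apply, ofR, hj]
  change fderiv ℝ (F ∘ ofRL) x _ = _
  rw [h2]
  simp [h3, cPartial, ofRL_apply]

lemma multiD_comp_ofR (β : Fin d → ℕ) {F : (Fin d → ℂ) → ℂ} (hF : ContDiff ℂ ∞ F) :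
    multiD β (fun x => F (ofR x)) = fun x =>
      (List.finRange d).foldr (fun i g => (cPartial i)^[β i] g) F (ofR x) := by
  have hit : ∀ (i : Fin d) (k : ℕ) {G : (Fin d → ℂ) → ℂ}, ContDiff ℂ ∞ G →
      (partialD i)^[k] (fun x => G (ofR x)) = fun x => (cPartial i)^[k] G (ofR x) := by
    intro i k G hG
    induction k with
    | zero => rfl
    | succ k ih =>
      rw [Function.iterate_succ_apply', ih, partialD_comp_ofR i (contDiff_cPartial_iterate i k hG),
        Function.iterate_succ_apply']
  unfold multiD
  induction List.finRange d with
  | nil => rfl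
  | cons i l ih => rw [List.foldr_cons, ih, hit i _ (contDiff_cPartial_foldr β l hF)]; rfl

lemma norm_multiD_comp_ofR_le (β : Fin d → ℕ) (r : Fin d → ℝ) (hr : ∀ i, 0 < r i)
    {F : (Fin d → ℂ) → ℂ} (hF : ContDiff ℂ ∞ F) {M : ℝ} (x : RSp d)
    (hM : ∀ w : Fin d → ℂ, (∀ i, ‖w i‖ ≤ r i) → ‖F (ofR x + w)‖ ≤ M) :
    ‖multiD β (fun x => F (ofR x)) x‖ ≤ M * ∏ i, (((β i).factorial : ℝ) / r i ^ β i) := by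
  rw [multiD_comp_ofR β hF, ← List.prod_ofFn, List.ofFn_eq_map]
  exact norm_cPartial_foldr_le β r hr hF _ (List.nodup_finRange d) _ fun w hw _ =>
    hM w fun i => hw i (List.mem_finRange i)

/-! ### Scalar inequalities -/

/-- Young's inequality for the exponents `1/θ` and `1/(1-θ)`, with a crude constant: if the first
term does not already dominate, then `s ≤ δ^{-θ/(1-θ)} m^θ`, and the second term does. -/
lemma mul_rpow_le_young {θ δ : ℝ} (hθ : 0 < θ) (hθ' : θ < 1) (hδ : 0 < δ) {s m : ℝ}
    (hs : 0 ≤ s) (hm : 0 < m) :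
    s * m ^ (1 - θ) ≤ δ * s ^ (1 / θ) + δ ^ (-(θ / (1 - θ))) * m := by
  have h1 : 0 < 1 - θ := by linarith
  by_cases h : s * m ^ (1 - θ) ≤ δ * s ^ (1 / θ)
  · have : 0 ≤ δ ^ (-(θ / (1 - θ))) * m := by positivity
    linarith
  push Not at h
  have hs0 : 0 < s := by
    rcases hs.eq_or_lt with rfl | h'
    · rw [Real.zero_rpow (by positivity)] at h; simp at h
    · exact h'
  have h2 : δ * s ^ ((1 - θ) / θ) < m ^ (1 - θ) := by
    have e : s ^ (1 / θ) = s * s ^ ((1 - θ) / θ) := by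
      rw [← Real.rpow_one_add' hs (by positivity)]
      congr 1; field_simp; ring
    rw [e] at h
    nlinarith
  have h3 : (δ * s ^ ((1 - θ) / θ)) ^ (θ / (1 - θ)) ≤ (m ^ (1 - θ)) ^ (θ / (1 - θ)) :=
    Real.rpow_le_rpow (by positivity) h2.le (by positivity)
  rw [Real.mul_rpow hδ.le (by positivity), ← Real.rpow_mul hs, ← Real.rpow_mul hm.le] at h3
  have e1 : (1 - θ) / θ * (θ / (1 - θ)) = 1 := by field_simp
  have e2 : (1 - θ) * (θ / (1 - θ)) = θ := by field_simp
  rw [e1, e2, Real.rpow_one] at h3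
  have h4 : s ≤ δ ^ (-(θ / (1 - θ))) * m ^ θ := by
    rw [Real.rpow_neg hδ.le, ← div_eq_inv_mul, le_div_iff₀ (by positivity)]
    linarith
  have h5 : 0 ≤ δ * s ^ (1 / θ) := by positivity
  calc s * m ^ (1 - θ) ≤ δ ^ (-(θ / (1 - θ))) * m ^ θ * m ^ (1 - θ) := by gcongr
    _ = δ ^ (-(θ / (1 - θ))) * m := by
        rw [mul_assoc, ← Real.rpow_add hm]; simp
    _ ≤ _ := by linarith

/-- With Cauchy radius `(n+1)^{1-θ}` the quotient `n!/r^n` is at most `n!^θ`, because `n! ≤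
(n+1)^n`. The Gaussian cost `b r²` stays linear in `n` exactly because `2(1-θ) ≤ 1`; this is where
`θ ≥ 1/2` enters. The linear cost `s r` goes to Young's inequality. -/
lemma factorial_div_radius_le {θ b δ : ℝ} (hθ : 1 / 2 ≤ θ) (hθ' : θ < 1) (hb : 0 ≤ b)
    (hδ : 0 < δ) : ∃ D : ℝ, 1 ≤ D ∧ ∀ (n : ℕ) (s : ℝ), 0 ≤ s →
      (n.factorial : ℝ) / ((n + 1 : ℝ) ^ (1 - θ)) ^ n *
        Real.exp (s * (n + 1 : ℝ) ^ (1 - θ) + b * ((n + 1 : ℝ) ^ (1 - θ)) ^ 2) ≤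
      D * D ^ n * (n.factorial : ℝ) ^ θ * Real.exp (δ * s ^ (1 / θ)) := by
  set A := δ ^ (-(θ / (1 - θ)))
  have hA : 0 ≤ A := by positivity
  refine ⟨Real.exp (A + b), Real.one_le_exp (by positivity), fun n s hs => ?_⟩
  have hn : (0 : ℝ) < n + 1 := by positivity
  have h1 := mul_rpow_le_young (by linarith) hθ' hδ hs hn
  have h2 : ((n + 1 : ℝ) ^ (1 - θ)) ^ 2 ≤ n + 1 := by
    rw [← Real.rpow_natCast, ← Real.rpow_mul hn.le]
    conv_rhs => rw [← Real.rpow_one (n + 1 : ℝ)]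
    refine Real.rpow_le_rpow_of_exponent_le (by linarith [(Nat.cast_nonneg n : (0 : ℝ) ≤ n)]) ?_
    push_cast; linarith
  have hf : (0 : ℝ) < n.factorial := by exact_mod_cast n.factorial_pos
  have h3 : (n.factorial : ℝ) / ((n + 1 : ℝ) ^ (1 - θ)) ^ n ≤ (n.factorial : ℝ) ^ θ := by
    rw [div_le_iff₀ (by positivity), ← Real.rpow_natCast, ← Real.rpow_mul hn.le, mul_comm (1 - θ),
      Real.rpow_mul hn.le, Real.rpow_natCast]
    calc (n.factorial : ℝ) = (n.factorial : ℝ) ^ θ * (n.factorial : ℝ) ^ (1 - θ) := by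
          rw [← Real.rpow_add hf]; simp
      _ ≤ _ := by
          gcongr
          exact_mod_cast (Nat.factorial_le_pow n).trans (Nat.pow_le_pow_left (Nat.le_succ n) n)
  calc _ ≤ (n.factorial : ℝ) ^ θ * Real.exp (δ * s ^ (1 / θ) + (A + b) * (n + 1)) := by
        have h4 := mul_le_mul_of_nonneg_left h2 hb
        exact mul_le_mul h3 (Real.exp_le_exp.2 (by linarith)) (Real.exp_pos _).le (by positivity)
    _ = _ := by
        rw [Real.exp_add, mul_comm (A + b), Real.exp_mul, mul_comm ((n : ℝ) + 1), ← Real.exp_mul,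
          mul_add, mul_one, Real.exp_add, mul_comm (A + b) (n : ℝ), Real.exp_nat_mul]
        ring

/-- This is the `θ`-th power of `x^n ≤ n! e^x` at `x = δ t^{1/θ}`. -/
lemma pow_le_factorial_mul_exp {θ δ t : ℝ} (hθ : 0 < θ) (hθ' : θ ≤ 1) (hδ : 0 < δ) (ht : 0 ≤ t)
    (n : ℕ) : t ^ n ≤ (δ ^ (-θ)) ^ n * (n.factorial : ℝ) ^ θ * Real.exp (δ * t ^ (1 / θ)) := by
  have hf : (0 : ℝ) < n.factorial := by exact_mod_cast n.factorial_pos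
  have h1 : (δ * t ^ (1 / θ)) ^ n ≤ n.factorial * Real.exp (δ * t ^ (1 / θ)) := by
    have := Real.pow_div_factorial_le_exp (δ * t ^ (1 / θ)) (by positivity) n
    rw [div_le_iff₀ hf] at this
    linarith
  have h2 := Real.rpow_le_rpow (by positivity) h1 hθ.le
  rw [Real.mul_rpow hf.le (Real.exp_pos _).le, ← Real.rpow_natCast, ← Real.rpow_mul (by positivity),
    mul_comm (n : ℝ), Real.rpow_mul (by positivity), Real.rpow_natCast,
    Real.mul_rpow hδ.le (by positivity), ← Real.rpow_mul ht, one_div_mul_cancel hθ.ne',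
    Real.rpow_one, mul_pow, ← Real.exp_mul] at h2
  have h3 : Real.exp (δ * t ^ (1 / θ) * θ) ≤ Real.exp (δ * t ^ (1 / θ)) :=
    Real.exp_le_exp.2 (mul_le_of_le_one_right (by positivity) hθ')
  have h4 : t ^ n = (δ ^ (-θ)) ^ n * ((δ ^ θ) ^ n * t ^ n) := by
    rw [← mul_assoc, ← mul_pow, ← Real.rpow_add hδ]; simp
  rw [h4, mul_assoc]
  exact mul_le_mul_of_nonneg_left (h2.trans (mul_le_mul_of_nonneg_left h3 (by positivity)))
    (by positivity)

/-- The asymmetry is deliberate: `t` will be a distance, and its square can be absorbed by a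
Gaussian, at the price of `σ = 1/θ ≤ 2`. -/
lemma add_rpow_le_sq {σ s t : ℝ} (hσ : 1 ≤ σ) (hσ' : σ ≤ 2) (hs : 0 ≤ s) (ht : 0 ≤ t) :
    (s + t) ^ σ ≤ 4 * s ^ σ + 4 + 4 * t ^ 2 := by
  have h2 : (2 : ℝ) ^ σ ≤ 4 := by
    calc (2 : ℝ) ^ σ ≤ 2 ^ (2 : ℝ) := Real.rpow_le_rpow_of_exponent_le (by norm_num) hσ'
      _ = 4 := by norm_num
  have ht2 : t ^ σ ≤ 1 + t ^ 2 := by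
    rcases le_total t 1 with h | h
    · have := Real.rpow_le_one ht h (by linarith : 0 ≤ σ)
      nlinarith
    · have := Real.rpow_le_rpow_of_exponent_le h hσ'
      rw [Real.rpow_two] at this
      linarith
  have hs2 : 0 ≤ s ^ σ := by positivity
  have ht3 : 0 ≤ t ^ σ := by positivity
  have hm : (s + t) ^ σ ≤ (2 * max s t) ^ σ := by
    refine Real.rpow_le_rpow (by positivity) ?_ (by linarith)
    linarith [le_max_left s t, le_max_right s t]
  rw [Real.mul_rpow (by norm_num) (le_max_of_le_left hs)] at hm
  have hmm : (max s t) ^ σ ≤ s ^ σ + t ^ σ := by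
    rcases max_cases s t with ⟨h, -⟩ | ⟨h, -⟩ <;> rw [h] <;> linarith
  have hm0 : 0 ≤ (max s t) ^ σ := Real.rpow_nonneg (le_max_of_le_left hs) _
  nlinarith

lemma one_le_one_div {θ : ℝ} (hθ : 1 / 2 ≤ θ) (hθ' : θ < 1) : 1 ≤ 1 / θ ∧ 1 / θ ≤ 2 := by
  have : 0 < θ := by linarith
  constructor
  · rw [le_div_iff₀ this]; linarith
  · rw [div_le_iff₀ this]; linarith

/-! ### Gelfand-Shilov bounds for entire functions with Gaussian bounds -/

lemma abs_apply_le_norm (x : RSp d) (i : Fin d) : |x i| ≤ ‖x‖ := by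
  simpa using PiLp.norm_apply_le x i

/-- An entire function with a Gaussian bound on `ℂ^d` restricts to an element of `S_θ`, with
explicit dependence of the bounds on the parameters `M`, `x`, `s`. -/
theorem gsNorm_le_of_entire {θ a b δ : ℝ} (hθ : 1 / 2 ≤ θ) (hθ' : θ < 1) (ha : 0 < a)
    (hb : 0 ≤ b) (hδ : 0 < δ) : ∃ K : ℝ, 0 < K ∧ ∃ D : ℝ, 0 < D ∧
      ∀ (F : (Fin d → ℂ) → ℂ) (M : ℝ) (x : RSp d) (s : Fin d → ℝ), ContDiff ℂ ∞ F → 0 ≤ M →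
        (∀ i, 0 ≤ s i) →
        (∀ (y : RSp d) (w : Fin d → ℂ), ‖F (ofR y + w)‖ ≤
          M * Real.exp (-a * ‖y - x‖ ^ 2 + ∑ i, (s i * ‖w i‖ + b * ‖w i‖ ^ 2))) →
        (∀ (β : Fin d → ℕ) (y : RSp d), ‖multiD β (fun y => F (ofR y)) y‖ ≤
          M * K * D ^ (∑ i, β i) * (∏ i, ((β i).factorial : ℝ)) ^ θ *
            Real.exp (δ * ∑ i, s i ^ (1 / θ)) * Real.exp (-a * ‖y - x‖ ^ 2)) ∧
        gsNorm θ D (fun y => F (ofR y)) ≤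
          ENNReal.ofReal (M * K * Real.exp (δ * ∑ i, s i ^ (1 / θ) + δ * ‖x‖ ^ (1 / θ))) := by
  obtain ⟨D₁, hD₁, hC⟩ := factorial_div_radius_le hθ hθ' hb hδ
  have hθ0 : 0 < θ := by linarith
  obtain ⟨hσ, hσ'⟩ := one_le_one_div hθ hθ'
  -- All `d` coordinates contribute `δ'|y|^{1/θ}`, and `|y|^{1/θ} ≤ 4|x|^{1/θ} + 4 + 4|y-x|²`. The
  -- choice makes the total cost at most `δ|x|^{1/θ}`, a constant, and `a|y-x|²`, which the Gaussian
  -- factor pays.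
  set δ' := min δ a / (4 * (d + 1)) with hδ'
  have hd' : 0 < δ' := by positivity
  have hdδ : 4 * (d * δ') ≤ min δ a := by
    have : 4 * (d * δ') = (d / (d + 1)) * min δ a := by rw [hδ']; field_simp
    rw [this]
    refine mul_le_of_le_one_left (by positivity) ?_
    rw [div_le_one (by positivity)]; linarith
  set D₂ := δ' ^ (-θ)
  have hD₂ : 0 < D₂ := by positivity
  set D := max D₁ D₂
  have hD : 0 < D := lt_max_of_lt_right hD₂
  refine ⟨D₁ ^ d * Real.exp (min δ a), by positivity, D, hD, ?_⟩
  intro F M x s hF hM hs hbd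
  have pt : ∀ (β : Fin d → ℕ) (y : RSp d), ‖multiD β (fun y => F (ofR y)) y‖ ≤
      M * D₁ ^ d * D ^ (∑ i, β i) * (∏ i, ((β i).factorial : ℝ)) ^ θ *
        Real.exp (δ * ∑ i, s i ^ (1 / θ)) * Real.exp (-a * ‖y - x‖ ^ 2) := by
    intro β y
    set r : Fin d → ℝ := fun i => (β i + 1 : ℝ) ^ (1 - θ) with hr
    have hr0 : ∀ i, 0 < r i := fun i => by positivity
    have h1 := norm_multiD_comp_ofR_le β r hr0 hF y
      (M := M * Real.exp (-a * ‖y - x‖ ^ 2 + ∑ i, (s i * r i + b * r i ^ 2))) fun w hw => by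
        refine (hbd y w).trans ?_
        gcongr with i _ i _
        · exact hs i
        · exact hw i
        · exact hw i
    refine h1.trans ?_
    calc M * Real.exp (-a * ‖y - x‖ ^ 2 + ∑ i, (s i * r i + b * r i ^ 2)) *
          ∏ i, (((β i).factorial : ℝ) / r i ^ β i)
        = M * Real.exp (-a * ‖y - x‖ ^ 2) * ∏ i, ((((β i).factorial : ℝ) / r i ^ β i) *
            Real.exp (s i * r i + b * r i ^ 2)) := by
          rw [Real.exp_add, Real.exp_sum, Finset.prod_mul_distrib]; ring
      _ ≤ M * Real.exp (-a * ‖y - x‖ ^ 2) * ∏ i, (D₁ * D₁ ^ β i * ((β i).factorial : ℝ) ^ θ *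
            Real.exp (δ * s i ^ (1 / θ))) := by
          exact mul_le_mul_of_nonneg_left (Finset.prod_le_prod (fun i _ => mul_nonneg
            (div_nonneg (by positivity) (pow_nonneg (hr0 i).le _)) (Real.exp_pos _).le)
            fun i _ => hC (β i) (s i) (hs i)) (by positivity)
      _ = M * D₁ ^ d * D₁ ^ (∑ i, β i) * (∏ i, ((β i).factorial : ℝ)) ^ θ *
            Real.exp (δ * ∑ i, s i ^ (1 / θ)) * Real.exp (-a * ‖y - x‖ ^ 2) := by
          rw [Finset.prod_mul_distrib, Finset.prod_mul_distrib, Finset.prod_mul_distrib,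
            Finset.prod_const, Finset.prod_pow_eq_pow_sum, Finset.mul_sum, Real.exp_sum,
            Real.finsetProd_rpow _ _ (fun i _ => by positivity)]
          simp only [Finset.card_univ, Fintype.card_fin]
          ring
      _ ≤ _ := by
          gcongr
          exact le_max_left _ _
  have he1 : 1 ≤ Real.exp (min δ a) := Real.one_le_exp (by positivity)
  refine ⟨fun β y => (pt β y).trans ?_, ?_⟩
  · gcongr
    exact le_mul_of_one_le_right (by positivity) he1
  refine iSup_le fun α => iSup_le fun β => iSup_le fun y => ENNReal.ofReal_le_ofReal ?_
  rw [div_le_iff₀ (gsWeight_pos θ hD α β)]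
  have hy : ∏ i, |y i| ^ α i ≤ D ^ (∑ i, α i) * (∏ i, ((α i).factorial : ℝ)) ^ θ *
      Real.exp (min δ a + δ * ‖x‖ ^ (1 / θ) + a * ‖y - x‖ ^ 2) := by
    calc ∏ i, |y i| ^ α i
        ≤ ∏ i, (D ^ α i * ((α i).factorial : ℝ) ^ θ * Real.exp (δ' * ‖y‖ ^ (1 / θ))) := by
          refine Finset.prod_le_prod (fun i _ => by positivity) fun i _ => ?_
          refine (pow_le_factorial_mul_exp hθ0 hθ'.le hd' (abs_nonneg (y i)) (α i)).trans ?_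
          gcongr
          · exact le_max_right _ _
          · exact abs_apply_le_norm y i
      _ = D ^ (∑ i, α i) * (∏ i, ((α i).factorial : ℝ)) ^ θ *
            Real.exp (d * δ' * ‖y‖ ^ (1 / θ)) := by
          rw [Finset.prod_mul_distrib, Finset.prod_mul_distrib, Finset.prod_pow_eq_pow_sum,
            Real.finsetProd_rpow _ _ (fun i _ => by positivity), Finset.prod_const,
            ← Real.exp_nat_mul]
          simp only [Finset.card_univ, Fintype.card_fin]
          ring_nf
      _ ≤ _ := by
          gcongr
          have h1 : ‖y‖ ^ (1 / θ) ≤ 4 * ‖x‖ ^ (1 / θ) + 4 + 4 * ‖y - x‖ ^ 2 := by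
            refine le_trans ?_ (add_rpow_le_sq hσ hσ' (norm_nonneg x) (norm_nonneg (y - x)))
            refine Real.rpow_le_rpow (norm_nonneg _) ?_ (by positivity)
            simpa using norm_add_le x (y - x)
          have hx0 : 0 ≤ ‖x‖ ^ (1 / θ) := by positivity
          calc d * δ' * ‖y‖ ^ (1 / θ)
              ≤ d * δ' * (4 * ‖x‖ ^ (1 / θ) + 4 + 4 * ‖y - x‖ ^ 2) := by gcongr
            _ = 4 * (d * δ') + 4 * (d * δ') * ‖x‖ ^ (1 / θ) + 4 * (d * δ') * ‖y - x‖ ^ 2 := by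
                ring
            _ ≤ min δ a + min δ a * ‖x‖ ^ (1 / θ) + min δ a * ‖y - x‖ ^ 2 := by gcongr
            _ ≤ _ := by
                gcongr
                · exact min_le_left _ _
                · exact min_le_right _ _
  calc (∏ i, |y i| ^ α i) * ‖multiD β (fun y => F (ofR y)) y‖
      ≤ (D ^ (∑ i, α i) * (∏ i, ((α i).factorial : ℝ)) ^ θ *
          Real.exp (min δ a + δ * ‖x‖ ^ (1 / θ) + a * ‖y - x‖ ^ 2)) *
        (M * D₁ ^ d * D ^ (∑ i, β i) * (∏ i, ((β i).factorial : ℝ)) ^ θ *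
          Real.exp (δ * ∑ i, s i ^ (1 / θ)) * Real.exp (-a * ‖y - x‖ ^ 2)) :=
        mul_le_mul hy (pt β y) (norm_nonneg _) (by positivity)
    _ = _ := by
        have e : Real.exp (a * ‖y - x‖ ^ 2) * Real.exp (-a * ‖y - x‖ ^ 2) = 1 := by
          rw [← Real.exp_add]; simp
        simp only [Real.exp_add, gsWeight, pow_add]
        linear_combination (D ^ (∑ i, α i) * (∏ i, ((α i).factorial : ℝ)) ^ θ *
          Real.exp (min δ a) * Real.exp (δ * ‖x‖ ^ (1 / θ)) * M * D₁ ^ d * D ^ (∑ i, β i) *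
          (∏ i, ((β i).factorial : ℝ)) ^ θ * Real.exp (δ * ∑ i, s i ^ (1 / θ))) * e

/-! ### Gaussian wave packets -/

/-- The bilinear form `⟨Cv, w⟩`. -/
def quad (C : Matrix (Fin d) (Fin d) ℂ) (v w : Fin d → ℂ) : ℂ := C.mulVec v ⬝ᵥ w

lemma quad_add_left (C : Matrix (Fin d) (Fin d) ℂ) (u v w : Fin d → ℂ) :
    quad C (u + v) w = quad C u w + quad C v w := by
  simp [quad, Matrix.mulVec_add, add_dotProduct]

lemma quad_add_right (C : Matrix (Fin d) (Fin d) ℂ) (u v w : Fin d → ℂ) :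
    quad C u (v + w) = quad C u v + quad C u w := by
  simp [quad, dotProduct_add]

lemma quad_sub_left (C : Matrix (Fin d) (Fin d) ℂ) (u v w : Fin d → ℂ) :
    quad C (u - v) w = quad C u w - quad C v w := by
  simp [quad, Matrix.mulVec_sub, sub_dotProduct]

lemma quad_sub_right (C : Matrix (Fin d) (Fin d) ℂ) (u v w : Fin d → ℂ) :
    quad C u (v - w) = quad C u v - quad C u w := by
  simp [quad, dotProduct_sub]

lemma quad_comm {C : Matrix (Fin d) (Fin d) ℂ} (hC : C.IsSymm) (v w : Fin d → ℂ) :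
    quad C v w = quad C w v := by
  unfold quad
  rw [dotProduct_comm, Matrix.dotProduct_mulVec, ← Matrix.mulVec_transpose, hC.eq]

lemma norm_quad_le (C : Matrix (Fin d) (Fin d) ℂ) (v w : Fin d → ℂ) :
    ‖quad C v w‖ ≤ (∑ i, ∑ j, ‖C i j‖) * ‖v‖ * ‖w‖ := by
  unfold quad dotProduct Matrix.mulVec dotProduct
  refine (norm_sum_le _ _).trans ?_
  rw [Finset.sum_mul, Finset.sum_mul]
  refine Finset.sum_le_sum fun i _ => ?_
  rw [norm_mul]
  refine mul_le_mul ?_ (norm_le_pi_norm w i) (norm_nonneg _) (by positivity)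
  refine (norm_sum_le _ _).trans ?_
  rw [Finset.sum_mul]
  refine Finset.sum_le_sum fun j _ => ?_
  rw [norm_mul]
  exact mul_le_mul_of_nonneg_left (norm_le_pi_norm v j) (norm_nonneg _)

/-- A symmetric matrix whose imaginary part is positive definite. -/
def IsWindow (C : Matrix (Fin d) (Fin d) ℂ) : Prop :=
  C.IsSymm ∧ ∃ a : ℝ, 0 < a ∧ ∀ v : RSp d, a * ‖v‖ ^ 2 ≤ (quad C (ofR v) (ofR v)).im

lemma norm_ofR_le (v : RSp d) : ‖ofR v‖ ≤ ‖v‖ := by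
  rw [pi_norm_le_iff_of_nonneg (norm_nonneg _)]
  intro i
  simpa [ofR] using abs_apply_le_norm v i

lemma continuous_ofR : Continuous (ofR : RSp d → Fin d → ℂ) := (ofRL (d := d)).continuous

lemma im_quad_ofR (C : Matrix (Fin d) (Fin d) ℂ) (v : RSp d) :
    (quad C (ofR v) (ofR v)).im = v.ofLp ⬝ᵥ (C.map Complex.im).mulVec v.ofLp := by
  simp [quad, dotProduct, Matrix.mulVec, ofR, Finset.sum_mul, Finset.mul_sum]
  refine Finset.sum_congr rfl fun i _ => Finset.sum_congr rfl fun j _ => ?_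
  ring

/-- The constant `a` is the minimum of the form on the unit sphere; the empty sphere, `d = 0`, is
separate. -/
lemma isWindow_of_posDef {C : Matrix (Fin d) (Fin d) ℂ} (hC : C.IsSymm)
    (hp : (C.map Complex.im).PosDef) : IsWindow C := by
  refine ⟨hC, ?_⟩
  have hcont : Continuous fun v : RSp d => (quad C (ofR v) (ofR v)).im := by
    have := continuous_ofR (d := d)
    unfold quad dotProduct Matrix.mulVec dotProduct
    fun_prop
  have hpos : ∀ v : RSp d, v ≠ 0 → 0 < (quad C (ofR v) (ofR v)).im := fun v hv => by
    rw [im_quad_ofR]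
    simpa using hp.dotProduct_mulVec_pos (x := v.ofLp) (by simpa using hv)
  rcases (Metric.sphere (0 : RSp d) 1).eq_empty_or_nonempty with h | h
  · refine ⟨1, one_pos, fun v => ?_⟩
    have hv : v = 0 := by
      by_contra hv
      have : (‖v‖⁻¹ • v) ∈ Metric.sphere (0 : RSp d) 1 := by
        simp [norm_smul, norm_ne_zero_iff.2 hv]
      rw [h] at this
      exact this
    subst hv
    rw [im_quad_ofR]; simp
  · obtain ⟨v₀, hv₀, hmin⟩ := (isCompact_sphere (0 : RSp d) 1).exists_isMinOn h hcont.continuousOn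
    have h0 : v₀ ≠ 0 := by
      rintro rfl; simp at hv₀
    refine ⟨_, hpos v₀ h0, fun v => ?_⟩
    by_cases hv : v = 0
    · subst hv
      rw [im_quad_ofR C 0]; simp
    have hn : ‖v‖ ≠ 0 := norm_ne_zero_iff.2 hv
    have h1 := hmin (a := ‖v‖⁻¹ • v) (by simp [norm_smul, hn])
    simp only [Set.mem_ofPred_eq] at h1
    rw [im_quad_ofR C (‖v‖⁻¹ • v)] at h1
    simp only [WithLp.ofLp_smul, Matrix.mulVec_smul, smul_dotProduct, dotProduct_smul] at h1
    rw [← im_quad_ofR] at h1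
    simp only [smul_eq_mul] at h1
    calc _ ≤ (‖v‖⁻¹ * (‖v‖⁻¹ * (quad C (ofR v) (ofR v)).im)) * ‖v‖ ^ 2 := by gcongr
      _ = _ := by field_simp

/-- The wave packet `exp(-i⟨ξ, z⟩ + (i/2)⟨C(z - x), z - x⟩)` as an entire function, `p = (x, ξ)`. -/
def packetEnt (C : Matrix (Fin d) (Fin d) ℂ) (p : RSp d × RSp d) (z : Fin d → ℂ) : ℂ :=
  Complex.exp (-Complex.I * (ofR p.2 ⬝ᵥ z) +
    Complex.I / 2 * quad C (z - ofR p.1) (z - ofR p.1))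

/-- The wave packet `exp(-i⟨ξ, y⟩ + (i/2)⟨C(y - x), y - x⟩)`, `p = (x, ξ)`. -/
def packet (C : Matrix (Fin d) (Fin d) ℂ) (p : RSp d × RSp d) (y : RSp d) : ℂ :=
  packetEnt C p (ofR y)

lemma contDiff_packetEnt (C : Matrix (Fin d) (Fin d) ℂ) (p : RSp d × RSp d) :
    ContDiff ℂ ∞ (packetEnt C p) := by
  unfold packetEnt quad dotProduct Matrix.mulVec dotProduct
  simp only [Pi.sub_apply]
  fun_prop

lemma contDiff_packet (C : Matrix (Fin d) (Fin d) ℂ) (p : RSp d × RSp d) :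
    ContDiff ℝ ∞ (packet C p) := contDiff_comp_ofR (contDiff_packetEnt C p)

lemma continuous_packet (C : Matrix (Fin d) (Fin d) ℂ) :
    Continuous fun q : (RSp d × RSp d) × RSp d => packet C q.1 q.2 := by
  unfold packet packetEnt quad dotProduct Matrix.mulVec dotProduct ofR
  fun_prop

lemma sq_pi_norm_le (w : Fin d → ℂ) : ‖w‖ ^ 2 ≤ ∑ i, ‖w i‖ ^ 2 := by
  rw [← Real.le_sqrt (norm_nonneg _) (by positivity), pi_norm_le_iff_of_nonneg (by positivity)]
  intro i
  refine Real.le_sqrt_of_sq_le ?_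
  exact Finset.single_le_sum (f := fun i => ‖w i‖ ^ 2) (fun i _ => by positivity)
    (Finset.mem_univ i)

lemma pi_norm_le_sum (w : Fin d → ℂ) : ‖w‖ ≤ ∑ i, ‖w i‖ := by
  rw [pi_norm_le_iff_of_nonneg (by positivity)]
  intro i
  exact Finset.single_le_sum (f := fun i => ‖w i‖) (fun i _ => by positivity) (Finset.mem_univ i)

lemma norm_dotProduct_ofR_le (ξ : RSp d) (w : Fin d → ℂ) :
    ‖ofR ξ ⬝ᵥ w‖ ≤ ∑ i, |ξ i| * ‖w i‖ := by
  refine (norm_sum_le _ _).trans (le_of_eq (Finset.sum_congr rfl fun i _ => ?_))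
  simp [ofR]

lemma im_dotProduct_ofR_ofR (ξ y : RSp d) : (ofR ξ ⬝ᵥ ofR y).im = 0 := by
  simp [dotProduct, ofR]

/-- The real quadratic part gives `-(a/2)|y-x|²`; half of it is spent on the cross term `κ|y-x||w|`
by completing a square. What remains has the shape required by `gsNorm_le_of_entire`, with `s_i =
|ξ_i|`. -/
lemma norm_packetEnt_le {C : Matrix (Fin d) (Fin d) ℂ} {a κ : ℝ} (ha : 0 < a)
    (hC : ∀ v : RSp d, a * ‖v‖ ^ 2 ≤ (quad C (ofR v) (ofR v)).im)
    (hκ : ∀ v w, ‖quad C v w‖ ≤ κ * ‖v‖ * ‖w‖) (hκ0 : 0 ≤ κ) (p : RSp d × RSp d) (y : RSp d)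
    (w : Fin d → ℂ) : ‖packetEnt C p (ofR y + w)‖ ≤
      Real.exp (-(a / 4) * ‖y - p.1‖ ^ 2 +
        ∑ i, (|p.2 i| * ‖w i‖ + (κ ^ 2 / a + κ / 2) * ‖w i‖ ^ 2)) := by
  obtain ⟨x, ξ⟩ := p
  rw [packetEnt, Complex.norm_exp]
  refine Real.exp_le_exp.2 ?_
  set v := y - x
  have e1 : ofR y + w - ofR x = ofR v + w := by
    simp only [v, ofR_sub]; abel
  simp only [e1, dotProduct_add, quad_add_left, quad_add_right]
  have h1 : (ofR ξ ⬝ᵥ w).im ≤ ∑ i, |ξ i| * ‖w i‖ :=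
    (Complex.abs_im_le_norm _ |> (le_abs_self _).trans).trans (norm_dotProduct_ofR_le ξ w)
  have h2 := hC v
  have hq : ∀ u u', -(quad C u u').im ≤ κ * ‖u‖ * ‖u'‖ := fun u u' =>
    ((neg_le_abs _).trans (Complex.abs_im_le_norm _)).trans (hκ u u')
  have h3 : -(quad C (ofR v) w).im ≤ κ * ‖v‖ * ‖w‖ := (hq _ _).trans (by
    gcongr; exact norm_ofR_le v)
  have h4 : -(quad C w (ofR v)).im ≤ κ * ‖w‖ * ‖v‖ := (hq _ _).trans (by
    gcongr; exact norm_ofR_le v)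
  have h5 := hq w w
  have h6 := sq_pi_norm_le w
  have h7 : κ * ‖v‖ * ‖w‖ ≤ a / 4 * ‖v‖ ^ 2 + κ ^ 2 / a * ‖w‖ ^ 2 := by
    have h8 : κ ^ 2 / a * ‖w‖ ^ 2 = (κ * ‖w‖) ^ 2 / a := by ring
    rw [h8]
    have h9 : 0 ≤ (a / 2 * ‖v‖ - κ * ‖w‖) ^ 2 / a := by positivity
    have h10 : (a / 2 * ‖v‖ - κ * ‖w‖) ^ 2 / a =
        a / 4 * ‖v‖ ^ 2 + (κ * ‖w‖) ^ 2 / a - κ * ‖v‖ * ‖w‖ := by field_simp; ring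
    linarith
  have h11 : (κ ^ 2 / a + κ / 2) * ‖w‖ ^ 2 ≤ (κ ^ 2 / a + κ / 2) * ∑ i, ‖w i‖ ^ 2 := by gcongr
  rw [Finset.sum_add_distrib, ← Finset.mul_sum]
  simp only [Complex.add_re, Complex.mul_re, Complex.neg_re, Complex.I_re, Complex.neg_im,
    Complex.I_im, Complex.add_im, Complex.div_ofNat_re, Complex.div_ofNat_im,
    im_dotProduct_ofR_ofR]
  nlinarith

lemma norm_packet_le {C : Matrix (Fin d) (Fin d) ℂ} {a : ℝ}
    (hC : ∀ v : RSp d, a * ‖v‖ ^ 2 ≤ (quad C (ofR v) (ofR v)).im) (p : RSp d × RSp d)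
    (y : RSp d) : ‖packet C p y‖ ≤ Real.exp (-(a / 2) * ‖y - p.1‖ ^ 2) := by
  rw [packet, packetEnt, Complex.norm_exp]
  refine Real.exp_le_exp.2 ?_
  have h := hC (y - p.1)
  rw [← ofR_sub]
  simp only [Complex.add_re, Complex.mul_re, Complex.neg_re, Complex.I_re, Complex.neg_im,
    Complex.I_im, Complex.div_ofNat_re, Complex.div_ofNat_im, im_dotProduct_ofR_ofR]
  linarith

/-- The quotient of the two packets is `e^Δ` with `|Δ| ≤ ‖p'-p‖ L(1 + |y-x| + ∑|w_i|)`, hence `|e^Δ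
- 1| ≤ |Δ|e^{|Δ|}`. The factor `‖p'-p‖` gives continuity in `p`; the linear exponent costs half of
the Gaussian rate and enlarges `s_i` by `2L`. -/
lemma norm_packetEnt_sub_le {C : Matrix (Fin d) (Fin d) ℂ} {a κ : ℝ} (ha : 0 < a)
    (hC : ∀ v : RSp d, a * ‖v‖ ^ 2 ≤ (quad C (ofR v) (ofR v)).im)
    (hκ : ∀ v w, ‖quad C v w‖ ≤ κ * ‖v‖ * ‖w‖) (hκ0 : 0 ≤ κ) (p : RSp d × RSp d) :
    ∃ L : ℝ, 0 ≤ L ∧ ∀ p' : RSp d × RSp d, ‖p' - p‖ ≤ 1 → ∀ (y : RSp d) (w : Fin d → ℂ),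
      ‖packetEnt C p' (ofR y + w) - packetEnt C p (ofR y + w)‖ ≤
        ‖p' - p‖ * Real.exp (2 * L + 8 * L ^ 2 / a) *
        Real.exp (-(a / 8) * ‖y - p.1‖ ^ 2 +
          ∑ i, ((|p.2 i| + 2 * L) * ‖w i‖ + (κ ^ 2 / a + κ / 2) * ‖w i‖ ^ 2)) := by
  obtain ⟨x, ξ⟩ := p
  refine ⟨d + d * ‖x‖ + 1 + 2 * κ, by positivity, ?_⟩
  rintro ⟨x', ξ'⟩ hp y w
  set L := d + d * ‖x‖ + 1 + 2 * κ with hL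
  have hL0 : 0 ≤ L := by positivity
  set h := ‖(x', ξ') - (x, ξ)‖
  have hh : 0 ≤ h := norm_nonneg _
  have hx : ‖x' - x‖ ≤ h := norm_fst_le ((x', ξ') - (x, ξ))
  have hξ : ‖ξ' - ξ‖ ≤ h := norm_snd_le ((x', ξ') - (x, ξ))
  set v := y - x
  set S := ∑ i, ‖w i‖
  have hS : 0 ≤ S := by positivity
  set z := ofR y + w
  set u := z - ofR x
  set η := ofR (x' - x)
  set Δ := -Complex.I * (ofR (ξ' - ξ) ⬝ᵥ z) +
    Complex.I / 2 * (quad C η η - quad C u η - quad C η u) with hΔ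
  have e1 : packetEnt C (x', ξ') z = packetEnt C (x, ξ) z * Complex.exp Δ := by
    rw [packetEnt, packetEnt, ← Complex.exp_add]
    have : z - ofR x' = u - η := by simp only [u, η, ofR_sub]; abel
    change Complex.exp (-Complex.I * (ofR ξ' ⬝ᵥ z) + Complex.I / 2 * quad C (z - ofR x') (z - ofR x'))
      = Complex.exp (-Complex.I * (ofR ξ ⬝ᵥ z) + Complex.I / 2 * quad C u u + Δ)
    rw [this]
    clear_value u η
    simp only [hΔ, quad_sub_left, quad_sub_right, ofR_sub, sub_dotProduct]
    congr 1
    ring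
  have hu : ‖u‖ ≤ ‖v‖ + S := by
    have : u = ofR v + w := by simp only [u, z, v, ofR_sub]; abel
    rw [this]
    exact (norm_add_le _ _).trans (add_le_add (norm_ofR_le v) (pi_norm_le_sum w))
  have hη : ‖η‖ ≤ h := (norm_ofR_le _).trans hx
  have hz : ‖ofR (ξ' - ξ) ⬝ᵥ z‖ ≤ h * (d * (‖v‖ + ‖x‖) + S) := by
    refine (norm_dotProduct_ofR_le _ _).trans ?_
    calc ∑ i, |(ξ' - ξ) i| * ‖z i‖ ≤ ∑ i, h * ((‖v‖ + ‖x‖) + ‖w i‖) := by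
          refine Finset.sum_le_sum fun i _ => ?_
          have h1 : ‖z i‖ ≤ (‖v‖ + ‖x‖) + ‖w i‖ := by
            refine (norm_add_le _ _).trans (add_le_add ?_ le_rfl)
            have h2 : ‖y‖ ≤ ‖v‖ + ‖x‖ := by
              simpa [v] using norm_add_le (y - x) x
            simpa [ofR] using (abs_apply_le_norm y i).trans h2
          exact mul_le_mul ((abs_apply_le_norm _ i).trans hξ) h1 (norm_nonneg _) hh
      _ = _ := by
          rw [← Finset.mul_sum, Finset.sum_add_distrib]
          simp only [Finset.sum_const, Finset.card_univ, Fintype.card_fin, nsmul_eq_mul, S]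
  set τ := L * (1 + ‖v‖ + S) with hτ
  have hτ0 : 0 ≤ τ := by positivity
  have hΔn : ‖Δ‖ ≤ h * τ := by
    have hq1 : ‖quad C η η‖ ≤ κ * h := (hκ η η).trans (by
      have : ‖η‖ * ‖η‖ ≤ h * 1 := mul_le_mul hη (hη.trans hp) (norm_nonneg _) hh
      rw [mul_assoc]; rw [mul_one] at this; gcongr)
    have hq2 : ‖quad C u η‖ ≤ κ * (‖v‖ + S) * h := (hκ u η).trans (by gcongr)
    have hq3 : ‖quad C η u‖ ≤ κ * h * (‖v‖ + S) := (hκ η u).trans (by gcongr)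
    have h1 : ‖Δ‖ ≤ ‖ofR (ξ' - ξ) ⬝ᵥ z‖ +
        1 / 2 * (‖quad C η η‖ + ‖quad C u η‖ + ‖quad C η u‖) := by
      refine (norm_add_le _ _).trans ?_
      simp only [norm_mul, norm_neg, Complex.norm_I, one_mul, norm_div, Complex.norm_ofNat]
      gcongr
      exact (norm_sub_le _ _).trans (add_le_add (norm_sub_le _ _) le_rfl)
    have hd0 : (0 : ℝ) ≤ d := by positivity
    have hv0 : 0 ≤ ‖v‖ := norm_nonneg _
    have hx0 : 0 ≤ ‖x‖ := norm_nonneg _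
    have h2 : ‖Δ‖ ≤ h * ((d * (‖v‖ + ‖x‖) + S) + κ + κ * (‖v‖ + S)) := by
      have : 0 ≤ κ * h := by positivity
      nlinarith
    refine h2.trans (mul_le_mul_of_nonneg_left ?_ hh)
    rw [hτ, hL]
    have i1 : 0 ≤ (d : ℝ) * S := by positivity
    have i2 : 0 ≤ (d : ℝ) * ‖x‖ * ‖v‖ := by positivity
    have i3 : 0 ≤ (d : ℝ) * ‖x‖ * S := by positivity
    have i4 : 0 ≤ κ * ‖v‖ := by positivity
    have i5 : 0 ≤ κ * S := by positivity
    nlinarith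
  have hexp : ‖Complex.exp Δ - 1‖ ≤ h * Real.exp (2 * τ) := by
    have h1 := Complex.norm_exp_sub_sum_le_norm_mul_exp Δ 1
    simp only [Finset.range_one, Finset.sum_singleton, pow_zero, Nat.factorial_zero,
      Nat.cast_one, div_one, pow_one] at h1
    refine h1.trans ?_
    have h2 : ‖Δ‖ ≤ τ := hΔn.trans (mul_le_of_le_one_left hτ0 hp)
    have h3 : τ ≤ Real.exp τ := by linarith [Real.add_one_le_exp τ]
    calc ‖Δ‖ * Real.exp ‖Δ‖ ≤ (h * Real.exp τ) * Real.exp τ :=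
          mul_le_mul (hΔn.trans (by gcongr)) (Real.exp_le_exp.2 h2) (Real.exp_pos _).le
            (by positivity)
      _ = _ := by rw [mul_assoc, ← Real.exp_add, two_mul]
  rw [e1, ← mul_sub_one, norm_mul]
  calc ‖packetEnt C (x, ξ) z‖ * ‖Complex.exp Δ - 1‖
      ≤ Real.exp (-(a / 4) * ‖v‖ ^ 2 + ∑ i, (|ξ i| * ‖w i‖ + (κ ^ 2 / a + κ / 2) * ‖w i‖ ^ 2)) *
        (h * Real.exp (2 * τ)) :=
        mul_le_mul (norm_packetEnt_le ha hC hκ hκ0 (x, ξ) y w) hexp (norm_nonneg _)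
          (Real.exp_pos _).le
    _ = h * Real.exp (-(a / 4) * ‖v‖ ^ 2 +
        ∑ i, (|ξ i| * ‖w i‖ + (κ ^ 2 / a + κ / 2) * ‖w i‖ ^ 2) + 2 * τ) := by
        rw [Real.exp_add _ (2 * τ)]; ring
    _ ≤ h * Real.exp (2 * L + 8 * L ^ 2 / a + (-(a / 8) * ‖v‖ ^ 2 +
        ∑ i, ((|ξ i| + 2 * L) * ‖w i‖ + (κ ^ 2 / a + κ / 2) * ‖w i‖ ^ 2))) := by
        refine mul_le_mul_of_nonneg_left (Real.exp_le_exp.2 ?_) hh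
        have s1 : ∑ i, ((|ξ i| + 2 * L) * ‖w i‖ + (κ ^ 2 / a + κ / 2) * ‖w i‖ ^ 2) =
            ∑ i, (|ξ i| * ‖w i‖ + (κ ^ 2 / a + κ / 2) * ‖w i‖ ^ 2) + 2 * L * S := by
          rw [Finset.mul_sum, ← Finset.sum_add_distrib]
          exact Finset.sum_congr rfl fun i _ => by ring
        have s2 : 2 * L * ‖v‖ ≤ a / 8 * ‖v‖ ^ 2 + 8 * L ^ 2 / a := by
          have h12 : 0 ≤ (a * ‖v‖ - 8 * L) ^ 2 / (8 * a) := by positivity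
          have h13 : (a * ‖v‖ - 8 * L) ^ 2 / (8 * a) =
            a / 8 * ‖v‖ ^ 2 + 8 * L ^ 2 / a - 2 * L * ‖v‖ := by field_simp; ring
          linarith
        rw [s1, hτ]
        have hv8 : 0 ≤ a / 8 * ‖v‖ ^ 2 := by positivity
        linarith
    _ = _ := by rw [Real.exp_add (2 * L + 8 * L ^ 2 / a)]; ring

/-- At zero frequency all `s_i` vanish, so the derivative bounds are uniform in the centre. This is
what integration by parts against a character will need. -/
lemma packet_zero_right_bounds {θ : ℝ} (hθ : 1 / 2 ≤ θ) (hθ' : θ < 1)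
    {C : Matrix (Fin d) (Fin d) ℂ} (hC : IsWindow C) :
    ∃ a : ℝ, 0 < a ∧ ∃ K : ℝ, 0 < K ∧ ∃ D : ℝ, 0 < D ∧ ∀ (x : RSp d) (β : Fin d → ℕ) (y : RSp d),
      ‖multiD β (packet C (x, 0)) y‖ ≤
        K * D ^ (∑ i, β i) * (∏ i, ((β i).factorial : ℝ)) ^ θ * Real.exp (-a * ‖y - x‖ ^ 2) := by
  obtain ⟨-, a, ha, hCa⟩ := hC
  set κ := ∑ i, ∑ j, ‖C i j‖
  have hκ0 : 0 ≤ κ := by positivity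
  obtain ⟨K, hK, D, hD, h⟩ := gsNorm_le_of_entire (d := d) hθ hθ' (a := a / 4)
    (b := κ ^ 2 / a + κ / 2) (δ := 1) (by positivity) (by positivity) one_pos
  refine ⟨a / 4, by positivity, K, hK, D, hD, fun x β y => ?_⟩
  have hθ0 : 1 / θ ≠ 0 := by
    have : 0 < θ := by linarith
    positivity
  have h1 := (h (packetEnt C (x, 0)) 1 x (fun _ => 0) (contDiff_packetEnt C _) zero_le_one
    (fun _ => le_rfl) fun y w => by
      simpa using norm_packetEnt_le ha hCa (norm_quad_le C) hκ0 (x, 0) y w).1 β y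
  simp only [Real.zero_rpow hθ0, Finset.sum_const_zero, mul_zero, Real.exp_zero, mul_one,
    one_mul] at h1
  exact h1

/-- The single `D` depends on `δ` but not on `p`. This suffices because an ultradistribution is
bounded with respect to `gsNorm θ D` for every `D`. The rate `δ/(d+1)` leaves room for the `d`
frequency terms and the position term. -/
lemma gsNorm_packet_bounds {θ δ : ℝ} (hθ : 1 / 2 ≤ θ) (hθ' : θ < 1) (hδ : 0 < δ)
    {C : Matrix (Fin d) (Fin d) ℂ} (hC : IsWindow C) :
    ∃ K : ℝ, 0 < K ∧ ∃ D : ℝ, 0 < D ∧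
      (∀ p, gsNorm θ D (packet C p) ≤ ENNReal.ofReal (K * Real.exp (δ * ‖p‖ ^ (1 / θ)))) ∧
      ∀ p, ∃ K' : ℝ, 0 ≤ K' ∧ ∀ p', ‖p' - p‖ ≤ 1 →
        gsNorm θ D (packet C p' - packet C p) ≤ ENNReal.ofReal (‖p' - p‖ * K') := by
  obtain ⟨-, a, ha, hCa⟩ := hC
  have hθ0 : 0 < θ := by linarith
  set κ := ∑ i, ∑ j, ‖C i j‖
  have hκ0 : 0 ≤ κ := by positivity
  have hδ1 : 0 < δ / (d + 1) := by positivity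
  obtain ⟨K, hK, D, hD, h⟩ := gsNorm_le_of_entire (d := d) hθ hθ' (a := a / 8)
    (b := κ ^ 2 / a + κ / 2) (by positivity) (by positivity) hδ1
  refine ⟨K, hK, D, hD, fun p => ?_, fun p => ?_⟩
  · have h1 := (h (packetEnt C p) 1 p.1 (fun i => |p.2 i|) (contDiff_packetEnt C _) zero_le_one
      (fun _ => abs_nonneg _) fun y w => by
        rw [one_mul]
        refine (norm_packetEnt_le ha hCa (norm_quad_le C) hκ0 p y w).trans ?_
        have : 0 ≤ a * ‖y - p.1‖ ^ 2 := by positivity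
        refine Real.exp_le_exp.2 (add_le_add ?_ le_rfl)
        linarith).2
    refine h1.trans (ENNReal.ofReal_le_ofReal ?_)
    rw [one_mul]
    refine mul_le_mul_of_nonneg_left (Real.exp_le_exp.2 ?_) hK.le
    have h2 : ∑ i, |p.2 i| ^ (1 / θ) ≤ d * ‖p‖ ^ (1 / θ) := by
      calc ∑ i, |p.2 i| ^ (1 / θ) ≤ ∑ _i : Fin d, ‖p‖ ^ (1 / θ) := by
            refine Finset.sum_le_sum fun i _ => Real.rpow_le_rpow (abs_nonneg _)
              ((abs_apply_le_norm _ i).trans (norm_snd_le p)) (by positivity)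
        _ = _ := by simp
    have h3 : ‖p.1‖ ^ (1 / θ) ≤ ‖p‖ ^ (1 / θ) :=
      Real.rpow_le_rpow (norm_nonneg _) (norm_fst_le p) (by positivity)
    calc _ ≤ δ / (d + 1) * (d * ‖p‖ ^ (1 / θ)) + δ / (d + 1) * ‖p‖ ^ (1 / θ) := by gcongr
      _ = _ := by field_simp
  · obtain ⟨L, hL, hLb⟩ := norm_packetEnt_sub_le ha hCa (norm_quad_le C) hκ0 p
    refine ⟨Real.exp (2 * L + 8 * L ^ 2 / a) * K *
      Real.exp (δ / (d + 1) * ∑ i, (|p.2 i| + 2 * L) ^ (1 / θ) + δ / (d + 1) * ‖p.1‖ ^ (1 / θ)),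
      by positivity, fun p' hp' => ?_⟩
    have h1 := (h (fun z => packetEnt C p' z - packetEnt C p z)
      (‖p' - p‖ * Real.exp (2 * L + 8 * L ^ 2 / a)) p.1 (fun i => |p.2 i| + 2 * L)
      ((contDiff_packetEnt C _).sub (contDiff_packetEnt C _)) (by positivity)
      (fun _ => by positivity) (hLb p' hp')).2
    refine h1.trans (ENNReal.ofReal_le_ofReal (le_of_eq ?_))
    ring

lemma packet_mem {θ : ℝ} (hθ : 1 / 2 ≤ θ) (hθ' : θ < 1)
    {C : Matrix (Fin d) (Fin d) ℂ} (hC : IsWindow C) (p : RSp d × RSp d) :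
    packet C p ∈ GS d θ := by
  obtain ⟨K, -, D, hD, h, -⟩ := gsNorm_packet_bounds hθ hθ' one_pos hC
  exact ⟨contDiff_packet C p, D, hD, (h p).trans_lt ENNReal.ofReal_lt_top⟩

/-! ### The Banach space of functions with finite `gsNorm` -/

/-- The smooth functions with `gsNorm θ D f < ⊤`. -/
def gsBdd (d : ℕ) (θ : ℝ) {D : ℝ} (hD : 0 < D) : Submodule ℂ (RSp d → ℂ) where
  carrier := {f | ContDiff ℝ ∞ f ∧ gsNorm θ D f < ⊤}
  zero_mem' := ⟨contDiff_const, by rw [gsNorm_zero]; exact ENNReal.zero_lt_top⟩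
  add_mem' := fun hf hg => ⟨hf.1.add hg.1,
    (gsNorm_add_le θ hD hf.1 hg.1).trans_lt (ENNReal.add_lt_top.2 ⟨hf.2, hg.2⟩)⟩
  smul_mem' := fun c _ hf => ⟨hf.1.const_smul c, (gsNorm_smul_le θ hD c hf.1).trans_lt
    (ENNReal.mul_lt_top ENNReal.ofReal_lt_top hf.2)⟩

lemma gsBdd_le {θ D : ℝ} (hD : 0 < D) : gsBdd d θ hD ≤ GS d θ := fun _ hf => ⟨hf.1, D, hD, hf.2⟩

/-- The space of bounded families indexed by `(α, β, x)`. -/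
abbrev GSBanach (d : ℕ) : Type :=
  lp (fun _ : (Fin d → ℕ) × (Fin d → ℕ) × RSp d => ℂ) ∞

/-- The family `x^α ∂^β f(x)` with the weights of `gsNorm θ D`. -/
def gsFamily (θ D : ℝ) (f : RSp d → ℂ) (i : (Fin d → ℕ) × (Fin d → ℕ) × RSp d) : ℂ :=
  (((∏ k, |i.2.2 k| ^ i.1 k) / gsWeight θ D i.1 i.2.1 : ℝ) : ℂ) * multiD i.2.1 f i.2.2

lemma norm_gsFamily {θ D : ℝ} (hD : 0 < D) (f : RSp d → ℂ)
    (i : (Fin d → ℕ) × (Fin d → ℕ) × RSp d) : ‖gsFamily θ D f i‖ =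
      (∏ k, |i.2.2 k| ^ i.1 k) * ‖multiD i.2.1 f i.2.2‖ / gsWeight θ D i.1 i.2.1 := by
  rw [gsFamily, norm_mul, Complex.norm_real, Real.norm_of_nonneg
    (div_nonneg (by positivity) (gsWeight_pos θ hD _ _).le)]
  ring

lemma norm_gsFamily_le {θ D r : ℝ} (hD : 0 < D) (hr : 0 ≤ r) {f : RSp d → ℂ}
    (hf : gsNorm θ D f ≤ ENNReal.ofReal r) (i : (Fin d → ℕ) × (Fin d → ℕ) × RSp d) :
    ‖gsFamily θ D f i‖ ≤ r := by
  rw [norm_gsFamily hD, ← ENNReal.ofReal_le_ofReal_iff hr]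
  refine le_trans ?_ hf
  unfold gsNorm
  exact le_iSup_of_le i.1 (le_iSup_of_le i.2.1 (le_iSup_of_le i.2.2 le_rfl))

/-- The isometric embedding of `gsBdd` in `GSBanach`. -/
def gsEmb (θ : ℝ) {D : ℝ} (hD : 0 < D) : gsBdd d θ hD →ₗ[ℂ] GSBanach d where
  toFun f := ⟨gsFamily θ D f, memℓp_infty_iff.2 ⟨(gsNorm θ D (f : RSp d → ℂ)).toReal, by
    rintro _ ⟨i, rfl⟩
    exact norm_gsFamily_le hD ENNReal.toReal_nonneg (by rw [ENNReal.ofReal_toReal f.2.2.ne]) i⟩⟩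
  map_add' f g := by
    ext i
    change gsFamily θ D ((f : RSp d → ℂ) + (g : RSp d → ℂ)) i = gsFamily θ D f i + gsFamily θ D g i
    simp [gsFamily, multiD_add _ f.2.1 g.2.1, mul_add]
  map_smul' c f := by
    ext i
    change gsFamily θ D (c • (f : RSp d → ℂ)) i = c * gsFamily θ D f i
    simp only [gsFamily, multiD_smul _ c f.2.1, Pi.smul_apply, smul_eq_mul]
    ring

lemma gsEmb_apply (θ : ℝ) {D : ℝ} (hD : 0 < D) (f : gsBdd d θ hD)
    (i : (Fin d → ℕ) × (Fin d → ℕ) × RSp d) : gsEmb θ hD f i = gsFamily θ D f i := rfl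

lemma norm_gsEmb_le {θ D r : ℝ} (hD : 0 < D) (hr : 0 ≤ r) {f : gsBdd d θ hD}
    (hf : gsNorm θ D (f : RSp d → ℂ) ≤ ENNReal.ofReal r) : ‖gsEmb θ hD f‖ ≤ r :=
  lp.norm_le_of_forall_le hr fun i => norm_gsFamily_le hD hr hf i

lemma gsNorm_le_of_gsFamily_le {θ D r : ℝ} (hD : 0 < D) {f : RSp d → ℂ}
    (h : ∀ i, ‖gsFamily θ D f i‖ ≤ r) : gsNorm θ D f ≤ ENNReal.ofReal r := by
  refine iSup_le fun α => iSup_le fun β => iSup_le fun x => ENNReal.ofReal_le_ofReal ?_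
  have := h (α, β, x)
  rwa [norm_gsFamily hD] at this

lemma gsNorm_le_norm_gsEmb {θ D : ℝ} (hD : 0 < D) (f : gsBdd d θ hD) :
    gsNorm θ D (f : RSp d → ℂ) ≤ ENNReal.ofReal ‖gsEmb θ hD f‖ :=
  gsNorm_le_of_gsFamily_le hD fun i => lp.norm_apply_le_norm ENNReal.top_ne_zero (gsEmb θ hD f) i

lemma multiD_eq_gsFamily {θ D : ℝ} (hD : 0 < D) (f : RSp d → ℂ) (β : Fin d → ℕ) (x : RSp d) :
    multiD β f x = (gsWeight θ D 0 β : ℂ) * gsFamily θ D f (0, β, x) := by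
  have h : (gsWeight θ D 0 β : ℂ) ≠ 0 := by exact_mod_cast (gsWeight_pos θ hD 0 β).ne'
  simp [gsFamily]
  field_simp

lemma gsEmb_injective (θ : ℝ) {D : ℝ} (hD : 0 < D) :
    Function.Injective (gsEmb (d := d) θ hD) := by
  intro f g h
  ext x
  have h1 := multiD_eq_gsFamily (θ := θ) hD (f : RSp d → ℂ) 0 x
  have h2 := multiD_eq_gsFamily (θ := θ) hD (g : RSp d → ℂ) 0 x
  rw [multiD_zero] at h1 h2
  rw [h1, h2, ← gsEmb_apply θ hD f, ← gsEmb_apply θ hD g, h]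

/-- An ultradistribution extends to a continuous linear form on the Banach space. -/
lemma exists_extension {θ D : ℝ} (hD : 0 < D) (u : Ultra d θ) :
    ∃ U : GSBanach d →L[ℂ] ℂ, ∀ f : gsBdd d θ hD,
      U (gsEmb θ hD f) = (u : GS d θ →ₗ[ℂ] ℂ) ⟨f, gsBdd_le hD f.2⟩ := by
  obtain ⟨K, hK, hu⟩ := u.2 D hD
  let e := LinearEquiv.ofInjective (gsEmb (d := d) θ hD) (gsEmb_injective θ hD)
  let ℓ : LinearMap.range (gsEmb (d := d) θ hD) →ₗ[ℂ] ℂ :=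
    (u : GS d θ →ₗ[ℂ] ℂ) ∘ₗ Submodule.inclusion (gsBdd_le hD) ∘ₗ e.symm.toLinearMap
  have hℓ : ∀ v, ‖ℓ v‖ ≤ K * ‖v‖ := fun v => by
    obtain ⟨f, rfl⟩ := e.surjective v
    have h1 := hu (Submodule.inclusion (gsBdd_le hD) f)
    have h2 : ℓ (e f) = (u : GS d θ →ₗ[ℂ] ℂ) (Submodule.inclusion (gsBdd_le hD) f) := by
      simp [ℓ]
    rw [h2, ← ENNReal.ofReal_le_ofReal_iff (by positivity), ENNReal.ofReal_mul hK.le]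
    exact h1.trans (mul_le_mul_right (gsNorm_le_norm_gsEmb hD f) _)
  -- Hahn-Banach, from the range of the embedding to the whole space of bounded families.
  obtain ⟨U, hU, -⟩ := exists_extension_norm_eq _ (ℓ.mkContinuous K hℓ)
  refine ⟨U, fun f => ?_⟩
  have h1 := hU (e f)
  have h2 : ((e f : LinearMap.range (gsEmb (d := d) θ hD)) : GSBanach d) = gsEmb θ hD f := rfl
  rw [h2] at h1
  rw [h1]
  simp [ℓ]
  rfl

/-- `coordL i c` is the linear form `v ↦ v_i c`. -/
def coordL (i : Fin d) : ℂ →L[ℝ] (RSp d →L[ℝ] ℂ) :=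
  ContinuousLinearMap.smulRightL ℝ (RSp d) ℂ (EuclideanSpace.proj i)

lemma coordL_apply (i : Fin d) (c : ℂ) (v : RSp d) : coordL i c v = v i • c := rfl

lemma fderiv_eq_sum_coordL (f : RSp d → ℂ) (x : RSp d) :
    fderiv ℝ f x = ∑ i, coordL i (partialD i f x) := fderiv_eq_sum_partialD f x

lemma multi_induction {P : (Fin d → ℕ) → Prop} (h0 : P 0)
    (hs : ∀ β i, P β → P (β + Pi.single i 1)) (β : Fin d → ℕ) : P β := by
  induction hn : ∑ i, β i generalizing β with
  | zero =>
    have : β = 0 := by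
      funext i
      exact (Finset.sum_eq_zero_iff.1 hn) i (Finset.mem_univ i)
    rwa [this]
  | succ n ih =>
    obtain ⟨i, -, hi⟩ : ∃ i ∈ Finset.univ, β i ≠ 0 := by
      by_contra! h
      rw [Finset.sum_eq_zero h] at hn
      omega
    have e : β = (β - Pi.single i 1) + Pi.single i 1 := by
      funext j
      by_cases hj : j = i
      · subst hj; simp; omega
      · simp [hj]
    rw [e]
    refine hs _ _ (ih _ ?_)
    have h1 : ∑ j, β j = ∑ j, (β - Pi.single i 1 : Fin d → ℕ) j + 1 := by
      conv_lhs => rw [e]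
      simp only [Pi.add_apply, Finset.sum_add_distrib]
      simp
    omega

/-- Differentiation under the integral sign, for all multi-indices. -/
theorem multiD_integral {W : Type*} [MeasurableSpace W] {μ : Measure W} {f : W → RSp d → ℂ}
    (hf : ∀ w, ContDiff ℝ ∞ (f w)) {b : (Fin d → ℕ) → W → ℝ}
    (hint : ∀ β x, Integrable (fun w => multiD β (f w) x) μ)
    (hb : ∀ β x w, ‖multiD β (f w) x‖ ≤ b β w) (hbi : ∀ β, Integrable (b β) μ) :
    ContDiff ℝ ∞ (fun x => ∫ w, f w x ∂μ) ∧
      ∀ β, multiD β (fun x => ∫ w, f w x ∂μ) = fun x => ∫ w, multiD β (f w) x ∂μ := by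
  set G : (Fin d → ℕ) → RSp d → ℂ := fun β x => ∫ w, multiD β (f w) x ∂μ with hG
  have hder : ∀ β x, HasFDerivAt (G β) (∑ i, coordL i (G (β + Pi.single i 1) x)) x := by
    intro β x
    have h1 := hasFDerivAt_integral_of_dominated_of_fderiv_le (𝕜 := ℝ) (μ := μ) (x₀ := x)
      (F := fun x w => multiD β (f w) x)
      (F' := fun x w => ∑ i, coordL i (multiD (β + Pi.single i 1) (f w) x))
      (bound := fun w => ∑ i, ‖coordL (d := d) i‖ * b (β + Pi.single i 1) w) univ_mem
      (Eventually.of_forall fun x => (hint β x).aestronglyMeasurable) (hint β x) ?_ ?_ ?_ ?_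
    · refine h1.congr_fderiv ?_
      refine (integral_finsetSum Finset.univ
        (f := fun i w => coordL i (multiD (β + Pi.single i 1) (f w) x)) fun i _ =>
        (coordL i).integrable_comp (hint (β + Pi.single i 1) x)).trans ?_
      exact Finset.sum_congr rfl fun i _ =>
        (coordL i).integral_comp_comm (hint (β + Pi.single i 1) x)
    · exact (integrable_finsetSum _ fun i _ =>
        (coordL i).integrable_comp (hint (β + Pi.single i 1) x)).aestronglyMeasurable
    · refine Eventually.of_forall fun w x _ => (norm_sum_le _ _).trans ?_
      exact Finset.sum_le_sum fun i _ => ((coordL i).le_opNorm _).trans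
        (mul_le_mul_of_nonneg_left (hb _ _ _) (norm_nonneg _))
    · exact integrable_finsetSum _ fun i _ => (hbi _).const_mul _
    · refine Eventually.of_forall fun w x _ => ?_
      have h2 := ((contDiff_multiD β (hf w)).differentiable (by simp)).differentiableAt
        (x := x) |>.hasFDerivAt
      rw [fderiv_eq_sum_coordL] at h2
      simpa only [partialD_multiD _ β (hf w)] using h2
  -- The family `G` is closed under differentiation, so the induction on the order of smoothness
  -- runs over all `β` at once.
  have hcont : ∀ (n : ℕ) β, ContDiff ℝ n (G β) := by
    intro n
    induction n with
    | zero =>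
      intro β
      rw [Nat.cast_zero, contDiff_zero]
      exact continuous_iff_continuousAt.2 fun x => (hder β x).continuousAt
    | succ n ih =>
      intro β
      push_cast
      rw [contDiff_succ_iff_hasFDerivAt]
      exact ⟨_, ContDiff.sum fun i _ => (coordL i).contDiff.comp (ih _), fun x => hder β x⟩
  have hsm : ∀ β, ContDiff ℝ ∞ (G β) := fun β => contDiff_infty.2 fun n => hcont n β
  have hpart : ∀ β i, partialD i (G β) = G (β + Pi.single i 1) := by
    intro β i
    funext x
    rw [partialD, (hder β x).fderiv]
    simp [coordL_apply]
  have hG0 : G 0 = fun x => ∫ w, f w x ∂μ := by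
    simp only [hG, multiD_zero]
  rw [← hG0]
  refine ⟨hsm 0, fun β => ?_⟩
  induction β using multi_induction with
  | h0 => exact multiD_zero _
  | hs β i ih => rw [← partialD_multiD i β (hsm 0), ih]; exact hpart β i

/-- Superposition of Gelfand-Shilov functions: the integral is a Gelfand-Shilov function, and
ultradistributions can be applied under the integral sign. -/
theorem exists_integral_gsBdd {W : Type*} [MeasurableSpace W] {μ : Measure W} {θ D : ℝ}
    (hD : 0 < D) (f : W → gsBdd d θ hD) (hf : Integrable (fun w => gsEmb θ hD (f w)) μ) :
    ∃ h : (fun x => ∫ w, (f w : RSp d → ℂ) x ∂μ) ∈ gsBdd d θ hD,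
      ∀ u : Ultra d θ, (u : GS d θ →ₗ[ℂ] ℂ) ⟨_, gsBdd_le hD h⟩ =
        ∫ w, (u : GS d θ →ₗ[ℂ] ℂ) ⟨f w, gsBdd_le hD (f w).2⟩ ∂μ := by
  have hint : ∀ i, Integrable (fun w => gsFamily θ D (f w : RSp d → ℂ) i) μ := fun i =>
    (lp.evalCLM ℂ (fun _ : (Fin d → ℕ) × (Fin d → ℕ) × RSp d => ℂ) ∞ i).integrable_comp hf
  have hintD : ∀ β x, Integrable (fun w => multiD β (f w : RSp d → ℂ) x) μ := fun β x => by
    simp only [multiD_eq_gsFamily (θ := θ) hD _ β x]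
    exact (hint _).const_mul _
  have hbd : ∀ β x w, ‖multiD β (f w : RSp d → ℂ) x‖ ≤ gsWeight θ D 0 β * ‖gsEmb θ hD (f w)‖ := by
    intro β x w
    rw [multiD_eq_gsFamily (θ := θ) hD _ β x, norm_mul, Complex.norm_real,
      Real.norm_of_nonneg (gsWeight_pos θ hD _ _).le]
    exact mul_le_mul_of_nonneg_left (lp.norm_apply_le_norm ENNReal.top_ne_zero (gsEmb θ hD (f w)) _)
      (gsWeight_pos θ hD _ _).le
  obtain ⟨hsm, hmul⟩ := multiD_integral (fun w => (f w).2.1) hintD hbd fun β =>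
    hf.norm.const_mul (gsWeight θ D 0 β)
  set G : RSp d → ℂ := fun x => ∫ w, (f w : RSp d → ℂ) x ∂μ
  -- Coordinate evaluations are continuous and commute with the Bochner integral, so the integral
  -- taken in the Banach space is the family of the pointwise integral. Completeness of `gsBdd`
  -- itself is thereby not needed.
  have hfam : ∀ i, gsFamily θ D (G) i = (∫ w, gsEmb θ hD (f w) ∂μ : GSBanach d) i := by
    intro i
    have h1 := (lp.evalCLM ℂ (fun _ : (Fin d → ℕ) × (Fin d → ℕ) × RSp d => ℂ) ∞ i).integral_comp_comm
      hf
    refine Eq.trans ?_ h1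
    rw [gsFamily, hmul]
    exact (integral_const_mul _ _).symm
  have hmem : G ∈ gsBdd d θ hD := by
    refine ⟨hsm, (gsNorm_le_of_gsFamily_le hD (r := ‖∫ w, gsEmb θ hD (f w) ∂μ‖)
      fun i => ?_).trans_lt ENNReal.ofReal_lt_top⟩
    rw [hfam]
    exact lp.norm_apply_le_norm ENNReal.top_ne_zero _ i
  refine ⟨hmem, fun u => ?_⟩
  obtain ⟨U, hU⟩ := exists_extension hD u
  have h1 : gsEmb θ hD ⟨_, hmem⟩ = ∫ w, gsEmb θ hD (f w) ∂μ := by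
    ext i
    rw [← hfam i, gsEmb_apply]
  rw [← hU ⟨_, hmem⟩, h1, ← U.integral_comp_comm hf]
  exact integral_congr_ae (Eventually.of_forall fun w => hU (f w))

/-! ### Superpositions of wave packets -/

/-- The wave packet as an element of `S_θ`. -/
def pkt {θ : ℝ} (hθ : 1 / 2 ≤ θ) (hθ' : θ < 1) {C : Matrix (Fin d) (Fin d) ℂ} (hC : IsWindow C)
    (p : RSp d × RSp d) : GS d θ := ⟨packet C p, packet_mem hθ hθ' hC p⟩

lemma exists_packet_family {θ δ : ℝ} (hθ : 1 / 2 ≤ θ) (hθ' : θ < 1) (hδ : 0 < δ)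
    {C : Matrix (Fin d) (Fin d) ℂ} (hC : IsWindow C) :
    ∃ K : ℝ, 0 < K ∧ ∃ (D : ℝ) (hD : 0 < D) (P : RSp d × RSp d → gsBdd d θ hD),
      (∀ p, (P p : RSp d → ℂ) = packet C p) ∧ Continuous (fun p => gsEmb θ hD (P p)) ∧
      ∀ p, ‖gsEmb θ hD (P p)‖ ≤ K * Real.exp (δ * ‖p‖ ^ (1 / θ)) := by
  obtain ⟨K, hK, D, hD, h1, h2⟩ := gsNorm_packet_bounds hθ hθ' hδ hC
  refine ⟨K, hK, D, hD, fun p => ⟨packet C p, contDiff_packet C p,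
    (h1 p).trans_lt ENNReal.ofReal_lt_top⟩, fun p => rfl, ?_, fun p =>
    norm_gsEmb_le hD (by positivity) (h1 p)⟩
  refine continuous_iff_continuousAt.2 fun p => ?_
  obtain ⟨K', hK', h3⟩ := h2 p
  rw [ContinuousAt, tendsto_iff_norm_sub_tendsto_zero]
  have h4 : Tendsto (fun p' : RSp d × RSp d => ‖p' - p‖ * K') (𝓝 p) (𝓝 0) := by
    have : Continuous fun p' : RSp d × RSp d => ‖p' - p‖ * K' := by fun_prop
    simpa using this.tendsto p
  refine squeeze_zero' (Eventually.of_forall fun _ => norm_nonneg _) ?_ h4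
  filter_upwards [Metric.closedBall_mem_nhds p one_pos] with p' hp'
  rw [← map_sub]
  refine norm_gsEmb_le hD (by positivity) (h3 p' ?_)
  rwa [Metric.mem_closedBall, dist_eq_norm] at hp'

lemma continuous_apply_pkt {θ : ℝ} (hθ : 1 / 2 ≤ θ) (hθ' : θ < 1)
    {C : Matrix (Fin d) (Fin d) ℂ} (hC : IsWindow C) (u : Ultra d θ) :
    Continuous fun p => (u : GS d θ →ₗ[ℂ] ℂ) (pkt hθ hθ' hC p) := by
  obtain ⟨K, -, D, hD, P, hP, hc, -⟩ := exists_packet_family hθ hθ' one_pos hC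
  obtain ⟨U, hU⟩ := exists_extension hD u
  refine (U.continuous.comp hc).congr fun p => ?_
  rw [Function.comp, hU]
  congr 1
  exact Subtype.ext (hP p)

lemma norm_apply_pkt_le {θ δ : ℝ} (hθ : 1 / 2 ≤ θ) (hθ' : θ < 1) (hδ : 0 < δ)
    {C : Matrix (Fin d) (Fin d) ℂ} (hC : IsWindow C) (u : Ultra d θ) :
    ∃ K : ℝ, 0 < K ∧ ∀ p, ‖(u : GS d θ →ₗ[ℂ] ℂ) (pkt hθ hθ' hC p)‖ ≤
      K * Real.exp (δ * ‖p‖ ^ (1 / θ)) := by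
  obtain ⟨K, hK, D, hD, h1, -⟩ := gsNorm_packet_bounds hθ hθ' hδ hC
  obtain ⟨K', hK', h2⟩ := u.2 D hD
  refine ⟨K' * K, by positivity, fun p => ?_⟩
  rw [← ENNReal.ofReal_le_ofReal_iff (by positivity), mul_assoc, ENNReal.ofReal_mul hK'.le]
  exact (h2 _).trans (mul_le_mul_right (h1 p) _)

theorem exists_integral_packet {θ δ : ℝ} (hθ : 1 / 2 ≤ θ) (hθ' : θ < 1) (hδ : 0 < δ)
    {C : Matrix (Fin d) (Fin d) ℂ} (hC : IsWindow C) {W : Type*} [MeasurableSpace W]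
    {μ : Measure W} {a : W → ℂ} (ha : AEStronglyMeasurable a μ) {π : W → RSp d × RSp d}
    (hπ : Measurable π) (hint : Integrable (fun w => ‖a w‖ * Real.exp (δ * ‖π w‖ ^ (1 / θ))) μ) :
    ∃ h : (fun y => ∫ w, a w * packet C (π w) y ∂μ) ∈ GS d θ,
      ∀ u : Ultra d θ, (u : GS d θ →ₗ[ℂ] ℂ) ⟨_, h⟩ =
        ∫ w, a w * (u : GS d θ →ₗ[ℂ] ℂ) (pkt hθ hθ' hC (π w)) ∂μ := by
  obtain ⟨K, hK, D, hD, P, hP, hc, hb⟩ := exists_packet_family hθ hθ' hδ hC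
  have hf : Integrable (fun w => gsEmb θ hD (a w • P (π w))) μ := by
    refine (hint.const_mul K).mono' ?_ (Eventually.of_forall fun w => ?_)
    · simp only [map_smul]
      -- The space of bounded families need not be separable; strong measurability comes from norm
      -- continuity in `p` on the second countable phase space.
      exact ha.smul (hc.stronglyMeasurable.comp_measurable hπ).aestronglyMeasurable
    · rw [map_smul, norm_smul]
      calc _ ≤ ‖a w‖ * (K * Real.exp (δ * ‖π w‖ ^ (1 / θ))) := by gcongr; exact hb _
        _ = _ := by ring
  obtain ⟨h, hu⟩ := exists_integral_gsBdd hD (fun w => a w • P (π w)) hf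
  have e : (fun x => ∫ w, ((a w • P (π w) : gsBdd d θ hD) : RSp d → ℂ) x ∂μ)
      = fun y => ∫ w, a w * packet C (π w) y ∂μ := by
    simp [hP]
  have hmem := gsBdd_le hD h
  refine ⟨e ▸ hmem, fun u => ?_⟩
  have h1 := hu u
  have h2 : (⟨_, e ▸ hmem⟩ : GS d θ) = ⟨_, hmem⟩ := Subtype.ext e.symm
  rw [h2, h1]
  refine integral_congr_ae (Eventually.of_forall fun w => ?_)
  simp only
  rw [← smul_eq_mul, ← map_smul]
  congr 1
  apply Subtype.ext
  simp [hP, pkt]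

/-! ### Decay of the wave packet transform of a Gelfand-Shilov function -/

/-- Raising the moment bounds to the power `σ = 1/θ` turns `k!^θ` into `k!`. With `m = t^σ/(2D^σ)`
they compare the exponential series of `m` termwise with a geometric series of ratio `1/2`; then
take `θ`-th powers. -/
lemma le_exp_of_moments {θ D N Q t : ℝ} (hθ : 0 < θ) (hθ' : θ ≤ 1) (hD : 0 < D) (hN : 0 ≤ N)
    (hQ : 0 ≤ Q) (ht : 0 ≤ t) (h : ∀ k : ℕ, t ^ k * Q ≤ N * D ^ k * (k.factorial : ℝ) ^ θ) :
    Q ≤ 2 * N * Real.exp (-(θ / (2 * D ^ (1 / θ))) * t ^ (1 / θ)) := by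
  set σ := 1 / θ with hσ
  have hσ0 : 0 < σ := by positivity
  have hθσ : θ * σ = 1 := by rw [hσ]; field_simp
  set m := t ^ σ / (2 * D ^ σ) with hm
  have h1 : ∀ k : ℕ, Q ^ σ * (m ^ k / k.factorial) ≤ N ^ σ * (1 / 2) ^ k := fun k => by
    have hf : (0 : ℝ) < k.factorial := by exact_mod_cast k.factorial_pos
    have h2 := Real.rpow_le_rpow (by positivity) (h k) hσ0.le
    rw [Real.mul_rpow (by positivity) hQ, Real.mul_rpow (by positivity) (by positivity),
      Real.mul_rpow hN (by positivity), ← Real.rpow_mul hf.le, hθσ, Real.rpow_one,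
      ← Real.rpow_natCast, ← Real.rpow_natCast, ← Real.rpow_mul ht, ← Real.rpow_mul hD.le,
      mul_comm (k : ℝ), Real.rpow_mul ht, Real.rpow_mul hD.le, Real.rpow_natCast,
      Real.rpow_natCast] at h2
    have h3 : Q ^ σ * (m ^ k / k.factorial) =
        ((t ^ σ) ^ k * Q ^ σ) / ((D ^ σ) ^ k * k.factorial) * (1 / 2) ^ k := by
      rw [hm, div_pow, mul_pow, one_div, inv_pow]
      field_simp
    rw [h3]
    refine mul_le_mul_of_nonneg_right ?_ (by positivity)
    rw [div_le_iff₀ (by positivity)]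
    linarith
  have hs1 : HasSum (fun k : ℕ => Q ^ σ * (m ^ k / k.factorial)) (Q ^ σ * Real.exp m) := by
    rw [Real.exp_eq_exp_ℝ]
    exact (NormedSpace.expSeries_div_hasSum_exp m).mul_left _
  have hs2 : HasSum (fun k : ℕ => N ^ σ * (1 / 2 : ℝ) ^ k) (N ^ σ * 2) :=
    hasSum_geometric_two.mul_left _
  have h4 := hasSum_le h1 hs1 hs2
  have h5 : Q ^ σ ≤ N ^ σ * 2 * Real.exp (-m) := by
    rw [Real.exp_neg, ← div_eq_mul_inv, le_div_iff₀ (Real.exp_pos _)]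
    exact h4
  have h6 := Real.rpow_le_rpow (by positivity) h5 hθ.le
  rw [← Real.rpow_mul hQ, mul_comm σ, hθσ, Real.rpow_one,
    Real.mul_rpow (by positivity) (Real.exp_pos _).le, Real.mul_rpow (by positivity) (by norm_num),
    ← Real.rpow_mul hN, mul_comm σ, hθσ, Real.rpow_one, ← Real.exp_mul] at h6
  have h7 : (2 : ℝ) ^ θ ≤ 2 := by
    simpa using Real.rpow_le_rpow_of_exponent_le (by norm_num : (1 : ℝ) ≤ 2) hθ'
  have e : -m * θ = -(θ / (2 * D ^ σ)) * t ^ σ := by rw [hm]; ring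
  rw [e] at h6
  calc Q ≤ N * 2 ^ θ * Real.exp (-(θ / (2 * D ^ σ)) * t ^ σ) := h6
    _ ≤ N * 2 * Real.exp (-(θ / (2 * D ^ σ)) * t ^ σ) := by gcongr
    _ = _ := by ring

/-- Use the largest coordinate, which satisfies `‖y‖ ≤ (d+1)|y_i|`. The bound `Q ≤ N` covers `d =
0`. -/
lemma le_exp_of_coords {σ N Q ε : ℝ} (hσ : 1 ≤ σ) (hσ' : σ ≤ 2) (hε : 0 < ε) (hN : 0 ≤ N)
    (y : RSp d) (h0 : Q ≤ N) (h : ∀ i, Q ≤ N * Real.exp (-ε * |y i| ^ σ)) :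
    Q ≤ N * Real.exp (-(ε / (d + 1) ^ 2) * ‖y‖ ^ σ) := by
  have h1 : ‖y‖ ≤ ∑ i, |y i| := by
    rw [EuclideanSpace.norm_eq, Real.sqrt_le_left (Finset.sum_nonneg fun i _ => abs_nonneg _)]
    simpa using Finset.sum_sq_le_sq_sum_of_nonneg
      (s := Finset.univ) (f := fun i => |y i|) (fun i _ => abs_nonneg _)
  rcases Nat.eq_zero_or_pos d with rfl | hd
  · have : ‖y‖ = 0 := le_antisymm (by simpa using h1) (norm_nonneg _)
    rw [this, Real.zero_rpow (by linarith)]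
    simpa using h0
  · have : Nonempty (Fin d) := ⟨⟨0, hd⟩⟩
    obtain ⟨i, hi⟩ := Finite.exists_max fun i => |y i|
    refine (h i).trans (mul_le_mul_of_nonneg_left (Real.exp_le_exp.2 ?_) hN)
    have h2 : ‖y‖ ≤ (d + 1) * |y i| := by
      calc ‖y‖ ≤ ∑ _j : Fin d, |y i| := h1.trans (Finset.sum_le_sum fun j _ => hi j)
        _ = d * |y i| := by simp
        _ ≤ _ := by gcongr; linarith
    have h3 : ‖y‖ ^ σ ≤ (d + 1) ^ 2 * |y i| ^ σ := by
      calc ‖y‖ ^ σ ≤ ((d + 1) * |y i|) ^ σ :=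
            Real.rpow_le_rpow (norm_nonneg _) h2 (by linarith)
        _ = (d + 1 : ℝ) ^ σ * |y i| ^ σ := Real.mul_rpow (by positivity) (abs_nonneg _)
        _ ≤ _ := by
            gcongr
            rw [← Real.rpow_two]
            exact Real.rpow_le_rpow_of_exponent_le (by linarith [(Nat.cast_nonneg d : (0 : ℝ) ≤ d)])
              hσ'
    have h4 : ε / (d + 1) ^ 2 * ‖y‖ ^ σ ≤ ε * |y i| ^ σ := by
      rw [div_mul_eq_mul_div, div_le_iff₀ (by positivity)]
      nlinarith
    linarith

lemma gsWeight_single (θ D : ℝ) (i : Fin d) (k : ℕ) :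
    gsWeight θ D (Pi.single i k) 0 = D ^ k * (k.factorial : ℝ) ^ θ ∧
    gsWeight θ D 0 (Pi.single i k) = D ^ k * (k.factorial : ℝ) ^ θ := by
  have h : ∏ j, (((Pi.single i k : Fin d → ℕ) j).factorial : ℝ) = k.factorial := by
    rw [Finset.prod_eq_single i (fun j _ hj => by simp [hj]) (by simp)]
    simp
  simp [gsWeight, h]

lemma exists_decay_of_mem {θ : ℝ} (hθ : 1 / 2 ≤ θ) (hθ' : θ < 1) {f : RSp d → ℂ}
    (hf : f ∈ GS d θ) : ∃ K : ℝ, 0 < K ∧ ∃ ε : ℝ, 0 < ε ∧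
      ∀ y, ‖f y‖ ≤ K * Real.exp (-ε * ‖y‖ ^ (1 / θ)) := by
  obtain ⟨-, D, hD, hfD⟩ := hf
  have hθ0 : 0 < θ := by linarith
  obtain ⟨hσ, hσ'⟩ := one_le_one_div hθ hθ'
  set N := (gsNorm θ D f).toReal
  have hN : 0 ≤ N := ENNReal.toReal_nonneg
  refine ⟨2 * N + 1, by positivity, θ / (2 * D ^ (1 / θ)) / (d + 1) ^ 2, by positivity, fun y => ?_⟩
  have h0 : ‖f y‖ ≤ N := by
    have := norm_le_of_gsNorm hD hfD 0 0 y
    rw [multiD_zero] at this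
    simpa [gsWeight] using this
  have h1 : ‖f y‖ ≤ 2 * N * Real.exp (-(θ / (2 * D ^ (1 / θ)) / (d + 1) ^ 2) * ‖y‖ ^ (1 / θ)) := by
    refine le_exp_of_coords hσ hσ' (by positivity) (by positivity) y (by linarith) fun i => ?_
    refine le_exp_of_moments hθ0 hθ'.le hD hN (norm_nonneg _) (abs_nonneg _) fun k => ?_
    have := norm_le_of_gsNorm hD hfD (Pi.single i k) 0 y
    rw [multiD_zero, Finset.prod_eq_single i (fun j _ hj => by simp [hj]) (by simp),
      (gsWeight_single θ D i k).1] at this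
    simpa [mul_assoc] using this
  refine h1.trans ?_
  gcongr
  linarith

lemma integrable_exp_neg_sq {a : ℝ} (ha : 0 < a) (x : RSp d) :
    Integrable fun y : RSp d => Real.exp (-a * ‖y - x‖ ^ 2) := by
  have h := (GaussianFourier.integrable_cexp_neg_mul_sq_norm_add (V := RSp d) (b := (a : ℂ))
    (by simpa using ha) 0 0).norm
  have h2 : Integrable fun y : RSp d => Real.exp (-a * ‖y‖ ^ 2) := by
    refine h.congr (Eventually.of_forall fun y => ?_)
    simp only [Complex.norm_exp]
    congr 1
    simp [← Complex.ofReal_pow]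
  exact h2.comp_sub_right x

lemma integral_exp_neg_sq (a : ℝ) (x : RSp d) :
    ∫ y : RSp d, Real.exp (-a * ‖y - x‖ ^ 2) = ∫ y : RSp d, Real.exp (-a * ‖y‖ ^ 2) :=
  integral_sub_right_eq_self (fun y : RSp d => Real.exp (-a * ‖y‖ ^ 2)) x

/-- Integration by parts, one derivative at a time; the character is bounded, so integrability of
the derivatives of `F` suffices. -/
lemma integral_partialD_mul_character (i : Fin d) (ξ : RSp d) (k : ℕ) {F : RSp d → ℂ}
    (hF : ContDiff ℝ ∞ F) (hi : ∀ j, Integrable ((partialD i)^[j] F)) :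
    ∫ y, (partialD i)^[k] F y * Complex.exp (-Complex.I * (ofR ξ ⬝ᵥ ofR y)) =
      (Complex.I * ξ i) ^ k * ∫ y, F y * Complex.exp (-Complex.I * (ofR ξ ⬝ᵥ ofR y)) := by
  induction k with
  | zero => simp
  | succ k ih =>
    rw [pow_succ', mul_assoc, ← ih, Function.iterate_succ_apply']
    set G := (partialD i)^[k] F
    have hG : ContDiff ℝ ∞ G := contDiff_partialD_iterate i k hF
    set e : RSp d → ℂ := fun y => Complex.exp (-Complex.I * (ofR ξ ⬝ᵥ ofR y)) with he
    have hes : ContDiff ℝ ∞ e := by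
      have : ContDiff ℂ ∞ fun z : Fin d → ℂ => Complex.exp (-Complex.I * (ofR ξ ⬝ᵥ z)) := by
        unfold dotProduct; fun_prop
      exact contDiff_comp_ofR this
    have hn : ∀ y, ‖e y‖ = 1 := fun y => by
      rw [he, Complex.norm_exp]
      simp [im_dotProduct_ofR_ofR]
    have hde : ∀ y, fderiv ℝ e y (EuclideanSpace.single i 1) = -Complex.I * ξ i * e y := fun y => by
      have h1 : HasFDerivAt (fun y : RSp d => -Complex.I * (ofR ξ ⬝ᵥ ofR y))
          (∑ j, ((-Complex.I * ξ j) • Complex.ofRealCLM.comp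
            (EuclideanSpace.proj j : RSp d →L[ℝ] ℝ))) y := by
        have h2 : (fun y : RSp d => -Complex.I * (ofR ξ ⬝ᵥ ofR y)) = fun y =>
            (∑ j, ((-Complex.I * ξ j) • Complex.ofRealCLM.comp
            (EuclideanSpace.proj j : RSp d →L[ℝ] ℝ))) y := by
          funext y
          simp [dotProduct, ofR, Finset.mul_sum, mul_assoc]
        rw [h2]
        exact ContinuousLinearMap.hasFDerivAt _
      rw [(h1.cexp).fderiv]
      have h3 : ∀ j, (((if j = i then (1 : ℝ) else 0) : ℝ) : ℂ) = if j = i then 1 else 0 := fun j => by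
        split_ifs <;> simp
      simp [he, h3]
      ring
    have hmul : ∀ {g : RSp d → ℂ}, Integrable g → Integrable fun y => g y * e y := fun hg =>
      hg.mul_bdd (c := 1) hes.continuous.aestronglyMeasurable
        (Eventually.of_forall fun y => (hn y).le)
    have hGi : Integrable G := hi k
    have hGi' : Integrable (partialD i G) := by
      have := hi (k + 1)
      rwa [Function.iterate_succ_apply'] at this
    have hibp := integral_mul_fderiv_eq_neg_fderiv_mul_of_integrable (μ := volume)
      (f := G) (g := e) (v := EuclideanSpace.single i (1 : ℝ)) (hmul hGi')
      (by
        simp only [hde]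
        refine ((hmul hGi).const_mul (-Complex.I * ξ i)).congr (Eventually.of_forall fun y => ?_)
        ring)
      (hmul hGi) (fun x _ => (hG.differentiable (by simp)).differentiableAt)
      (fun x _ => (hes.differentiable (by simp)).differentiableAt)
    simp only [hde] at hibp
    have h3 : ∫ y, G y * (-Complex.I * ξ i * e y) = -(Complex.I * ξ i) * ∫ y, G y * e y := by
      rw [← integral_const_mul]
      congr 1; funext y; ring
    rw [h3] at hibp
    have h4 : ∫ y, partialD i G y * e y = (Complex.I * ξ i) * ∫ y, G y * e y := by
      have := congrArg Neg.neg hibp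
      rw [neg_neg, neg_mul, neg_neg] at this
      exact this.symm
    exact h4

lemma packet_eq_mul (C : Matrix (Fin d) (Fin d) ℂ) (x ξ y : RSp d) :
    packet C (x, ξ) y = packet C (x, 0) y * Complex.exp (-Complex.I * (ofR ξ ⬝ᵥ ofR y)) := by
  have h0 : ofR (0 : RSp d) = 0 := by funext i; simp [ofR]
  rw [packet, packet, packetEnt, packetEnt, ← Complex.exp_add]
  congr 1
  simp [h0]
  ring

/-- Decay in `x` comes from the decay of `f` against the Gaussian localization of the packet. Decay
in `ξ` comes from viewing the integral as a Fourier integral of `f` times a packet of frequency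
zero, whose derivatives give factorial moment bounds. The norm on phase space is a maximum, so the
two halves combine. -/
theorem exists_decay_packet_transform {θ : ℝ} (hθ : 1 / 2 ≤ θ) (hθ' : θ < 1) {f : RSp d → ℂ}
    (hf : f ∈ GS d θ) {C : Matrix (Fin d) (Fin d) ℂ} (hC : IsWindow C) :
    ∃ K : ℝ, 0 < K ∧ ∃ ε : ℝ, 0 < ε ∧ ∀ p : RSp d × RSp d,
      ‖∫ y, f y * packet C p y‖ ≤ K * Real.exp (-ε * ‖p‖ ^ (1 / θ)) := by
  have hθ0 : 0 < θ := by linarith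
  obtain ⟨hσ, hσ'⟩ := one_le_one_div hθ hθ'
  have h1 : ∃ K : ℝ, 0 < K ∧ ∃ ε : ℝ, 0 < ε ∧ ∀ p : RSp d × RSp d,
      ‖∫ y, f y * packet C p y‖ ≤ K * Real.exp (-ε * ‖p.1‖ ^ (1 / θ)) := by
    obtain ⟨-, a, ha, hCa⟩ := id hC
    obtain ⟨K, hK, ε, hε, hfd⟩ := exists_decay_of_mem hθ hθ' hf
    set J := ∫ y : RSp d, Real.exp (-(a / 4) * ‖y‖ ^ 2)
    have hJ : 0 ≤ J := integral_nonneg fun _ => (Real.exp_pos _).le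
    set η := min ε (a / 4) / 4
    have hη : 0 < η := by positivity
    refine ⟨K * Real.exp (4 * η) * (J + 1), by positivity, η, hη, ?_⟩
    rintro ⟨x, ξ⟩
    have hpt : ∀ y, ‖f y * packet C (x, ξ) y‖ ≤
        K * Real.exp (4 * η) * Real.exp (-η * ‖x‖ ^ (1 / θ)) * Real.exp (-(a / 4) * ‖y - x‖ ^ 2) := by
      intro y
      rw [norm_mul]
      refine (mul_le_mul (hfd y) (norm_packet_le hCa (x, ξ) y) (norm_nonneg _)
        (by positivity)).trans ?_
      rw [mul_assoc, mul_assoc, mul_assoc, ← Real.exp_add, ← Real.exp_add, ← Real.exp_add]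
      refine mul_le_mul_of_nonneg_left (Real.exp_le_exp.2 ?_) hK.le
      have h1 : ‖x‖ ^ (1 / θ) ≤ 4 * ‖y‖ ^ (1 / θ) + 4 + 4 * ‖y - x‖ ^ 2 := by
        rw [norm_sub_rev y x]
        refine le_trans ?_ (add_rpow_le_sq hσ hσ' (norm_nonneg y) (norm_nonneg (x - y)))
        refine Real.rpow_le_rpow (norm_nonneg _) ?_ (by positivity)
        simpa using norm_add_le y (x - y)
      have h2 := mul_le_mul_of_nonneg_left h1 hη.le
      have h3 : 4 * η * ‖y‖ ^ (1 / θ) ≤ ε * ‖y‖ ^ (1 / θ) := by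
        gcongr
        have : 4 * η = min ε (a / 4) := by simp only [η]; ring
        rw [this]; exact min_le_left _ _
      have h4 : 4 * η * ‖y - x‖ ^ 2 ≤ a / 4 * ‖y - x‖ ^ 2 := by
        gcongr
        have : 4 * η = min ε (a / 4) := by simp only [η]; ring
        rw [this]; exact min_le_right _ _
      simp only
      linarith
    refine (norm_integral_le_of_norm_le ((integrable_exp_neg_sq (by positivity) x).const_mul _)
      (Eventually.of_forall hpt)).trans ?_
    rw [integral_const_mul, integral_exp_neg_sq]
    have : 0 ≤ K * Real.exp (4 * η) * Real.exp (-η * ‖x‖ ^ (1 / θ)) := by positivity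
    nlinarith
  have h2 : ∃ K : ℝ, 0 < K ∧ ∃ ε : ℝ, 0 < ε ∧ ∀ p : RSp d × RSp d,
      ‖∫ y, f y * packet C p y‖ ≤ K * Real.exp (-ε * ‖p.2‖ ^ (1 / θ)) := by
    obtain ⟨hfs, D₁, hD₁, hfD⟩ := hf
    obtain ⟨a, ha, K, hK, D₂, hD₂, hpk⟩ := packet_zero_right_bounds (d := d) hθ hθ' hC
    set D := max D₁ D₂
    have hD : 0 < D := lt_max_of_lt_left hD₁
    set N := (gsNorm θ D₁ f).toReal
    have hN : 0 ≤ N := ENNReal.toReal_nonneg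
    set J := ∫ y : RSp d, Real.exp (-a * ‖y‖ ^ 2)
    have hJ : 0 ≤ J := integral_nonneg fun _ => (Real.exp_pos _).le
    -- The `2^k` is the sum of the binomial coefficients in Leibniz' rule; `j!(k-j)! ≤ k!` keeps the
    -- Gevrey order `θ`.
    have hder : ∀ (x : RSp d) (i : Fin d) (k : ℕ) (y : RSp d),
        ‖(partialD i)^[k] (fun y => f y * packet C (x, 0) y) y‖ ≤
          N * K * (2 * D) ^ k * (k.factorial : ℝ) ^ θ * Real.exp (-a * ‖y - x‖ ^ 2) := by
      intro x i k y
      rw [partialD_iterate_mul i k hfs (contDiff_packet C _)]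
      have hterm : ∀ j ∈ Finset.range (k + 1),
          ‖(k.choose j : ℂ) * (partialD i)^[j] f y * (partialD i)^[k - j] (packet C (x, 0)) y‖ ≤
            (k.choose j : ℝ) * (N * K * D ^ k * (k.factorial : ℝ) ^ θ *
              Real.exp (-a * ‖y - x‖ ^ 2)) := by
        intro j hj
        have hjk : j ≤ k := Nat.lt_succ_iff.1 (Finset.mem_range.1 hj)
        rw [norm_mul, norm_mul, Complex.norm_natCast, mul_assoc]
        refine mul_le_mul_of_nonneg_left ?_ (by positivity)
        have b1 : ‖(partialD i)^[j] f y‖ ≤ N * (D ^ j * (j.factorial : ℝ) ^ θ) := by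
          have := norm_le_of_gsNorm hD₁ hfD 0 (Pi.single i j) y
          rw [multiD_single i j hfs, (gsWeight_single θ D₁ i j).2] at this
          refine (le_trans (by simp) this).trans ?_
          gcongr
          exact le_max_left _ _
        have b2 : ‖(partialD i)^[k - j] (packet C (x, 0)) y‖ ≤
            K * D ^ (k - j) * ((k - j).factorial : ℝ) ^ θ * Real.exp (-a * ‖y - x‖ ^ 2) := by
          have := hpk x (Pi.single i (k - j)) y
          rw [multiD_single i _ (contDiff_packet C _)] at this
          have e2 : ∏ j', (((Pi.single i (k - j) : Fin d → ℕ) j').factorial : ℝ) =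
              (k - j).factorial := by
            rw [Finset.prod_eq_single i (fun j _ hj => by simp [hj]) (by simp)]
            simp
          rw [e2, Finset.sum_pi_single' , if_pos (Finset.mem_univ _)] at this
          refine this.trans ?_
          gcongr
          exact le_max_right _ _
        refine (mul_le_mul b1 b2 (norm_nonneg _) (by positivity)).trans ?_
        have b3 : (j.factorial : ℝ) ^ θ * ((k - j).factorial : ℝ) ^ θ ≤ (k.factorial : ℝ) ^ θ := by
          rw [← Real.mul_rpow (by positivity) (by positivity)]
          refine Real.rpow_le_rpow (by positivity) ?_ hθ0.le
          have := Nat.le_of_dvd k.factorial_pos (Nat.factorial_mul_factorial_dvd_factorial hjk)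
          exact_mod_cast this
        have b4 : D ^ j * D ^ (k - j) = D ^ k := by rw [← pow_add, Nat.add_sub_cancel' hjk]
        calc _ = N * K * (D ^ j * D ^ (k - j)) * ((j.factorial : ℝ) ^ θ *
                ((k - j).factorial : ℝ) ^ θ) * Real.exp (-a * ‖y - x‖ ^ 2) := by ring
          _ ≤ _ := by rw [b4]; gcongr
      refine (norm_sum_le_of_le _ hterm).trans (le_of_eq ?_)
      rw [← Finset.sum_mul]
      have : (∑ j ∈ Finset.range (k + 1), (k.choose j : ℝ)) = 2 ^ k := by
        exact_mod_cast Nat.sum_range_choose k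
      rw [this, mul_pow]
      ring
    set ε := θ / (2 * (2 * D) ^ (1 / θ))
    have hε : 0 < ε := by positivity
    refine ⟨2 * (N * K * J) + 1, by positivity, ε / (d + 1) ^ 2, by positivity, ?_⟩
    rintro ⟨x, ξ⟩
    have hFs : ContDiff ℝ ∞ (fun y => f y * packet C (x, 0) y) := hfs.mul (contDiff_packet C _)
    have hFi : ∀ i k, Integrable ((partialD i)^[k] (fun y => f y * packet C (x, 0) y)) :=
      fun i k => ((integrable_exp_neg_sq ha x).const_mul _).mono'
        (contDiff_partialD_iterate i k hFs).continuous.aestronglyMeasurable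
        (Eventually.of_forall (hder x i k))
    have hI : ∫ y, f y * packet C (x, ξ) y = ∫ y, (f y * packet C (x, 0) y) *
        Complex.exp (-Complex.I * (ofR ξ ⬝ᵥ ofR y)) := by
      congr 1; funext y; rw [packet_eq_mul C x ξ, mul_assoc]
    have hchar : ∀ y, ‖Complex.exp (-Complex.I * (ofR ξ ⬝ᵥ ofR y))‖ = 1 := fun y => by
      rw [Complex.norm_exp]
      simp [im_dotProduct_ofR_ofR]
    have hmom : ∀ i (k : ℕ), |ξ i| ^ k * ‖∫ y, f y * packet C (x, ξ) y‖ ≤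
        (N * K * J) * (2 * D) ^ k * (k.factorial : ℝ) ^ θ := by
      intro i k
      have h3 := congrArg norm (integral_partialD_mul_character i ξ k hFs (hFi i))
      rw [norm_mul, norm_pow, norm_mul, Complex.norm_I, one_mul, Complex.norm_real,
        Real.norm_eq_abs, ← hI] at h3
      rw [← h3]
      refine (norm_integral_le_of_norm_le ((integrable_exp_neg_sq ha x).const_mul
        (N * K * (2 * D) ^ k * (k.factorial : ℝ) ^ θ))
        (Eventually.of_forall fun y => ?_)).trans (le_of_eq ?_)
      · rw [norm_mul, hchar, mul_one]
        exact hder x i k y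
      · rw [integral_const_mul, integral_exp_neg_sq]
        ring
    have h0 : ‖∫ y, f y * packet C (x, ξ) y‖ ≤ N * K * J := by
      rw [hI]
      refine (norm_integral_le_of_norm_le ((integrable_exp_neg_sq ha x).const_mul (N * K))
        (Eventually.of_forall fun y => ?_)).trans (le_of_eq ?_)
      · rw [norm_mul, hchar, mul_one]
        have b1 : ‖f y‖ ≤ N := by
          have := norm_le_of_gsNorm hD₁ hfD 0 0 y
          rw [multiD_zero] at this
          simpa [gsWeight] using this
        have b2 : ‖packet C (x, 0) y‖ ≤ K * Real.exp (-a * ‖y - x‖ ^ 2) := by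
          have := hpk x 0 y
          rw [multiD_zero] at this
          simpa using this
        rw [norm_mul, mul_assoc]
        exact mul_le_mul b1 b2 (norm_nonneg _) hN
      · rw [integral_const_mul, integral_exp_neg_sq]
    have hNKJ : 0 ≤ N * K * J := by positivity
    refine (le_exp_of_coords (N := 2 * (N * K * J)) hσ hσ' hε (by positivity) ξ (by linarith)
      fun i => le_exp_of_moments hθ0 hθ'.le (by positivity) hNKJ (norm_nonneg _) (abs_nonneg _)
      (hmom i)).trans ?_
    gcongr
    linarith
  obtain ⟨K₁, hK₁, ε₁, hε₁, h1⟩ := h1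
  obtain ⟨K₂, hK₂, ε₂, hε₂, h2⟩ := h2
  refine ⟨max K₁ K₂, lt_max_of_lt_left hK₁, min ε₁ ε₂, lt_min hε₁ hε₂, fun p => ?_⟩
  rcases le_total ‖p.2‖ ‖p.1‖ with h | h
  · rw [show ‖p‖ = ‖p.1‖ from max_eq_left h]
    refine (h1 p).trans ?_
    gcongr
    · exact le_max_left _ _
    · exact min_le_left _ _
  · rw [show ‖p‖ = ‖p.2‖ from max_eq_right h]
    refine (h2 p).trans ?_
    gcongr
    · exact le_max_right _ _
    · exact min_le_right _ _

/-! ### The reproducing formula -/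

instance instIsAddHaarMeasureVolumeProd :
    (volume : Measure (RSp d × RSp d)).IsAddHaarMeasure := by
  rw [Measure.volume_eq_prod]
  infer_instance

/-- As `s ≤ 1 + s^σ`, the function is dominated by `e^{-ε s}`, hence by `(1+s)^{-n}` with `n` one
more than the dimension, up to constants. -/
lemma integrable_exp_neg_rpow {E : Type*} [NormedAddCommGroup E] [NormedSpace ℝ E]
    [FiniteDimensional ℝ E] [MeasurableSpace E] [BorelSpace E] {μ : Measure E}
    [μ.IsAddHaarMeasure] {σ ε : ℝ} (hσ : 1 ≤ σ) (hε : 0 < ε) :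
    Integrable (fun x : E => Real.exp (-ε * ‖x‖ ^ σ)) μ := by
  set n := Module.finrank ℝ E + 1
  have h1 : Integrable (fun x : E => (n.factorial / ε ^ n * Real.exp (2 * ε)) *
      (1 + ‖x‖) ^ (-(n : ℝ))) μ :=
    (integrable_one_add_norm (by simp [n])).const_mul _
  refine h1.mono' ?_ (Eventually.of_forall fun x => ?_)
  · have : Continuous fun x : E => Real.exp (-ε * ‖x‖ ^ σ) := by
      have : Continuous fun x : E => ‖x‖ ^ σ :=
        continuous_norm.rpow_const fun _ => Or.inr (by linarith)
      fun_prop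
    exact this.aestronglyMeasurable
  · rw [Real.norm_of_nonneg (Real.exp_pos _).le]
    set s := ‖x‖
    have hs : 0 ≤ s := norm_nonneg x
    have h2 : s ≤ 1 + s ^ σ := by
      rcases le_total s 1 with h | h
      · have : 0 ≤ s ^ σ := by positivity
        linarith
      · have := Real.rpow_le_rpow_of_exponent_le h hσ
        rw [Real.rpow_one] at this
        linarith
    have h3 := Real.pow_div_factorial_le_exp (ε * (1 + s)) (by positivity) n
    rw [Real.rpow_neg (by positivity), Real.rpow_natCast]
    rw [mul_pow, div_le_iff₀ (by positivity)] at h3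
    have h4 : Real.exp (-ε * s ^ σ) * Real.exp (ε * (1 + s)) ≤ Real.exp (2 * ε) := by
      rw [← Real.exp_add]
      refine Real.exp_le_exp.2 ?_
      nlinarith
    rw [← div_eq_mul_inv, le_div_iff₀ (by positivity), div_mul_eq_mul_div,
      le_div_iff₀ (by positivity)]
    calc Real.exp (-ε * s ^ σ) * (1 + s) ^ n * ε ^ n
        = Real.exp (-ε * s ^ σ) * (ε ^ n * (1 + s) ^ n) := by ring
      _ ≤ Real.exp (-ε * s ^ σ) * (Real.exp (ε * (1 + s)) * n.factorial) := by gcongr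
      _ = (Real.exp (-ε * s ^ σ) * Real.exp (ε * (1 + s))) * n.factorial := by ring
      _ ≤ Real.exp (2 * ε) * n.factorial := by gcongr
      _ = _ := by ring

lemma dotProduct_ofR (x y : RSp d) : ofR x ⬝ᵥ ofR y = ((inner ℝ x y : ℝ) : ℂ) := by
  simp [dotProduct, ofR, PiLp.inner_apply, mul_comm]

/-- Fourier inversion without normalizing factors in the phases. -/
lemma integral_fourier_inversion {F : RSp d → ℂ} (hF : Continuous F) (hFi : Integrable F)
    (hFh : Integrable fun ξ : RSp d => ∫ x, F x * Complex.exp (-Complex.I * (ofR (-ξ) ⬝ᵥ ofR x)))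
    (y : RSp d) :
    ∫ ξ : RSp d, (∫ x, F x * Complex.exp (-Complex.I * (ofR (-ξ) ⬝ᵥ ofR x))) *
      Complex.exp (-Complex.I * (ofR ξ ⬝ᵥ ofR y)) = ((2 * Real.pi : ℝ) : ℂ) ^ d * F y := by
  set H : RSp d → ℂ := fun ξ => ∫ x, F x * Complex.exp (-Complex.I * (ofR (-ξ) ⬝ᵥ ofR x)) with hH
  have hpi : (-(2 * Real.pi) : ℝ) ≠ 0 := by simp [Real.pi_ne_zero]
  -- The standard transform has phase `e^{-2πi⟨x,η⟩}` while `H` has `e^{i⟨ξ,x⟩}`, whence the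
  -- dilation by `-2π`. Its Jacobian is the source of `(2π)^d`.
  have e1 : ∀ η, FourierTransform.fourier F η = H ((-(2 * Real.pi) : ℝ) • η) := by
    intro η
    rw [Real.fourier_eq', hH]
    congr 1
    funext x
    rw [dotProduct_ofR, smul_eq_mul, mul_comm (F x), inner_neg_left, inner_smul_left,
      real_inner_comm]
    congr 2
    push_cast
    simp
    ring
  have hint : Integrable (FourierTransform.fourier F) volume := by
    have : FourierTransform.fourier F = fun η => H ((-(2 * Real.pi) : ℝ) • η) := funext e1
    rw [this]
    exact (integrable_comp_smul_iff volume H hpi).2 hFh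
  have h1 := congrFun (hF.fourierInv_fourier_eq hFi hint) y
  rw [Real.fourierInv_eq'] at h1
  have h2 := Measure.integral_comp_smul (volume : Measure (RSp d))
    (fun ξ => H ξ * Complex.exp (-Complex.I * (ofR ξ ⬝ᵥ ofR y))) (-(2 * Real.pi))
  have h3 : ∀ v : RSp d, Complex.exp (((2 * Real.pi * inner ℝ v y : ℝ) : ℂ) * Complex.I) •
      FourierTransform.fourier F v = H ((-(2 * Real.pi) : ℝ) • v) *
        Complex.exp (-Complex.I * (ofR ((-(2 * Real.pi) : ℝ) • v) ⬝ᵥ ofR y)) := fun v => by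
    rw [e1, smul_eq_mul, mul_comm, dotProduct_ofR, inner_smul_left]
    congr 2
    push_cast
    simp
    ring
  simp only [h3] at h1
  rw [h2] at h1
  rw [← h1, finrank_euclideanSpace, Fintype.card_fin, abs_inv, abs_pow, abs_neg,
    abs_of_pos (by positivity : (0 : ℝ) < 2 * Real.pi), Complex.real_smul]
  push_cast
  have : (2 * (Real.pi : ℂ)) ^ d ≠ 0 := pow_ne_zero _ (by simp [Real.pi_ne_zero])
  rw [← mul_assoc, mul_inv_cancel₀ this, one_mul]

/-- The matrix of the window dual to the window of matrix `C`. -/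
def dualWindow (C : Matrix (Fin d) (Fin d) ℂ) (l : ℝ) : Matrix (Fin d) (Fin d) ℂ :=
  (2 * Complex.I * l) • (1 : Matrix (Fin d) (Fin d) ℂ) - C

lemma quad_ofR_self_one (c : ℂ) (v : RSp d) :
    quad (c • (1 : Matrix (Fin d) (Fin d) ℂ)) (ofR v) (ofR v) = c * ((‖v‖ ^ 2 : ℝ) : ℂ) := by
  rw [quad, Matrix.smul_mulVec, Matrix.one_mulVec, smul_dotProduct, dotProduct_ofR,
    real_inner_self_eq_norm_sq, smul_eq_mul]

lemma quad_matrix_sub (C C' : Matrix (Fin d) (Fin d) ℂ) (v w : Fin d → ℂ) :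
    quad (C - C') v w = quad C v w - quad C' v w := by
  simp [quad, Matrix.sub_mulVec, sub_dotProduct]

lemma isWindow_smul_one {m : ℝ} (hm : 0 < m) :
    IsWindow ((Complex.I * m) • (1 : Matrix (Fin d) (Fin d) ℂ)) := by
  refine ⟨by simp [Matrix.IsSymm], m, hm, fun v => ?_⟩
  rw [quad_ofR_self_one, mul_assoc, ← Complex.ofReal_mul, Complex.I_mul_im, Complex.ofReal_re]

/-- The imaginary part is `2l - Im C`, at least `l` once `l` dominates the entries of `C`. -/
lemma isWindow_dualWindow {C : Matrix (Fin d) (Fin d) ℂ} (hC : C.IsSymm) {l : ℝ} (hl : 0 < l)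
    (hl' : ∑ i, ∑ j, ‖C i j‖ ≤ l) : IsWindow (dualWindow C l) := by
  refine ⟨?_, l, hl, fun v => ?_⟩
  · simp [dualWindow, Matrix.IsSymm, Matrix.transpose_sub, hC.eq]
  · rw [dualWindow, quad_matrix_sub, quad_ofR_self_one]
    have h1 : (quad C (ofR v) (ofR v)).im ≤ l * ‖v‖ ^ 2 := by
      refine (le_abs_self _).trans ((Complex.abs_im_le_norm _).trans ((norm_quad_le C _ _).trans ?_))
      rw [mul_assoc, sq]
      have := norm_ofR_le v
      gcongr
    have h2 : (2 * Complex.I * (l : ℂ) * ((‖v‖ ^ 2 : ℝ) : ℂ)).im = 2 * l * ‖v‖ ^ 2 := by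
      have : 2 * Complex.I * (l : ℂ) * ((‖v‖ ^ 2 : ℝ) : ℂ) = ((2 * l * ‖v‖ ^ 2 : ℝ) : ℂ) * Complex.I := by
        push_cast; ring
      rw [this, Complex.mul_I_im, Complex.ofReal_re]
    rw [Complex.sub_im, h2]
    linarith

/-- The two matrices add up to `2il`. Thus the product of the windows is a real Gaussian, whose
integral over `t` does not depend on `y`. -/
lemma packet_zero_mul_dual (C : Matrix (Fin d) (Fin d) ℂ) (l : ℝ) (t y : RSp d) :
    packet C (t, 0) y * packet (dualWindow C l) (t, 0) y =
      ((Real.exp (-l * ‖y - t‖ ^ 2) : ℝ) : ℂ) := by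
  have h0 : ofR (0 : RSp d) = 0 := by funext i; simp [ofR]
  rw [packet, packet, packetEnt, packetEnt, ← Complex.exp_add, Complex.ofReal_exp]
  congr 1
  rw [← ofR_sub, dualWindow, quad_matrix_sub, quad_ofR_self_one]
  simp only [h0, zero_dotProduct, mul_zero, zero_add]
  push_cast
  linear_combination (l : ℂ) * (‖y - t‖ : ℂ) ^ 2 * Complex.I_mul_I

/-- The wave packet transform of `f` with respect to the dual window. -/
def coef (C : Matrix (Fin d) (Fin d) ℂ) (l : ℝ) (f : RSp d → ℂ) (p : RSp d × RSp d) : ℂ :=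
  ∫ y, f y * packet (dualWindow C l) (p.1, -p.2) y

/-- The constant in the reproducing formula. -/
def reprConst (d : ℕ) (l : ℝ) : ℂ :=
  (((2 * Real.pi : ℝ) : ℂ) ^ d)⁻¹ * (((∫ t : RSp d, Real.exp (-l * ‖t‖ ^ 2) : ℝ) : ℂ))⁻¹

lemma integral_exp_neg_sq_pos {l : ℝ} (hl : 0 < l) :
    0 < ∫ t : RSp d, Real.exp (-l * ‖t‖ ^ 2) := by
  rw [GaussianFourier.integral_rexp_neg_mul_sq_norm hl]
  positivity

lemma stronglyMeasurable_coef (C : Matrix (Fin d) (Fin d) ℂ) (l : ℝ) {f : RSp d → ℂ}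
    (hf : Continuous f) : StronglyMeasurable (coef C l f) := by
  have h1 : Continuous fun q : (RSp d × RSp d) × RSp d =>
      f q.2 * packet (dualWindow C l) (q.1.1, -q.1.2) q.2 := by
    have := (continuous_packet (dualWindow C l)).comp
      (f := fun q : (RSp d × RSp d) × RSp d => ((q.1.1, -q.1.2), q.2)) (by fun_prop)
    exact (hf.comp continuous_snd).mul this
  exact (StronglyMeasurable.integral_prod_right (ν := (volume : Measure (RSp d)))
    (f := fun (p : RSp d × RSp d) y => f y * packet (dualWindow C l) (p.1, -p.2) y)
    h1.stronglyMeasurable)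

lemma norm_prod_neg (p : RSp d × RSp d) : ‖((p.1, -p.2) : RSp d × RSp d)‖ = ‖p‖ := by
  simp [Prod.norm_def]

lemma exists_decay_coef {θ : ℝ} (hθ : 1 / 2 ≤ θ) (hθ' : θ < 1) {f : RSp d → ℂ}
    (hf : f ∈ GS d θ) {C : Matrix (Fin d) (Fin d) ℂ} {l : ℝ} (hC : IsWindow (dualWindow C l)) :
    ∃ K : ℝ, 0 < K ∧ ∃ ε : ℝ, 0 < ε ∧ ∀ p : RSp d × RSp d,
      ‖coef C l f p‖ ≤ K * Real.exp (-ε * ‖p‖ ^ (1 / θ)) := by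
  obtain ⟨K, hK, ε, hε, h⟩ := exists_decay_packet_transform hθ hθ' hf hC
  refine ⟨K, hK, ε, hε, fun p => ?_⟩
  rw [← norm_prod_neg p]
  exact h _

lemma norm_packet_le_one {C : Matrix (Fin d) (Fin d) ℂ} (hC : IsWindow C) (p : RSp d × RSp d)
    (y : RSp d) : ‖packet C p y‖ ≤ 1 := by
  obtain ⟨-, a, ha, h⟩ := hC
  refine (norm_packet_le h p y).trans (Real.exp_le_one_iff.2 ?_)
  have : 0 ≤ a / 2 * ‖y - p.1‖ ^ 2 := by positivity
  linarith

/-- For a fixed centre `t`, the frequency integral is Fourier inversion for `f` times the dual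
window, giving `(2π)^d f(y) e^{-l|y-t|²}`. Integrating over `t` leaves the constant inverted in
`reprConst`. -/
theorem integral_coef_mul_packet {θ : ℝ} (hθ : 1 / 2 ≤ θ) (hθ' : θ < 1) {f : RSp d → ℂ}
    (hf : f ∈ GS d θ) {C : Matrix (Fin d) (Fin d) ℂ} (hC : IsWindow C) {l : ℝ} (hl : 0 < l)
    (hC' : IsWindow (dualWindow C l)) (y : RSp d) :
    reprConst d l * ∫ p, coef C l f p * packet C p y = f y := by
  obtain ⟨hσ, hσ'⟩ := one_le_one_div hθ hθ'
  obtain ⟨K, hK, ε, hε, hdec⟩ := exists_decay_coef hθ hθ' hf hC'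
  have hcont : Continuous f := hf.1.continuous
  have hpc : ∀ {C : Matrix (Fin d) (Fin d) ℂ} (p), Continuous (packet C p) := fun p =>
    (contDiff_packet _ p).continuous
  have hmeas := stronglyMeasurable_coef C l hcont
  have hint : Integrable (fun p => coef C l f p * packet C p y) := by
    refine ((integrable_exp_neg_rpow hσ hε).const_mul K).mono' ?_ (Eventually.of_forall fun p => ?_)
    · refine hmeas.aestronglyMeasurable.mul ?_
      exact ((continuous_packet C).comp (Continuous.prodMk_left y)).aestronglyMeasurable
    · rw [norm_mul]
      exact (mul_le_of_le_one_right (norm_nonneg _) (norm_packet_le_one hC p y)).trans (hdec p)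
  have hinner : ∀ t : RSp d, ∫ ξ, coef C l f (t, ξ) * packet C (t, ξ) y =
      ((2 * Real.pi : ℝ) : ℂ) ^ d * (f y * ((Real.exp (-l * ‖y - t‖ ^ 2) : ℝ) : ℂ)) := by
    intro t
    set F : RSp d → ℂ := fun x => f x * packet (dualWindow C l) (t, 0) x with hF
    have e1 : ∀ ξ, coef C l f (t, ξ) =
        ∫ x, F x * Complex.exp (-Complex.I * (ofR (-ξ) ⬝ᵥ ofR x)) := fun ξ => by
      rw [coef]
      congr 1; funext x
      rw [packet_eq_mul, hF, mul_assoc]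
    have hFi : Integrable F :=
      (integrable_of_mem hf).mul_bdd (c := 1) (hpc _).aestronglyMeasurable
        (Eventually.of_forall fun x => norm_packet_le_one hC' _ x)
    have hFh : Integrable fun ξ : RSp d =>
        ∫ x, F x * Complex.exp (-Complex.I * (ofR (-ξ) ⬝ᵥ ofR x)) := by
      simp only [← e1]
      refine ((integrable_exp_neg_rpow hσ hε).const_mul K).mono'
        (hmeas.comp_measurable measurable_prodMk_left).aestronglyMeasurable
        (Eventually.of_forall fun ξ => (hdec _).trans ?_)
      gcongr K * Real.exp ?_
      have : ‖ξ‖ ^ (1 / θ) ≤ ‖((t, ξ) : RSp d × RSp d)‖ ^ (1 / θ) :=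
        Real.rpow_le_rpow (norm_nonneg _) (norm_snd_le (t, ξ)) (by linarith)
      nlinarith
    have h := integral_fourier_inversion (F := F) (hcont.mul (hpc _)) hFi hFh y
    calc _ = ∫ ξ : RSp d, packet C (t, 0) y *
          ((∫ x, F x * Complex.exp (-Complex.I * (ofR (-ξ) ⬝ᵥ ofR x))) *
            Complex.exp (-Complex.I * (ofR ξ ⬝ᵥ ofR y))) := by
          congr 1; funext ξ; rw [← e1, packet_eq_mul]; ring
      _ = _ := by
          rw [integral_const_mul, h, ← packet_zero_mul_dual C l t y]
          ring
  rw [Measure.volume_eq_prod] at hint ⊢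
  rw [integral_prod _ hint]
  simp only [hinner]
  rw [integral_const_mul, integral_const_mul, integral_complex_ofReal]
  have h2 : ∫ t : RSp d, Real.exp (-l * ‖y - t‖ ^ 2) = ∫ t : RSp d, Real.exp (-l * ‖t‖ ^ 2) := by
    simp only [norm_sub_rev y]
    exact integral_exp_neg_sq l y
  rw [h2, reprConst]
  have h3 : ((∫ t : RSp d, Real.exp (-l * ‖t‖ ^ 2) : ℝ) : ℂ) ≠ 0 := by
    exact_mod_cast (integral_exp_neg_sq_pos hl).ne'
  have h4 : ((2 * Real.pi : ℝ) : ℂ) ^ d ≠ 0 := pow_ne_zero _ (by simp [Real.pi_ne_zero])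
  generalize ((∫ t : RSp d, Real.exp (-l * ‖t‖ ^ 2) : ℝ) : ℂ) = J at h3 ⊢
  field_simp

theorem apply_eq_integral_coef {θ : ℝ} (hθ : 1 / 2 ≤ θ) (hθ' : θ < 1) (f : GS d θ)
    {C : Matrix (Fin d) (Fin d) ℂ} (hC : IsWindow C) {l : ℝ} (hl : 0 < l)
    (hC' : IsWindow (dualWindow C l)) (u : Ultra d θ) :
    (u : GS d θ →ₗ[ℂ] ℂ) f = reprConst d l *
      ∫ p, coef C l (f : RSp d → ℂ) p * (u : GS d θ →ₗ[ℂ] ℂ) (pkt hθ hθ' hC p) := by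
  obtain ⟨hσ, hσ'⟩ := one_le_one_div hθ hθ'
  obtain ⟨K, hK, ε, hε, hdec⟩ := exists_decay_coef hθ hθ' f.2 hC'
  have hmeas := stronglyMeasurable_coef C l f.2.1.continuous
  obtain ⟨h, hu⟩ := exists_integral_packet (d := d) hθ hθ' (δ := ε / 2) (by positivity) hC
    (μ := volume) (a := coef C l (f : RSp d → ℂ)) (π := id) hmeas.aestronglyMeasurable
    measurable_id (by
      refine ((integrable_exp_neg_rpow hσ (by positivity : 0 < ε / 2)).const_mul K).mono' ?_
        (Eventually.of_forall fun p => ?_)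
      · refine hmeas.norm.aestronglyMeasurable.mul ?_
        have : Continuous fun p : RSp d × RSp d => ‖p‖ ^ (1 / θ) :=
          continuous_norm.rpow_const fun _ => Or.inr (by linarith)
        exact Continuous.aestronglyMeasurable (by simp only [id]; fun_prop)
      · rw [Real.norm_of_nonneg (by positivity)]
        calc _ ≤ K * Real.exp (-ε * ‖p‖ ^ (1 / θ)) * Real.exp (ε / 2 * ‖p‖ ^ (1 / θ)) := by
              gcongr
              · exact hdec p
              · exact le_rfl
          _ = _ := by
              rw [mul_assoc, ← Real.exp_add]
              congr 2; ring)
  have e : f = reprConst d l • (⟨_, h⟩ : GS d θ) := by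
    apply Subtype.ext
    funext y
    exact (integral_coef_mul_packet hθ hθ' f.2 hC hl hC' y).symm
  conv_lhs => rw [e]
  rw [map_smul, hu u, smul_eq_mul]
  rfl

/-! ### The regularizing operators -/

lemma packet_smul_one (m : ℝ) (x ξ y : RSp d) :
    packet ((Complex.I * m) • (1 : Matrix (Fin d) (Fin d) ℂ)) (x, ξ) y =
      Complex.exp (-Complex.I * ((inner ℝ ξ y : ℝ) : ℂ) - m / 2 * (‖y - x‖ : ℂ) ^ 2) := by
  rw [packet, packetEnt, ← ofR_sub, quad_ofR_self_one, dotProduct_ofR]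
  congr 1
  push_cast
  linear_combination (m / 2 * (‖y - x‖ : ℂ) ^ 2) * Complex.I_mul_I

lemma integral_gaussian_character {m : ℝ} (hm : 0 < m) (z ξ : RSp d) :
    ∫ y : RSp d, Complex.exp (-(m : ℂ) * (‖y - z‖ : ℂ) ^ 2 + Complex.I * ((inner ℝ ξ y : ℝ) : ℂ)) =
      (Real.pi / m : ℂ) ^ (d / 2 : ℂ) *
        Complex.exp (Complex.I * ((inner ℝ ξ z : ℝ) : ℂ) - (‖ξ‖ : ℂ) ^ 2 / (4 * m)) := by
  rw [← integral_add_right_eq_self _ z]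
  have h := GaussianFourier.integral_cexp_neg_mul_sq_norm_add (V := RSp d) (b := (m : ℂ))
    (by simpa using hm) Complex.I ξ
  rw [finrank_euclideanSpace, Fintype.card_fin, Complex.I_sq] at h
  rw [sub_eq_add_neg, Complex.exp_add, mul_left_comm,
    show -((‖ξ‖ : ℂ) ^ 2 / (4 * m)) = -1 * (‖ξ‖ : ℂ) ^ 2 / (4 * m) by ring, ← h,
    ← integral_const_mul]
  congr 1
  funext y
  rw [← Complex.exp_add, add_sub_cancel_right, inner_add_right]
  congr 1
  push_cast
  ring

/-- The normalizing constant of the heat kernel at time `ε / 2`. -/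
def heatConst (d : ℕ) (ε : ℝ) : ℝ := (∫ z : RSp d, Real.exp (-(ε⁻¹ / 2) * ‖z‖ ^ 2))⁻¹

lemma heatConst_pos {ε : ℝ} (hε : 0 < ε) : 0 < heatConst d ε :=
  inv_pos.2 (integral_exp_neg_sq_pos (by positivity))

/-- The `ξ`-integral of a Gaussian is a heat kernel in `x - y`, that is, a packet of window `i/ε`
and frequency zero. So the operator itself is expressed through packets. -/
lemma pdoKernel_gaussSymbol {ε : ℝ} (hε : 0 < ε) (x : RSp d) :
    pdoKernel (gaussSymbol ε) x = ((heatConst d ε * Real.exp (-(ε / 2) * ‖x‖ ^ 2) : ℝ) : ℂ) •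
      packet ((Complex.I * (ε⁻¹ : ℝ)) • (1 : Matrix (Fin d) (Fin d) ℂ)) (x, 0) := by
  funext y
  have h := integral_gaussian_character (d := d) (m := ε / 2) (by positivity) 0 (x - y)
  have e1 : ∫ ξ : RSp d, Complex.exp (Complex.I * ((inner ℝ (x - y) ξ : ℝ) : ℂ)) *
      gaussSymbol ε x ξ = ((Real.exp (-(ε / 2) * ‖x‖ ^ 2) : ℝ) : ℂ) *
        ((Real.pi / (ε / 2 : ℝ) : ℂ) ^ (d / 2 : ℂ) *
          Complex.exp (-(‖x - y‖ : ℂ) ^ 2 / (4 * (ε / 2 : ℝ)))) := by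
    rw [show (-(‖x - y‖ : ℂ) ^ 2 / (4 * (ε / 2 : ℝ))) =
      Complex.I * ((inner ℝ (x - y) (0 : RSp d) : ℝ) : ℂ) - (‖x - y‖ : ℂ) ^ 2 / (4 * (ε / 2 : ℝ)) by
        rw [inner_zero_right]; push_cast; ring, ← h, ← integral_const_mul]
    congr 1
    funext ξ
    rw [gaussSymbol, Complex.ofReal_mul, Complex.ofReal_exp (-(ε / 2) * ‖ξ‖ ^ 2), sub_zero,
      Complex.exp_add]
    push_cast
    ring
  have e2 : (heatConst d ε : ℂ) = (((2 * Real.pi : ℝ) : ℂ) ^ d)⁻¹ *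
      (Real.pi / (ε / 2 : ℝ) : ℂ) ^ (d / 2 : ℂ) := by
    have h2 : (Real.pi / (ε / 2 : ℝ) : ℂ) ^ (d / 2 : ℂ) =
        (((Real.pi / (ε / 2)) ^ ((d : ℝ) / 2) : ℝ) : ℂ) := by
      rw [Complex.ofReal_cpow (by positivity)]
      push_cast
      rfl
    rw [h2, heatConst, GaussianFourier.integral_rexp_neg_mul_sq_norm (by positivity),
      finrank_euclideanSpace, Fintype.card_fin]
    norm_cast
    rw [← Real.rpow_neg_one, eq_comm, inv_mul_eq_iff_eq_mul₀ (by positivity), Real.rpow_neg_one,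
      ← div_eq_mul_inv, eq_div_iff (by positivity), ← Real.mul_rpow (by positivity) (by positivity)]
    have : Real.pi / (ε / 2) * (Real.pi / (ε⁻¹ / 2)) = (2 * Real.pi) ^ (2 : ℝ) := by
      rw [Real.rpow_two]; field_simp
    rw [this, ← Real.rpow_mul (by positivity), ← Real.rpow_natCast]
    congr 1; ring
  rw [pdoKernel, e1, Pi.smul_apply, smul_eq_mul, packet_smul_one, Complex.ofReal_mul (heatConst d ε), e2,
    inner_zero_left, norm_sub_rev x y]
  have e3 : -(‖y - x‖ : ℂ) ^ 2 / (4 * (ε / 2 : ℝ)) =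
      -Complex.I * ((0 : ℝ) : ℂ) - ((ε⁻¹ : ℝ) : ℂ) / 2 * (‖y - x‖ : ℂ) ^ 2 := by
    have : (ε : ℂ) ≠ 0 := by exact_mod_cast hε.ne'
    push_cast
    field_simp
    ring
  rw [e3]
  push_cast
  ring

lemma pdo_eq {θ : ℝ} (hθ : 1 / 2 ≤ θ) (hθ' : θ < 1) {ε : ℝ} (hε : 0 < ε) (u : Ultra d θ)
    (x : RSp d) : pdo (gaussSymbol ε) u x =
      ((heatConst d ε * Real.exp (-(ε / 2) * ‖x‖ ^ 2) : ℝ) : ℂ) *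
        (u : GS d θ →ₗ[ℂ] ℂ) (pkt hθ hθ' (isWindow_smul_one (inv_pos.2 hε)) (x, 0)) := by
  have h : pdoKernel (gaussSymbol ε) x ∈ GS d θ := by
    rw [pdoKernel_gaussSymbol hε]
    exact (GS d θ).smul_mem _ (packet_mem hθ hθ' (isWindow_smul_one (inv_pos.2 hε)) _)
  rw [pdo, pair, dif_pos h, ← smul_eq_mul, ← map_smul]
  congr 1
  exact Subtype.ext (pdoKernel_gaussSymbol hε x)

lemma dualWindow_smul_one (m : ℝ) :
    dualWindow ((Complex.I * m) • (1 : Matrix (Fin d) (Fin d) ℂ)) m = (Complex.I * m) • 1 := by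
  rw [dualWindow, ← sub_smul]
  congr 1
  ring

/-- The window `im` is its own dual for `l = m`. The parallelogram law merges the two Gaussians into
one centred at the midpoint, leaving `e^{-m|x-p.1|²/4}`. -/
lemma coef_smul_one {m : ℝ} (hm : 0 < m) (x : RSp d) (p : RSp d × RSp d) :
    coef ((Complex.I * m) • (1 : Matrix (Fin d) (Fin d) ℂ)) m
      (packet ((Complex.I * m) • (1 : Matrix (Fin d) (Fin d) ℂ)) (x, 0)) p =
    (Real.pi / m : ℂ) ^ (d / 2 : ℂ) * Complex.exp (-(m / 4) * (‖x - p.1‖ : ℂ) ^ 2 +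
      Complex.I * ((inner ℝ p.2 ((1 / 2 : ℝ) • (x + p.1)) : ℝ) : ℂ) -
        (‖p.2‖ : ℂ) ^ 2 / (4 * m)) := by
  rw [coef, dualWindow_smul_one, add_sub_assoc, Complex.exp_add, mul_left_comm,
    ← integral_gaussian_character hm, ← integral_const_mul]
  congr 1
  funext y
  rw [packet_smul_one, packet_smul_one, ← Complex.exp_add, ← Complex.exp_add]
  congr 1
  have h : ‖y - x‖ ^ 2 + ‖y - p.1‖ ^ 2 =
      2 * ‖y - (1 / 2 : ℝ) • (x + p.1)‖ ^ 2 + 1 / 2 * ‖x - p.1‖ ^ 2 := by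
    have e := parallelogram_law_with_norm ℝ (y - x) (y - p.1)
    have e1 : y - x + (y - p.1) = (2 : ℝ) • (y - (1 / 2 : ℝ) • (x + p.1)) := by module
    have e2 : y - x - (y - p.1) = -(x - p.1) := by abel
    rw [e1, e2, norm_smul, norm_neg, Real.norm_of_nonneg (by norm_num)] at e
    nlinarith
  have h' : (‖y - x‖ : ℂ) ^ 2 + (‖y - p.1‖ : ℂ) ^ 2 =
      2 * (‖y - (1 / 2 : ℝ) • (x + p.1)‖ : ℂ) ^ 2 + 1 / 2 * (‖x - p.1‖ : ℂ) ^ 2 := by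
    have := congrArg (fun r : ℝ => (r : ℂ)) h
    push_cast at this
    exact this
  rw [inner_zero_left, inner_neg_left]
  push_cast
  linear_combination (-(m : ℂ) / 2) * h'

lemma norm_sq_prod_le (p : RSp d × RSp d) : ‖p‖ ^ 2 ≤ ‖p.1‖ ^ 2 + ‖p.2‖ ^ 2 := by
  rw [Prod.norm_def]
  rcases max_cases ‖p.1‖ ‖p.2‖ with ⟨h, -⟩ | ⟨h, -⟩ <;> rw [h] <;> nlinarith [norm_nonneg p.1]

lemma rpow_le_one_add_sq {σ t : ℝ} (hσ : 1 ≤ σ) (hσ' : σ ≤ 2) (ht : 0 ≤ t) :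
    t ^ σ ≤ 1 + t ^ 2 := by
  rcases le_total t 1 with h | h
  · have := Real.rpow_le_one ht h (by linarith : 0 ≤ σ)
    nlinarith
  · have := Real.rpow_le_rpow_of_exponent_le h hσ'
    rw [Real.rpow_two] at this
    linarith

/-- The regularization of an ultradistribution is a Gelfand-Shilov function. -/
theorem pdo_mem {θ : ℝ} (hθ : 1 / 2 ≤ θ) (hθ' : θ < 1) {ε : ℝ} (hε : 0 < ε) (u : Ultra d θ) :
    (fun x => pdo (gaussSymbol ε) u x) ∈ GS d θ := by
  obtain ⟨hσ, hσ'⟩ := one_le_one_div hθ hθ'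
  set m := ε⁻¹ with hm
  have hm0 : 0 < m := inv_pos.2 hε
  have hC₁ : IsWindow ((Complex.I * m) • (1 : Matrix (Fin d) (Fin d) ℂ)) := isWindow_smul_one hm0
  -- `A` and `B` are the Gaussian rates in `x` and in `x - p.1` of the expanded kernel. Completing
  -- the square yields rate `A+B` about `B/(A+B) p.1`, hence the window `2(A+B)i`, and the remainder
  -- `AB/(A+B)|p.1|²`, which is the decay of `b` in position.
  set A := ε / 2 with hA
  set B := m / 4 with hB
  have hA0 : 0 < A := by positivity
  have hB0 : 0 < B := by positivity
  have hAB : 0 < A + B := by positivity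
  have hC₂ : IsWindow ((Complex.I * (2 * (A + B) : ℝ)) • (1 : Matrix (Fin d) (Fin d) ℂ)) :=
    isWindow_smul_one (by positivity)
  set c := min (A * B / (A + B)) (1 / (4 * m)) with hc
  have hc0 : 0 < c := by positivity
  -- The Gaussian rate `c` of the coefficients pays twice for `c/4`: once for the growth of `u` on
  -- packets and once for the norm of the packets being superposed.
  obtain ⟨K, hK, hu⟩ := norm_apply_pkt_le hθ hθ' (δ := c / 4) (by positivity) hC₁ u
  have hcu := continuous_apply_pkt hθ hθ' hC₁ u
  set b : RSp d × RSp d → ℂ := fun p => Complex.exp (Complex.I / 2 * ((inner ℝ p.2 p.1 : ℝ) : ℂ) -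
    (A * B / (A + B) : ℝ) * (‖p.1‖ : ℂ) ^ 2 - (‖p.2‖ : ℂ) ^ 2 / (4 * m)) with hb
  have hbc : Continuous b := by simp only [hb]; fun_prop
  have hbn : ∀ p, ‖b p‖ ≤ Real.exp (-c * ‖p‖ ^ 2) := fun p => by
    rw [hb, Complex.norm_exp]
    refine Real.exp_le_exp.2 ?_
    have e : (Complex.I / 2 * ((inner ℝ p.2 p.1 : ℝ) : ℂ) -
        (A * B / (A + B) : ℝ) * (‖p.1‖ : ℂ) ^ 2 - (‖p.2‖ : ℂ) ^ 2 / (4 * m)) =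
        ((-(A * B / (A + B)) * ‖p.1‖ ^ 2 - 1 / (4 * m) * ‖p.2‖ ^ 2 : ℝ) : ℂ) +
          ((1 / 2 * inner ℝ p.2 p.1 : ℝ) : ℂ) * Complex.I := by
      push_cast; ring
    rw [e, Complex.add_re, Complex.re_ofReal_mul, Complex.ofReal_re, Complex.I_re, mul_zero,
      add_zero]
    have h1 := norm_sq_prod_le p
    have h2 : c * ‖p.1‖ ^ 2 ≤ A * B / (A + B) * ‖p.1‖ ^ 2 := by gcongr; exact min_le_left _ _
    have h3 : c * ‖p.2‖ ^ 2 ≤ 1 / (4 * m) * ‖p.2‖ ^ 2 := by gcongr; exact min_le_right _ _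
    nlinarith
  set κ : ℂ := reprConst d m * heatConst d ε * (Real.pi / m : ℂ) ^ (d / 2 : ℂ)
  -- The frequency `-1/2 p.2` comes from the midpoint phase `e^{i⟨p.2,(x+p.1)/2⟩}`, since packets
  -- carry `e^{-i⟨ξ,·⟩}`.
  set π : RSp d × RSp d → RSp d × RSp d := fun p => ((B / (A + B)) • p.1, (-(1 / 2 : ℝ)) • p.2)
  have hπn : ∀ p, ‖π p‖ ≤ ‖p‖ := fun p => by
    have hs : B / (A + B) ≤ 1 := by rw [div_le_one hAB]; linarith
    refine max_le ?_ ?_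
    · simp only [π, norm_smul]
      rw [Real.norm_of_nonneg (by positivity)]
      exact (mul_le_of_le_one_left (norm_nonneg _) hs).trans (norm_fst_le p)
    · simp only [π, norm_smul]
      rw [norm_neg, Real.norm_of_nonneg (by norm_num)]
      exact (mul_le_of_le_one_left (norm_nonneg _) (by norm_num)).trans (norm_snd_le p)
  have hπc : Continuous π := by fun_prop
  obtain ⟨h, -⟩ := exists_integral_packet (d := d) hθ hθ' (δ := c / 4) (by positivity) hC₂
    (μ := volume) (a := fun p => κ * b p * (u : GS d θ →ₗ[ℂ] ℂ) (pkt hθ hθ' hC₁ p)) (π := π)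
    ((continuous_const.mul hbc).mul hcu).aestronglyMeasurable hπc.measurable (by
      refine ((integrable_exp_neg_rpow (by norm_num : (1 : ℝ) ≤ 2)
        (by positivity : 0 < c / 2)).const_mul (‖κ‖ * K * Real.exp (c / 2))).mono' ?_
        (Eventually.of_forall fun p => ?_)
      · have h1 : Continuous fun p : RSp d × RSp d => ‖π p‖ ^ (1 / θ) :=
          hπc.norm.rpow_const fun _ => Or.inr (by linarith)
        exact Continuous.aestronglyMeasurable (by fun_prop)
      · rw [Real.norm_of_nonneg (by positivity), norm_mul, norm_mul, Real.rpow_two]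
        have h1 : ‖π p‖ ^ (1 / θ) ≤ 1 + ‖p‖ ^ 2 :=
          (Real.rpow_le_rpow (norm_nonneg _) (hπn p) (by linarith)).trans
            (rpow_le_one_add_sq hσ hσ' (norm_nonneg _))
        have h2 := rpow_le_one_add_sq hσ hσ' (norm_nonneg p)
        calc _ ≤ ‖κ‖ * Real.exp (-c * ‖p‖ ^ 2) * (K * Real.exp (c / 4 * (1 + ‖p‖ ^ 2))) *
              Real.exp (c / 4 * (1 + ‖p‖ ^ 2)) := by
              gcongr
              · exact hbn p
              · exact (hu p).trans (by gcongr)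
          _ = ‖κ‖ * K * (Real.exp (-c * ‖p‖ ^ 2) * Real.exp (c / 4 * (1 + ‖p‖ ^ 2)) *
              Real.exp (c / 4 * (1 + ‖p‖ ^ 2))) := by ring
          _ = ‖κ‖ * K * (Real.exp (c / 2) * Real.exp (-(c / 2) * ‖p‖ ^ 2)) := by
              rw [← Real.exp_add, ← Real.exp_add, ← Real.exp_add]
              congr 2; ring
          _ = _ := by ring)
  convert h using 1
  funext x
  rw [pdo_eq hθ hθ' hε, apply_eq_integral_coef hθ hθ' _ hC₁ hm0
    (by rw [dualWindow_smul_one]; exact hC₁), ← integral_const_mul, ← integral_const_mul]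
  congr 1
  funext p
  change _ * (_ * (coef _ _ (packet _ (x, 0)) p * _)) = _
  rw [coef_smul_one hm0, packet_smul_one]
  have key : (Real.exp (-(ε / 2) * ‖x‖ ^ 2) : ℂ) * Complex.exp (-(m / 4) * (‖x - p.1‖ : ℂ) ^ 2 +
      Complex.I * ((inner ℝ p.2 ((1 / 2 : ℝ) • (x + p.1)) : ℝ) : ℂ) -
        (‖p.2‖ : ℂ) ^ 2 / (4 * m)) = b p * Complex.exp (-Complex.I *
          ((inner ℝ ((-(1 / 2 : ℝ)) • p.2) x : ℝ) : ℂ) -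
          ((2 * (A + B) : ℝ) : ℂ) / 2 * (‖x - (B / (A + B)) • p.1‖ : ℂ) ^ 2) := by
    have h1 : A * ‖x‖ ^ 2 + B * ‖x - p.1‖ ^ 2 =
        (A + B) * ‖x - (B / (A + B)) • p.1‖ ^ 2 + A * B / (A + B) * ‖p.1‖ ^ 2 := by
      rw [norm_sub_sq_real, norm_sub_sq_real, inner_smul_right, norm_smul, mul_pow,
        Real.norm_eq_abs, sq_abs]
      field_simp
      ring
    have h2 := congrArg (fun r : ℝ => (r : ℂ)) h1
    simp only [Complex.ofReal_add, Complex.ofReal_mul, Complex.ofReal_pow] at h2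
    simp only [hb]
    rw [Complex.ofReal_exp, ← Complex.exp_add, ← Complex.exp_add, inner_smul_left,
      inner_smul_right, inner_add_right]
    congr 1
    have hA' : (A : ℂ) = ε / 2 := by rw [hA]; push_cast; rfl
    have hB' : (B : ℂ) = m / 4 := by rw [hB]; push_cast; rfl
    simp only [Complex.ofReal_mul, Complex.ofReal_neg, Complex.ofReal_div, Complex.ofReal_add,
      Complex.ofReal_pow, Complex.ofReal_ofNat, Complex.ofReal_one, map_neg, conj_trivial] at h2 ⊢
    rw [← hA', ← hB']
    linear_combination -h2
  rw [Complex.ofReal_mul]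
  linear_combination (reprConst d m * heatConst d ε * (Real.pi / m : ℂ) ^ (d / 2 : ℂ) *
    (u : GS d θ →ₗ[ℂ] ℂ) (pkt hθ hθ' hC₁ p)) * key

/-! ### The kernel of the regularizing operators on phase space -/

/-- `P` and `R` are the real and imaginary parts of `CD`. Their norm bounds follow by testing the
form on `P` and `R` themselves. -/
lemma exists_quad_eq_inner (C : Matrix (Fin d) (Fin d) ℂ) (D : RSp d) :
    ∃ P R : RSp d, ‖P‖ ≤ (∑ i, ∑ j, ‖C i j‖) * ‖D‖ ∧ ‖R‖ ≤ (∑ i, ∑ j, ‖C i j‖) * ‖D‖ ∧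
      ∀ v : RSp d, quad C (ofR D) (ofR v) =
        ((inner ℝ P v : ℝ) : ℂ) + ((inner ℝ R v : ℝ) : ℂ) * Complex.I := by
  set κ := ∑ i, ∑ j, ‖C i j‖
  set P : RSp d := WithLp.toLp 2 fun i => (C.mulVec (ofR D) i).re with hP
  set R : RSp d := WithLp.toLp 2 fun i => (C.mulVec (ofR D) i).im with hR
  have h : ∀ v : RSp d, quad C (ofR D) (ofR v) =
      ((inner ℝ P v : ℝ) : ℂ) + ((inner ℝ R v : ℝ) : ℂ) * Complex.I := fun v => by
    simp only [quad, dotProduct, PiLp.inner_apply, Complex.ofReal_sum, Finset.sum_mul,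
      ← Finset.sum_add_distrib]
    refine Finset.sum_congr rfl fun i _ => ?_
    conv_lhs => rw [← Complex.re_add_im (C.mulVec (ofR D) i)]
    simp only [ofR, hP, hR, RCLike.inner_apply, conj_trivial, Complex.ofReal_mul]
    ring
  have hb : ∀ v : RSp d, ‖quad C (ofR D) (ofR v)‖ ≤ κ * ‖D‖ * ‖v‖ := fun v =>
    (norm_quad_le C _ _).trans (by gcongr <;> exact norm_ofR_le _)
  have hle : ∀ Q : RSp d, ‖Q‖ ^ 2 ≤ ‖quad C (ofR D) (ofR Q)‖ → ‖Q‖ ≤ κ * ‖D‖ := fun Q hQ => by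
    have h1 := hQ.trans (hb Q)
    rcases (norm_nonneg Q).eq_or_lt with h0 | h0
    · rw [← h0]; positivity
    · nlinarith
  refine ⟨P, R, hle P ?_, hle R ?_, h⟩
  · have := Complex.abs_re_le_norm (quad C (ofR D) (ofR P))
    rw [h P] at this ⊢
    simpa [← Complex.ofReal_pow] using this
  · have := Complex.abs_im_le_norm (quad C (ofR D) (ofR R))
    rw [h R] at this ⊢
    simpa [← Complex.ofReal_pow] using this

/-- A real shift removes `S`; the oscillation `W` then produces Gaussian decay. -/
lemma norm_cexp_quadratic_integral {b : ℝ} (hb : 0 < b) (S W : RSp d) (c : ℂ) :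
    ‖∫ v : RSp d, Complex.exp (-(b : ℂ) * (‖v‖ : ℂ) ^ 2 - ((inner ℝ S v : ℝ) : ℂ) +
      Complex.I * ((inner ℝ W v : ℝ) : ℂ) + c)‖ =
    (Real.pi / b) ^ ((d : ℝ) / 2) *
      Real.exp (‖S‖ ^ 2 / (4 * b) - ‖W‖ ^ 2 / (4 * b) + c.re) := by
  set z : RSp d := (-(1 / (2 * b))) • S with hz
  have h1 : ∀ v : RSp d, Complex.exp (-(b : ℂ) * (‖v‖ : ℂ) ^ 2 - ((inner ℝ S v : ℝ) : ℂ) +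
      Complex.I * ((inner ℝ W v : ℝ) : ℂ) + c) = Complex.exp (((‖S‖ ^ 2 / (4 * b) : ℝ) : ℂ) + c) *
        Complex.exp (-(b : ℂ) * (‖v - z‖ : ℂ) ^ 2 + Complex.I * ((inner ℝ W v : ℝ) : ℂ)) :=
      fun v => by
    rw [← Complex.exp_add]
    congr 1
    have h : b * ‖v - z‖ ^ 2 = b * ‖v‖ ^ 2 + inner ℝ S v + ‖S‖ ^ 2 / (4 * b) := by
      rw [norm_sub_sq_real, hz, inner_smul_right, norm_smul, mul_pow, Real.norm_eq_abs, sq_abs,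
        real_inner_comm]
      field_simp
      ring
    have h' := congrArg (fun r : ℝ => (r : ℂ)) h
    simp only [Complex.ofReal_add, Complex.ofReal_mul, Complex.ofReal_pow] at h'
    linear_combination h'
  simp_rw [h1]
  rw [integral_const_mul, integral_gaussian_character hb, norm_mul, norm_mul, Complex.norm_exp,
    Complex.norm_exp]
  have h2 : ((Real.pi / b : ℂ) ^ (d / 2 : ℂ)) = (((Real.pi / b) ^ ((d : ℝ) / 2) : ℝ) : ℂ) := by
    rw [Complex.ofReal_cpow (by positivity)]
    push_cast
    rfl
  have h3 : (Complex.I * ((inner ℝ W z : ℝ) : ℂ) - (‖W‖ : ℂ) ^ 2 / (4 * b)) =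
      ((-(‖W‖ ^ 2 / (4 * b)) : ℝ) : ℂ) + ((inner ℝ W z : ℝ) : ℂ) * Complex.I := by
    push_cast; ring
  rw [h2, Complex.norm_real, Real.norm_of_nonneg (by positivity), h3, Complex.add_re,
    Complex.ofReal_re, Complex.add_re, Complex.ofReal_re, Complex.re_ofReal_mul, Complex.I_re,
    mul_zero, add_zero, mul_left_comm, ← Real.exp_add]
  congr 2
  ring

/-- The matrix coefficient of a phase space shift multiplied by a Gaussian. -/
lemma exists_norm_shifted_coef_le {C : Matrix (Fin d) (Fin d) ℂ} (hC : C.IsSymm) {a l M : ℝ}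
    (ha : 0 < a) (hCa : ∀ v : RSp d, a * ‖v‖ ^ 2 ≤ (quad C (ofR v) (ofR v)).im) (hl : 0 < l)
    (hl' : (∑ i, ∑ j, ‖C i j‖) ^ 2 / a ≤ l) (hM : 0 < M) :
    ∃ c : ℝ, 0 < c ∧ ∀ ε : ℝ, 0 < ε → ε ≤ M → ∀ (Y : RSp d) (p q : RSp d × RSp d),
      ‖∫ y : RSp d, ((Real.exp (-(ε / 2) * ‖y + Y‖ ^ 2) : ℝ) : ℂ) * packet C q (y + Y) *
        packet (dualWindow C l) (p.1, -p.2) y‖ ≤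
      (Real.pi / l) ^ ((d : ℝ) / 2) *
        Real.exp (-c * (‖p.1 + Y - q.1‖ ^ 2 + ‖p.2 - q.2‖ ^ 2)) := by
  set κ := ∑ i, ∑ j, ‖C i j‖ with hκ
  have hκ0 : 0 ≤ κ := by positivity
  -- The first entry gives `η ≤ 1/(4b)` for all `ε ≤ M`. The second keeps the frequency perturbation
  -- `η|P|²` below `(a/8)|D|²`.
  set η := min (1 / (4 * (l + M / 2))) (a / (8 * (κ ^ 2 + 1))) with hη
  have hη0 : 0 < η := by positivity
  refine ⟨min (a / 8) (η / 2), by positivity, fun ε hε hεM Y ⟨t, ξ₁⟩ ⟨x₀, ξ₀⟩ => ?_⟩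
  set D := t + Y - x₀ with hD
  set s := t + Y with hs
  obtain ⟨P, R, hPn, hRn, hPR⟩ := exists_quad_eq_inner C D
  set b := l + ε / 2 with hb
  have hb0 : 0 < b := by positivity
  set S := R + ε • s with hS
  set W := (ξ₁ - ξ₀) + P with hW
  set c : ℂ := -((ε / 2 * ‖s‖ ^ 2 : ℝ) : ℂ) + Complex.I / 2 * quad C (ofR D) (ofR D) +
    Complex.I * ((inner ℝ ξ₁ t - inner ℝ ξ₀ s : ℝ) : ℂ) with hc
  have h1 : ∀ v : RSp d, ((Real.exp (-(ε / 2) * ‖v + t + Y‖ ^ 2) : ℝ) : ℂ) *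
      packet C (x₀, ξ₀) (v + t + Y) * packet (dualWindow C l) (t, -ξ₁) (v + t) =
      Complex.exp (-(b : ℂ) * (‖v‖ : ℂ) ^ 2 - ((inner ℝ S v : ℝ) : ℂ) +
        Complex.I * ((inner ℝ W v : ℝ) : ℂ) + c) := fun v => by
    rw [packet, packet, packetEnt, packetEnt, Complex.ofReal_exp, ← Complex.exp_add,
      ← Complex.exp_add]
    congr 1
    simp only [← ofR_sub]
    have e1 : v + t + Y - x₀ = v + D := by rw [hD, hs]; abel
    have e2 : v + t - t = v := by abel
    have e3 : v + t + Y = v + s := by rw [hs]; abel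
    rw [e1, e2, e3, dualWindow, quad_matrix_sub, quad_ofR_self_one, dotProduct_ofR,
      dotProduct_ofR, ofR_add v D, quad_add_left, quad_add_right, quad_add_right,
      quad_comm hC (ofR v) (ofR D), hPR v, hc, hS, hW, hb]
    simp only [norm_add_sq_real v s, inner_add_right, inner_add_left, inner_neg_left,
      inner_sub_left, real_inner_smul_left, real_inner_comm v s]
    push_cast
    linear_combination (((inner ℝ R v : ℝ) : ℂ) + (l : ℂ) * (‖v‖ : ℂ) ^ 2) * Complex.I_mul_I
  rw [← integral_add_right_eq_self _ t]
  simp_rw [h1]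
  rw [norm_cexp_quadratic_integral hb0]
  have hcre : c.re = -(ε / 2 * ‖s‖ ^ 2) - 1 / 2 * (quad C (ofR D) (ofR D)).im := by
    rw [hc]
    simp [-Complex.ofReal_mul, -Complex.ofReal_sub, Complex.div_ofNat_re, Complex.div_ofNat_im]
    ring
  -- The term `(ε/2)|s|²` cancels exactly against the one in `c.re`, so the final bound depends
  -- neither on `ε` nor on the distance of `s` from the origin.
  have hSn : ‖S‖ ^ 2 / (4 * b) ≤ ‖R‖ ^ 2 / (4 * l) + ε / 2 * ‖s‖ ^ 2 := by
    have h2 : ‖S‖ ≤ ‖R‖ + ε * ‖s‖ := (norm_add_le _ _).trans (by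
      rw [norm_smul, Real.norm_of_nonneg hε.le])
    have h3 : ‖S‖ ^ 2 ≤ (‖R‖ + ε * ‖s‖) ^ 2 := pow_le_pow_left₀ (norm_nonneg _) h2 2
    rw [div_le_iff₀ (by positivity)]
    refine h3.trans ?_
    have h4 : (‖R‖ ^ 2 / (4 * l) + ε / 2 * ‖s‖ ^ 2) * (4 * b) =
        (‖R‖ + ε * ‖s‖) ^ 2 + ε / (2 * l) * (‖R‖ - 2 * l * ‖s‖) ^ 2 := by
      rw [hb]; field_simp; ring
    rw [h4]
    have : 0 ≤ ε / (2 * l) * (‖R‖ - 2 * l * ‖s‖) ^ 2 := by positivity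
    linarith
  have hRl : ‖R‖ ^ 2 / (4 * l) ≤ a / 4 * ‖D‖ ^ 2 := by
    rw [div_le_iff₀ (by positivity)]
    have h2 : ‖R‖ ^ 2 ≤ (κ * ‖D‖) ^ 2 := pow_le_pow_left₀ (norm_nonneg _) hRn 2
    rw [div_le_iff₀ ha] at hl'
    nlinarith [sq_nonneg ‖D‖]
  have hWn : η * (1 / 2 * ‖ξ₁ - ξ₀‖ ^ 2 - ‖P‖ ^ 2) ≤ ‖W‖ ^ 2 / (4 * b) := by
    have h2 : ‖ξ₁ - ξ₀‖ ≤ ‖W‖ + ‖P‖ := by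
      have := norm_sub_le W P
      rwa [hW, add_sub_cancel_right] at this
    have h3 : 1 / 2 * ‖ξ₁ - ξ₀‖ ^ 2 - ‖P‖ ^ 2 ≤ ‖W‖ ^ 2 := by
      have := pow_le_pow_left₀ (norm_nonneg _) h2 2
      nlinarith [sq_nonneg (‖W‖ - ‖P‖)]
    calc _ ≤ η * ‖W‖ ^ 2 := by gcongr
      _ ≤ 1 / (4 * b) * ‖W‖ ^ 2 := by
        gcongr
        refine (min_le_left _ _).trans ?_
        gcongr
        linarith
      _ = _ := by ring
  have hPη : η * ‖P‖ ^ 2 ≤ a / 8 * ‖D‖ ^ 2 := by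
    have h2 : ‖P‖ ^ 2 ≤ (κ * ‖D‖) ^ 2 := pow_le_pow_left₀ (norm_nonneg _) hPn 2
    calc η * ‖P‖ ^ 2 ≤ a / (8 * (κ ^ 2 + 1)) * (κ * ‖D‖) ^ 2 := by
          gcongr; exact min_le_right _ _
      _ = a / 8 * ‖D‖ ^ 2 * (κ ^ 2 / (κ ^ 2 + 1)) := by field_simp
      _ ≤ a / 8 * ‖D‖ ^ 2 * 1 := by
        gcongr
        rw [div_le_one (by positivity)]
        linarith
      _ = _ := mul_one _
  have hDa := hCa D
  gcongr
  · linarith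
  · rw [hcre]
    have h5 : min (a / 8) (η / 2) * ‖D‖ ^ 2 ≤ a / 8 * ‖D‖ ^ 2 := by
      gcongr; exact min_le_left _ _
    have h6 : min (a / 8) (η / 2) * ‖ξ₁ - ξ₀‖ ^ 2 ≤ η / 2 * ‖ξ₁ - ξ₀‖ ^ 2 := by
      gcongr; exact min_le_right _ _
    change _ ≤ -min (a / 8) (η / 2) * (‖D‖ ^ 2 + ‖ξ₁ - ξ₀‖ ^ 2)
    nlinarith

/-- The density of the standard normal distribution. -/
def heatDensity (z : RSp d) : ℝ := heatConst d 1 * Real.exp (-(1⁻¹ / 2) * ‖z‖ ^ 2)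

lemma heatDensity_pos (z : RSp d) : 0 < heatDensity z :=
  mul_pos (heatConst_pos one_pos) (Real.exp_pos _)

lemma continuous_heatDensity : Continuous (heatDensity (d := d)) := by
  unfold heatDensity; fun_prop

lemma integrable_heatDensity : Integrable (heatDensity (d := d)) := by
  have := (integrable_exp_neg_sq (d := d) (a := 1⁻¹ / 2) (by norm_num) 0).const_mul (heatConst d 1)
  simp only [sub_zero] at this
  exact this

lemma integral_heatDensity : ∫ z : RSp d, heatDensity z = 1 := by
  unfold heatDensity
  rw [integral_const_mul, heatConst, inv_mul_cancel₀ (integral_exp_neg_sq_pos (by norm_num)).ne']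

/-- The transpose of the regularizing operator, written as an average over translations. -/
def smear (ε : ℝ) (g : RSp d → ℂ) (y : RSp d) : ℂ :=
  ∫ z : RSp d, (heatDensity z : ℂ) *
    (((Real.exp (-(ε / 2) * ‖y + √ε • z‖ ^ 2) : ℝ) : ℂ) * g (y + √ε • z))

lemma heatConst_eq {ε : ℝ} (hε : 0 < ε) : heatConst d ε = heatConst d 1 * (√ε ^ d)⁻¹ := by
  have h := Measure.integral_comp_smul (μ := (volume : Measure (RSp d)))
    (fun z => Real.exp (-(ε⁻¹ / 2) * ‖z‖ ^ 2)) (√ε)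
  have h0 : 0 < √ε := Real.sqrt_pos.2 hε
  have e : ∀ z : RSp d, Real.exp (-(ε⁻¹ / 2) * ‖√ε • z‖ ^ 2) =
      Real.exp (-(1⁻¹ / 2) * ‖z‖ ^ 2) := fun z => by
    rw [norm_smul, mul_pow, Real.norm_of_nonneg h0.le, Real.sq_sqrt hε.le]
    congr 1
    field_simp
  simp_rw [e] at h
  rw [heatConst, heatConst, h, finrank_euclideanSpace, Fintype.card_fin, smul_eq_mul,
    abs_of_pos (by positivity), mul_inv, inv_inv]
  field_simp

/-- The substitution `x = y + √ε z` moves the `ε`-dependence out of the heat kernel, giving a fixed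
probability density suited to dominated convergence as `ε → 0`. -/
lemma integral_heat_kernel {ε : ℝ} (hε : 0 < ε) (g : RSp d → ℂ) (y : RSp d) :
    ∫ x : RSp d, ((heatConst d ε * Real.exp (-(ε / 2) * ‖x‖ ^ 2) : ℝ) : ℂ) * g x *
      packet ((Complex.I * (ε⁻¹ : ℝ)) • (1 : Matrix (Fin d) (Fin d) ℂ)) (x, 0) y = smear ε g y := by
  have h0 : 0 < √ε := Real.sqrt_pos.2 hε
  set F : RSp d → ℂ := fun x => ((Real.exp (-(ε⁻¹ / 2) * ‖x - y‖ ^ 2) : ℝ) : ℂ) *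
    (((Real.exp (-(ε / 2) * ‖x‖ ^ 2) : ℝ) : ℂ) * g x) with hF
  have h := Measure.integral_comp_smul (μ := (volume : Measure (RSp d))) (fun z => F (y + z)) (√ε)
  rw [integral_add_left_eq_self, finrank_euclideanSpace, Fintype.card_fin,
    abs_of_pos (by positivity), Complex.real_smul] at h
  have h1 : ∀ x, ((heatConst d ε * Real.exp (-(ε / 2) * ‖x‖ ^ 2) : ℝ) : ℂ) * g x *
      packet ((Complex.I * (ε⁻¹ : ℝ)) • (1 : Matrix (Fin d) (Fin d) ℂ)) (x, 0) y =
        (heatConst d ε : ℂ) * F x := fun x => by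
    rw [packet_smul_one, inner_zero_left, norm_sub_rev, hF]
    simp only
    rw [Complex.ofReal_mul, Complex.ofReal_exp (-(ε⁻¹ / 2) * ‖x - y‖ ^ 2)]
    push_cast
    rw [mul_zero, zero_sub]
    ring_nf
  simp_rw [h1]
  rw [integral_const_mul, heatConst_eq hε, Complex.ofReal_mul, mul_assoc, ← h, smear,
    ← integral_const_mul]
  congr 1
  funext z
  have e : Real.exp (-(ε⁻¹ / 2) * ‖√ε • z‖ ^ 2) = Real.exp (-(1⁻¹ / 2) * ‖z‖ ^ 2) := by
    rw [norm_smul, mul_pow, Real.norm_of_nonneg h0.le, Real.sq_sqrt hε.le]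
    congr 1
    field_simp
  simp only [hF, add_sub_cancel_left, e, heatDensity, Complex.ofReal_mul]
  ring

lemma norm_exp_mul_packet_le_one {C : Matrix (Fin d) (Fin d) ℂ} (hC : IsWindow C) {ε : ℝ}
    (hε : 0 ≤ ε) (q : RSp d × RSp d) (y : RSp d) :
    ‖((Real.exp (-(ε / 2) * ‖y‖ ^ 2) : ℝ) : ℂ) * packet C q y‖ ≤ 1 := by
  rw [norm_mul, Complex.norm_real, Real.norm_of_nonneg (Real.exp_pos _).le]
  refine mul_le_one₀ (Real.exp_le_one_iff.2 ?_) (norm_nonneg _) (norm_packet_le_one hC q y)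
  have : 0 ≤ ε / 2 * ‖y‖ ^ 2 := by positivity
  linarith

lemma norm_smear_packet_le_one {C : Matrix (Fin d) (Fin d) ℂ} (hC : IsWindow C) {ε : ℝ}
    (hε : 0 ≤ ε) (q : RSp d × RSp d) (y : RSp d) : ‖smear ε (packet C q) y‖ ≤ 1 := by
  rw [← integral_heatDensity (d := d)]
  refine norm_integral_le_of_norm_le integrable_heatDensity (Eventually.of_forall fun z => ?_)
  rw [norm_mul, Complex.norm_real, Real.norm_of_nonneg (heatDensity_pos z).le]
  exact mul_le_of_le_one_right (heatDensity_pos z).le (norm_exp_mul_packet_le_one hC hε q _)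

lemma continuous_packet_apply (C : Matrix (Fin d) (Fin d) ℂ) (q : RSp d × RSp d) :
    Continuous (packet C q) := (contDiff_packet C q).continuous

lemma tendsto_smear_packet {C : Matrix (Fin d) (Fin d) ℂ} (hC : IsWindow C) {e : ℕ → ℝ}
    (he : ∀ n, 0 < e n) (he0 : Tendsto e atTop (𝓝 0)) (q : RSp d × RSp d) (y : RSp d) :
    Tendsto (fun n => smear (e n) (packet C q) y) atTop (𝓝 (packet C q y)) := by
  have hp := continuous_packet_apply C q
  have h1 : packet C q y = ∫ z : RSp d, (heatDensity z : ℂ) * packet C q y := by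
    rw [integral_mul_const, integral_complex_ofReal, integral_heatDensity, Complex.ofReal_one,
      one_mul]
  rw [h1]
  refine tendsto_integral_of_dominated_convergence (heatDensity (d := d)) (fun n => ?_)
    integrable_heatDensity (fun n => Eventually.of_forall fun z => ?_)
    (Eventually.of_forall fun z => ?_)
  · have := continuous_heatDensity (d := d)
    exact Continuous.aestronglyMeasurable (by fun_prop)
  · rw [norm_mul, Complex.norm_real, Real.norm_of_nonneg (heatDensity_pos z).le]
    exact mul_le_of_le_one_right (heatDensity_pos z).le (norm_exp_mul_packet_le_one hC (he n).le q _)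
  · have h2 : Continuous fun ε : ℝ => (heatDensity z : ℂ) *
        (((Real.exp (-(ε / 2) * ‖y + √ε • z‖ ^ 2) : ℝ) : ℂ) * packet C q (y + √ε • z)) := by
      fun_prop
    have h3 := (h2.tendsto 0).comp he0
    simpa [Function.comp_def] using h3

lemma integrable_packet {C : Matrix (Fin d) (Fin d) ℂ} (hC : IsWindow C) (p : RSp d × RSp d) :
    Integrable (packet C p) := by
  obtain ⟨-, a, ha, h⟩ := hC
  exact (integrable_exp_neg_sq (by positivity : 0 < a / 2) p.1).mono'
    (continuous_packet_apply C p).aestronglyMeasurable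
    (Eventually.of_forall fun y => norm_packet_le h p y)

lemma continuous_smear_packet {C : Matrix (Fin d) (Fin d) ℂ} (hC : IsWindow C) {ε : ℝ}
    (hε : 0 < ε) (q : RSp d × RSp d) : Continuous (smear ε (packet C q)) := by
  have hp := continuous_packet_apply C q
  have hh := continuous_heatDensity (d := d)
  refine continuous_of_dominated (bound := heatDensity (d := d)) (fun y => ?_)
    (fun y => Eventually.of_forall fun z => ?_) integrable_heatDensity
    (Eventually.of_forall fun z => ?_)
  · exact Continuous.aestronglyMeasurable (by fun_prop)
  · rw [norm_mul, Complex.norm_real, Real.norm_of_nonneg (heatDensity_pos z).le]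
    exact mul_le_of_le_one_right (heatDensity_pos z).le (norm_exp_mul_packet_le_one hC hε.le q _)
  · fun_prop

lemma tendsto_coef_smear_packet {C : Matrix (Fin d) (Fin d) ℂ} (hC : IsWindow C) {l : ℝ}
    (hC' : IsWindow (dualWindow C l)) {e : ℕ → ℝ} (he : ∀ n, 0 < e n)
    (he0 : Tendsto e atTop (𝓝 0)) (p q : RSp d × RSp d) :
    Tendsto (fun n => coef C l (smear (e n) (packet C q)) p) atTop
      (𝓝 (coef C l (packet C q) p)) := by
  refine tendsto_integral_of_dominated_convergence
    (fun y => ‖packet (dualWindow C l) (p.1, -p.2) y‖) (fun n => ?_)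
    (integrable_packet hC' _).norm (fun n => Eventually.of_forall fun y => ?_)
    (Eventually.of_forall fun y => ?_)
  · exact ((continuous_smear_packet hC (he n) q).mul
      (continuous_packet_apply _ _)).aestronglyMeasurable
  · rw [norm_mul]
    exact mul_le_of_le_one_left (norm_nonneg _) (norm_smear_packet_le_one hC (he n).le q y)
  · exact (tendsto_smear_packet hC he he0 q y).mul_const _

lemma coef_smear_packet_eq {C : Matrix (Fin d) (Fin d) ℂ} (hC : IsWindow C) {l : ℝ}
    (hC' : IsWindow (dualWindow C l)) {ε : ℝ} (hε : 0 < ε) (p q : RSp d × RSp d) :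
    coef C l (smear ε (packet C q)) p = ∫ z : RSp d, (heatDensity z : ℂ) *
      ∫ y : RSp d, ((Real.exp (-(ε / 2) * ‖y + √ε • z‖ ^ 2) : ℝ) : ℂ) *
        packet C q (y + √ε • z) * packet (dualWindow C l) (p.1, -p.2) y := by
  have hp := continuous_packet_apply C q
  have hp' := continuous_packet_apply (dualWindow C l) (p.1, -p.2)
  have hh := continuous_heatDensity (d := d)
  simp_rw [coef, smear, ← integral_mul_const, ← integral_const_mul]
  rw [integral_integral_swap]
  · simp only [mul_assoc]
  · refine ((integrable_packet hC' (p.1, -p.2)).norm.mul_prod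
      (integrable_heatDensity (d := d))).mono' ?_ (Eventually.of_forall fun w => ?_)
    · refine Continuous.aestronglyMeasurable ?_
      unfold Function.uncurry
      fun_prop
    · simp only [Function.uncurry]
      rw [norm_mul, norm_mul, Complex.norm_real, Real.norm_of_nonneg (heatDensity_pos w.2).le,
        mul_comm]
      gcongr
      exact mul_le_of_le_one_right (heatDensity_pos w.2).le
        (norm_exp_mul_packet_le_one hC hε.le q _)

/-- By Fubini the coefficient is an average of coefficients of shifted packets, each Gaussian in the
shifted phase space distance uniformly in `ε`. The shift `√ε z` is then paid for by part of the
density in `z`. -/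
theorem exists_norm_coef_smear_le {C : Matrix (Fin d) (Fin d) ℂ} (hC : IsWindow C) :
    ∃ l₀ : ℝ, 0 < l₀ ∧ ∀ l : ℝ, l₀ ≤ l → IsWindow (dualWindow C l) ∧ ∀ M : ℝ, 0 < M →
      ∃ K : ℝ, 0 < K ∧ ∃ c : ℝ, 0 < c ∧ ∀ ε : ℝ, 0 < ε → ε ≤ M → ∀ p q : RSp d × RSp d,
        ‖coef C l (smear ε (packet C q)) p‖ ≤ K * Real.exp (-c * ‖p - q‖ ^ 2) := by
  obtain ⟨hCs, a, ha, hCa⟩ := id hC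
  set κ := ∑ i, ∑ j, ‖C i j‖ with hκ
  have hκ0 : 0 ≤ κ := by positivity
  -- `κ` makes the dual matrix a window and `κ²/a` meets the requirement of the shifted estimate.
  refine ⟨κ + κ ^ 2 / a + 1, by positivity, fun l hl => ?_⟩
  have hκa : 0 ≤ κ ^ 2 / a := by positivity
  have hl0 : 0 < l := by linarith
  have hC' := isWindow_dualWindow hCs hl0 (by rw [← hκ]; linarith)
  refine ⟨hC', fun M hM => ?_⟩
  obtain ⟨c, hc, hbd⟩ := exists_norm_shifted_coef_le hCs ha hCa hl0
    (by rw [← hκ]; linarith) hM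
  -- With `c'ε ≤ 1/4` the shift costs at most `|z|²/4`, half of the exponent of the density.
  set c' := min c (1 / (4 * M)) with hc'
  have hc'0 : 0 < c' := by positivity
  have hcM : c' * M ≤ 1 / 4 := by
    calc c' * M ≤ 1 / (4 * M) * M := by gcongr; exact min_le_right _ _
      _ = 1 / 4 := by field_simp
  set N := (Real.pi / l) ^ ((d : ℝ) / 2) with hN
  have hN0 : 0 < N := by positivity
  set G := ∫ z : RSp d, heatConst d 1 * Real.exp (-(1 / 4) * ‖z‖ ^ 2) with hG
  have hGi : Integrable fun z : RSp d => heatConst d 1 * Real.exp (-(1 / 4) * ‖z‖ ^ 2) := by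
    have := (integrable_exp_neg_sq (d := d) (a := 1 / 4) (by norm_num) 0).const_mul (heatConst d 1)
    simpa only [sub_zero] using this
  have hG0 : 0 < G := by
    rw [hG, integral_const_mul]
    exact mul_pos (heatConst_pos one_pos) (integral_exp_neg_sq_pos (by norm_num))
  refine ⟨N * G, by positivity, c' / 2, by positivity, fun ε hε hεM p q => ?_⟩
  rw [coef_smear_packet_eq hC hC' hε]
  have h1 : N * G * Real.exp (-(c' / 2) * ‖p - q‖ ^ 2) =
      ∫ z : RSp d, N * Real.exp (-(c' / 2) * ‖p - q‖ ^ 2) *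
        (heatConst d 1 * Real.exp (-(1 / 4) * ‖z‖ ^ 2)) := by
    rw [integral_const_mul, ← hG]; ring
  rw [h1]
  refine norm_integral_le_of_norm_le (hGi.const_mul _) (Eventually.of_forall fun z => ?_)
  rw [norm_mul, Complex.norm_real, Real.norm_of_nonneg (heatDensity_pos z).le]
  refine (mul_le_mul_of_nonneg_left (hbd ε hε hεM (√ε • z) p q) (heatDensity_pos z).le).trans ?_
  have hexp : Real.exp (-(1⁻¹ / 2) * ‖z‖ ^ 2) *
      Real.exp (-c * (‖p.1 + √ε • z - q.1‖ ^ 2 + ‖p.2 - q.2‖ ^ 2)) ≤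
      Real.exp (-(c' / 2) * ‖p - q‖ ^ 2) * Real.exp (-(1 / 4) * ‖z‖ ^ 2) := by
    rw [← Real.exp_add, ← Real.exp_add]
    refine Real.exp_le_exp.2 ?_
    have h2 := norm_sq_prod_le (p - q)
    rw [Prod.fst_sub, Prod.snd_sub] at h2
    set D := p.1 + √ε • z - q.1 with hD
    have h3 : ‖p.1 - q.1‖ ≤ ‖D‖ + √ε * ‖z‖ := by
      have := norm_sub_le D (√ε • z)
      rw [norm_smul, Real.norm_of_nonneg (Real.sqrt_nonneg _)] at this
      rwa [hD, show p.1 + √ε • z - q.1 - √ε • z = p.1 - q.1 by abel] at this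
    have h4 : ‖p.1 - q.1‖ ^ 2 ≤ 2 * ‖D‖ ^ 2 + 2 * (ε * ‖z‖ ^ 2) := by
      have h5 := pow_le_pow_left₀ (norm_nonneg _) h3 2
      have h6 : (√ε * ‖z‖) ^ 2 = ε * ‖z‖ ^ 2 := by rw [mul_pow, Real.sq_sqrt hε.le]
      nlinarith [sq_nonneg (‖D‖ - √ε * ‖z‖)]
    have h7 : c' * (‖D‖ ^ 2 + ‖p.2 - q.2‖ ^ 2) ≤ c * (‖D‖ ^ 2 + ‖p.2 - q.2‖ ^ 2) := by
      gcongr; exact min_le_left _ _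
    have h8 : c' * (ε * ‖z‖ ^ 2) ≤ 1 / 4 * ‖z‖ ^ 2 := by
      rw [← mul_assoc]
      gcongr
      exact (mul_le_mul_of_nonneg_left hεM hc'0.le).trans hcM
    have h9 := mul_le_mul_of_nonneg_left h4 hc'0.le
    have h10 := mul_le_mul_of_nonneg_left h2 hc'0.le
    have h11 : 0 ≤ c' * ‖p.2 - q.2‖ ^ 2 := by positivity
    norm_num
    linarith
  calc heatDensity z * (N * Real.exp (-c * (‖p.1 + √ε • z - q.1‖ ^ 2 + ‖p.2 - q.2‖ ^ 2)))
      = heatConst d 1 * N * (Real.exp (-(1⁻¹ / 2) * ‖z‖ ^ 2) *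
        Real.exp (-c * (‖p.1 + √ε • z - q.1‖ ^ 2 + ‖p.2 - q.2‖ ^ 2))) := by
        rw [heatDensity]; ring
    _ ≤ heatConst d 1 * N * (Real.exp (-(c' / 2) * ‖p - q‖ ^ 2) *
        Real.exp (-(1 / 4) * ‖z‖ ^ 2)) := by
        have := (heatConst_pos (d := d) one_pos).le
        gcongr
    _ = _ := by ring

/-- The regularizing operator in terms of wave packets. -/
theorem integral_pdo_mul_packet {θ : ℝ} (hθ : 1 / 2 ≤ θ) (hθ' : θ < 1)
    {C : Matrix (Fin d) (Fin d) ℂ} (hC : IsWindow C) {l : ℝ} (hl : 0 < l)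
    (hC' : IsWindow (dualWindow C l)) {ε : ℝ} (hε : 0 < ε) (u : Ultra d θ) (q : RSp d × RSp d) :
    ∫ x, pdo (gaussSymbol ε) u x * packet C q x = reprConst d l *
      ∫ p, coef C l (smear ε (packet C q)) p * (u : GS d θ →ₗ[ℂ] ℂ) (pkt hθ hθ' hC p) := by
  obtain ⟨hσ, hσ'⟩ := one_le_one_div hθ hθ'
  have hC₁ : IsWindow ((Complex.I * (ε⁻¹ : ℝ)) • (1 : Matrix (Fin d) (Fin d) ℂ)) :=
    isWindow_smul_one (inv_pos.2 hε)
  have hp := continuous_packet_apply C q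
  have hκ := heatConst_pos (d := d) hε
  obtain ⟨h, hu⟩ := exists_integral_packet (d := d) hθ hθ' (δ := ε / 4) (by positivity) hC₁
    (μ := volume) (a := fun x : RSp d =>
      ((heatConst d ε * Real.exp (-(ε / 2) * ‖x‖ ^ 2) : ℝ) : ℂ) * packet C q x)
    (π := fun x => (x, 0)) (Continuous.aestronglyMeasurable (by fun_prop))
    (by fun_prop) (by
      refine ((integrable_exp_neg_sq (by positivity : 0 < ε / 4) 0).const_mul
        (heatConst d ε * Real.exp (ε / 4))).mono' ?_ (Eventually.of_forall fun x => ?_)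
      · have h1 : Continuous fun x : RSp d => ‖((x, 0) : RSp d × RSp d)‖ ^ (1 / θ) :=
          (by fun_prop : Continuous fun x : RSp d => ‖((x, 0) : RSp d × RSp d)‖).rpow_const
            fun _ => Or.inr (by linarith)
        exact Continuous.aestronglyMeasurable (by fun_prop)
      · have hn : ‖((x, 0) : RSp d × RSp d)‖ = ‖x‖ := by simp [Prod.norm_def]
        rw [Real.norm_of_nonneg (by positivity), norm_mul, Complex.norm_real,
          Real.norm_of_nonneg (by positivity), hn, sub_zero]
        have h2 := rpow_le_one_add_sq hσ hσ' (norm_nonneg x)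
        calc _ ≤ heatConst d ε * Real.exp (-(ε / 2) * ‖x‖ ^ 2) * 1 *
              Real.exp (ε / 4 * (1 + ‖x‖ ^ 2)) := by
              gcongr
              exact norm_packet_le_one hC q x
          _ = heatConst d ε * (Real.exp (-(ε / 2) * ‖x‖ ^ 2) *
              Real.exp (ε / 4 * (1 + ‖x‖ ^ 2))) := by ring
          _ = heatConst d ε * (Real.exp (ε / 4) * Real.exp (-(ε / 4) * ‖x‖ ^ 2)) := by
              rw [← Real.exp_add, ← Real.exp_add]; congr 2; ring
          _ = _ := by ring)
  have h1 : ∫ x, pdo (gaussSymbol ε) u x * packet C q x = (u : GS d θ →ₗ[ℂ] ℂ) ⟨_, h⟩ := by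
    rw [hu u]
    congr 1
    funext x
    rw [pdo_eq hθ hθ' hε]
    ring
  -- The superposition of heat packets to which `u` is applied equals `smear ε (packet C q)`; it is
  -- now re-expanded in packets of the window `C`.
  rw [h1, apply_eq_integral_coef hθ hθ' _ hC hl hC']
  congr 2
  funext p
  congr 2
  funext y
  exact integral_heat_kernel hε (packet C q) y

/-! ### Uniform estimates and convergence of the regularizations -/

lemma integrable_exp_neg_sq_prod {c : ℝ} (hc : 0 < c) (q : RSp d × RSp d) :
    Integrable fun p : RSp d × RSp d => Real.exp (-c * ‖p - q‖ ^ 2) := by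
  have h := (integrable_exp_neg_rpow (E := RSp d × RSp d) (μ := volume)
    (by norm_num : (1 : ℝ) ≤ 2) hc).comp_sub_right q
  simpa only [Real.rpow_two] using h

lemma integral_exp_neg_sq_prod (c : ℝ) (q : RSp d × RSp d) :
    ∫ p : RSp d × RSp d, Real.exp (-c * ‖p - q‖ ^ 2) =
      ∫ p : RSp d × RSp d, Real.exp (-c * ‖p‖ ^ 2) :=
  integral_sub_right_eq_self (fun p : RSp d × RSp d => Real.exp (-c * ‖p‖ ^ 2)) q

lemma norm_rpow_le_of_sub {E : Type*} [NormedAddCommGroup E] {σ : ℝ} (hσ : 1 ≤ σ) (hσ' : σ ≤ 2)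
    (p q : E) : ‖p‖ ^ σ ≤ 4 * ‖q‖ ^ σ + 4 + 4 * ‖p - q‖ ^ 2 := by
  refine le_trans ?_ (add_rpow_le_sq hσ hσ' (norm_nonneg q) (norm_nonneg (p - q)))
  refine Real.rpow_le_rpow (norm_nonneg _) ?_ (by linarith)
  have := norm_add_le q (p - q)
  rwa [add_sub_cancel] at this

lemma norm_mul_integral_le {a b : RSp d × RSp d → ℂ} {κ : ℂ} {N c : ℝ} (hc : 0 < c)
    (q : RSp d × RSp d) (h : ∀ p, ‖a p‖ * ‖b p‖ ≤ N * Real.exp (-c * ‖p - q‖ ^ 2)) :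
    ‖κ * ∫ p, a p * b p‖ ≤ ‖κ‖ * (∫ p : RSp d × RSp d, Real.exp (-c * ‖p‖ ^ 2)) * N := by
  rw [norm_mul, mul_assoc]
  gcongr
  rw [← integral_exp_neg_sq_prod c q, mul_comm, ← integral_const_mul]
  exact norm_integral_le_of_norm_le ((integrable_exp_neg_sq_prod hc q).const_mul N)
    (Eventually.of_forall fun p => by rw [norm_mul]; exact h p)

/-- Growth at `p` is transferred to `q` at the cost `4δ|p-q|²`, at most half of the Gaussian rate
because `8δ ≤ c`. -/
lemma exp_decay_mul_growth_le {σ c δ A B : ℝ} (hσ : 1 ≤ σ) (hσ' : σ ≤ 2) (hδ : 0 ≤ δ)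
    (hδc : 8 * δ ≤ c) (hA : 0 ≤ A) (hB : 0 ≤ B) (p q : RSp d × RSp d) :
    A * Real.exp (-c * ‖p - q‖ ^ 2) * (B * Real.exp (δ * ‖p‖ ^ σ)) ≤
      A * B * Real.exp (4 * δ) * Real.exp (4 * δ * ‖q‖ ^ σ) *
        Real.exp (-(c / 2) * ‖p - q‖ ^ 2) := by
  have h := norm_rpow_le_of_sub hσ hσ' p q
  calc _ = A * B * (Real.exp (-c * ‖p - q‖ ^ 2) * Real.exp (δ * ‖p‖ ^ σ)) := by ring
    _ ≤ A * B * (Real.exp (4 * δ) * Real.exp (4 * δ * ‖q‖ ^ σ) *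
        Real.exp (-(c / 2) * ‖p - q‖ ^ 2)) := by
      refine mul_le_mul_of_nonneg_left ?_ (by positivity)
      rw [← Real.exp_add, ← Real.exp_add, ← Real.exp_add]
      refine Real.exp_le_exp.2 ?_
      have h1 := mul_le_mul_of_nonneg_left h hδ
      nlinarith [sq_nonneg ‖p - q‖]
    _ = _ := by ring

theorem tendsto_integral_pdo_mul_packet {θ : ℝ} (hθ : 1 / 2 ≤ θ) (hθ' : θ < 1)
    {C : Matrix (Fin d) (Fin d) ℂ} (hC : IsWindow C) (u : Ultra d θ) {e : ℕ → ℝ}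
    (he : ∀ n, 0 < e n) {M : ℝ} (heM : ∀ n, e n ≤ M) (he0 : Tendsto e atTop (𝓝 0))
    (q : RSp d × RSp d) :
    Tendsto (fun n => ∫ x, pdo (gaussSymbol (e n)) u x * packet C q x) atTop
      (𝓝 ((u : GS d θ →ₗ[ℂ] ℂ) (pkt hθ hθ' hC q))) := by
  obtain ⟨hσ, hσ'⟩ := one_le_one_div hθ hθ'
  obtain ⟨l, hl, hbd⟩ := exists_norm_coef_smear_le hC
  obtain ⟨hC', hbd⟩ := hbd l le_rfl
  obtain ⟨K, hK, c, hc, hbd⟩ := hbd M ((he 0).trans_le (heM 0))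
  obtain ⟨K', hK', hu⟩ := norm_apply_pkt_le hθ hθ' (δ := c / 8) (by positivity) hC u
  have hcu := continuous_apply_pkt hθ hθ' hC u
  rw [apply_eq_integral_coef hθ hθ' (pkt hθ hθ' hC q) hC hl hC']
  simp_rw [fun n => integral_pdo_mul_packet hθ hθ' hC hl hC' (he n) u q]
  refine Tendsto.const_mul _ (tendsto_integral_of_dominated_convergence
    (fun p => K * K' * Real.exp (4 * (c / 8)) * Real.exp (4 * (c / 8) * ‖q‖ ^ (1 / θ)) *
      Real.exp (-(c / 2) * ‖p - q‖ ^ 2)) (fun n => ?_)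
    ((integrable_exp_neg_sq_prod (by positivity) q).const_mul _)
    (fun n => Eventually.of_forall fun p => ?_) (Eventually.of_forall fun p => ?_))
  · exact (stronglyMeasurable_coef C l (continuous_smear_packet hC (he n) q)).aestronglyMeasurable.mul
      hcu.aestronglyMeasurable
  · rw [norm_mul]
    refine le_trans ?_ (exp_decay_mul_growth_le hσ hσ' (by positivity) (by linarith) hK.le hK'.le p q)
    exact mul_le_mul (hbd _ (he n) (heM n) p q) (hu p) (norm_nonneg _) (by positivity)
  · exact (tendsto_coef_smear_packet hC hC' he he0 p q).mul_const _

theorem norm_integral_pdo_mul_packet_le {θ δ : ℝ} (hθ : 1 / 2 ≤ θ) (hθ' : θ < 1) (hδ : 0 < δ)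
    {C : Matrix (Fin d) (Fin d) ℂ} (hC : IsWindow C) (u : Ultra d θ) {M : ℝ} (hM : 0 < M) :
    ∃ K : ℝ, 0 ≤ K ∧ ∀ ε : ℝ, 0 < ε → ε ≤ M → ∀ q : RSp d × RSp d,
      ‖∫ x, pdo (gaussSymbol ε) u x * packet C q x‖ ≤ K * Real.exp (δ * ‖q‖ ^ (1 / θ)) := by
  obtain ⟨hσ, hσ'⟩ := one_le_one_div hθ hθ'
  obtain ⟨l, hl, hbd⟩ := exists_norm_coef_smear_le hC
  obtain ⟨hC', hbd⟩ := hbd l le_rfl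
  obtain ⟨K, hK, c, hc, hbd⟩ := hbd M hM
  set η := min (δ / 4) (c / 8) with hη
  have hη0 : 0 < η := by positivity
  have hηδ : 4 * η ≤ δ := by have := min_le_left (δ / 4) (c / 8); linarith
  have hηc : 8 * η ≤ c := by have := min_le_right (δ / 4) (c / 8); linarith
  obtain ⟨K', hK', hu⟩ := norm_apply_pkt_le hθ hθ' hη0 hC u
  set G := ∫ p : RSp d × RSp d, Real.exp (-(c / 2) * ‖p‖ ^ 2) with hG
  have hG0 : 0 ≤ G := integral_nonneg fun _ => (Real.exp_pos _).le
  refine ⟨‖reprConst d l‖ * G * (K * K' * Real.exp (4 * η)), by positivity,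
    fun ε hε hεM q => ?_⟩
  rw [integral_pdo_mul_packet hθ hθ' hC hl hC' hε]
  refine (norm_mul_integral_le (c := c / 2)
    (N := K * K' * Real.exp (4 * η) * Real.exp (4 * η * ‖q‖ ^ (1 / θ))) (by positivity) q
    fun p => ?_).trans ?_
  · refine le_trans ?_ (exp_decay_mul_growth_le hσ hσ' hη0.le hηc hK.le hK'.le p q)
    exact mul_le_mul (hbd _ hε hεM p q) (hu p) (norm_nonneg _) (by positivity)
  · rw [← hG, ← mul_assoc]
    gcongr

/-- The open cone generated by the ball of radius `r` around `p`. -/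
def coneBall (p : RSp d × RSp d) (r : ℝ) : Set (RSp d × RSp d) :=
  {q | ∃ t : ℝ, 0 < t ∧ ‖t • q - p‖ < r}

/-- Near the diagonal, `|p-q| < r|q|`, the point `p` lies in the larger cone and the decay of `u` is
transported to `q`. Far from it, the Gaussian kernel gains `e^{-c r²|q|²}`-type decay, which beats
the growth of `u`. -/
theorem norm_integral_pdo_mul_packet_le_of_cone {θ : ℝ} (hθ : 1 / 2 ≤ θ) (hθ' : θ < 1)
    {C : Matrix (Fin d) (Fin d) ℂ} (hC : IsWindow C) (u : Ultra d θ) {M : ℝ} (hM : 0 < M)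
    {p₀ : RSp d × RSp d} {ρ K₀ ε₀ : ℝ} (hρ : 0 < ρ) (hK₀ : 0 ≤ K₀) (hε₀ : 0 < ε₀)
    (hu₀ : ∀ p ∈ coneBall p₀ (2 * ρ),
      ‖(u : GS d θ →ₗ[ℂ] ℂ) (pkt hθ hθ' hC p)‖ ≤ K₀ * Real.exp (-ε₀ * ‖p‖ ^ (1 / θ))) :
    ∃ K : ℝ, 0 ≤ K ∧ ∃ η : ℝ, 0 < η ∧ ∀ ε : ℝ, 0 < ε → ε ≤ M → ∀ q ∈ coneBall p₀ ρ,
      ‖∫ x, pdo (gaussSymbol ε) u x * packet C q x‖ ≤ K * Real.exp (-η * ‖q‖ ^ (1 / θ)) := by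
  obtain ⟨hσ, hσ'⟩ := one_le_one_div hθ hθ'
  obtain ⟨l, hl, hbd⟩ := exists_norm_coef_smear_le hC
  obtain ⟨hC', hbd⟩ := hbd l le_rfl
  obtain ⟨K, hK, c, hc, hbd⟩ := hbd M hM
  -- If `‖tq - p₀‖ < ρ` then `‖tq‖ ≤ ‖p₀‖ + ρ`, so `‖p-q‖ < r‖q‖` moves `tq` by at most `ρ` and puts
  -- `p` in the cone of radius `2ρ`.
  set r := ρ / (‖p₀‖ + ρ) with hr
  have hr0 : 0 < r := by positivity
  have hr1 : r ≤ 1 := by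
    rw [hr, div_le_one (by positivity)]
    linarith [norm_nonneg p₀]
  have hr2 : r ^ 2 ≤ 1 := pow_le_one₀ hr0.le hr1
  set δ := c * r ^ 2 / 32 with hδ
  have hδ0 : 0 < δ := by positivity
  obtain ⟨K', hK', hu⟩ := norm_apply_pkt_le hθ hθ' hδ0 hC u
  set ε₁ := min ε₀ (c / 2) with hε₁
  have hε₁0 : 0 < ε₁ := by positivity
  have hε₁c : ε₁ ≤ c / 2 := min_le_right _ _
  set η := min (ε₁ / 4) (c * r ^ 2 / 8) with hη
  have hη0 : 0 < η := by positivity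
  set G := ∫ p : RSp d × RSp d, Real.exp (-(c / 2) * ‖p‖ ^ 2) with hG
  have hG0 : 0 ≤ G := integral_nonneg fun _ => (Real.exp_pos _).le
  refine ⟨‖reprConst d l‖ * G * (K * (K₀ + K') * Real.exp c), by positivity, η, hη0,
    fun ε hε hεM q hq => ?_⟩
  rw [integral_pdo_mul_packet hθ hθ' hC hl hC' hε]
  refine (norm_mul_integral_le (c := c / 2)
    (N := K * (K₀ + K') * Real.exp c * Real.exp (-η * ‖q‖ ^ (1 / θ))) (by positivity) q
    fun p => ?_).trans (by rw [← hG, ← mul_assoc])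
  have hq0 : 0 ≤ ‖q‖ ^ (1 / θ) := by positivity
  -- Here `hUL` is the exponent `s` itself, negative decay or slow growth according to the case, and
  -- `hexp` holds both inequalities.
  obtain ⟨L, hL0, hL, hUL, hexp⟩ : ∃ L : ℝ, 0 ≤ L ∧ L ≤ K₀ + K' ∧ ∃ s : ℝ,
      ‖(u : GS d θ →ₗ[ℂ] ℂ) (pkt hθ hθ' hC p)‖ ≤ L * Real.exp s ∧
      -c * ‖p - q‖ ^ 2 + s ≤ c + -η * ‖q‖ ^ (1 / θ) + -(c / 2) * ‖p - q‖ ^ 2 := by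
    by_cases hpq : ‖p - q‖ < r * ‖q‖
    · refine ⟨K₀, hK₀, by linarith, -ε₁ * ‖p‖ ^ (1 / θ), ?_, ?_⟩
      · obtain ⟨t, ht, htq⟩ := hq
        refine (hu₀ p ⟨t, ht, ?_⟩).trans ?_
        · have h1 : ‖t • q‖ ≤ ‖p₀‖ + ρ := by
            have := norm_add_le (t • q - p₀) p₀
            rw [sub_add_cancel] at this
            linarith
          have h2 : ‖t • (p - q)‖ ≤ r * ‖t • q‖ := by
            rw [norm_smul, norm_smul, mul_left_comm]
            gcongr
          calc ‖t • p - p₀‖ = ‖t • (p - q) + (t • q - p₀)‖ := by congr 1; module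
            _ ≤ ‖t • (p - q)‖ + ‖t • q - p₀‖ := norm_add_le _ _
            _ < r * (‖p₀‖ + ρ) + ρ := by
                have : r * ‖t • q‖ ≤ r * (‖p₀‖ + ρ) := by gcongr
                linarith
            _ = 2 * ρ := by rw [hr]; field_simp; ring
        · gcongr
          exact min_le_left _ _
      · have h1 := norm_rpow_le_of_sub hσ hσ' q p
        rw [norm_sub_rev q p] at h1
        have h2 : η ≤ ε₁ / 4 := min_le_left _ _
        have h3 := mul_le_mul_of_nonneg_right h2 hq0
        have h4 := mul_le_mul_of_nonneg_left h1 hε₁0.le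
        nlinarith [sq_nonneg ‖p - q‖]
    · refine ⟨K', hK'.le, by linarith, δ * ‖p‖ ^ (1 / θ), hu p, ?_⟩
      rw [not_lt] at hpq
      have h1 := norm_rpow_le_of_sub hσ hσ' p q
      have h2 : r ^ 2 * ‖q‖ ^ 2 ≤ ‖p - q‖ ^ 2 := by
        rw [← mul_pow]
        exact pow_le_pow_left₀ (by positivity) hpq 2
      have h3 := rpow_le_one_add_sq hσ hσ' (norm_nonneg q)
      have h4 : η ≤ c * r ^ 2 / 8 := min_le_right _ _
      have h5 := mul_le_mul_of_nonneg_right h4 hq0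
      have h6 := mul_le_mul_of_nonneg_left h1 hδ0.le
      have h7 : r ^ 2 * ‖q‖ ^ (1 / θ) ≤ r ^ 2 + ‖p - q‖ ^ 2 := by
        have := mul_le_mul_of_nonneg_left h3 (sq_nonneg r)
        linarith
      have h8 := mul_le_mul_of_nonneg_left h7 hc.le
      have h9 : c * r ^ 2 ≤ c := by nlinarith
      have h10 : c * r ^ 2 * ‖p - q‖ ^ 2 ≤ c * ‖p - q‖ ^ 2 := by gcongr
      rw [hδ] at h6 ⊢
      nlinarith
  calc _ ≤ K * Real.exp (-c * ‖p - q‖ ^ 2) * (L * Real.exp hUL) :=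
        mul_le_mul (hbd _ hε hεM p q) hexp.1 (norm_nonneg _) (by positivity)
    _ = K * L * Real.exp (-c * ‖p - q‖ ^ 2 + hUL) := by rw [Real.exp_add]; ring
    _ ≤ K * (K₀ + K') * Real.exp (c + -η * ‖q‖ ^ (1 / θ) + -(c / 2) * ‖p - q‖ ^ 2) := by
        refine mul_le_mul (by gcongr) (Real.exp_le_exp.2 hexp.2) (Real.exp_pos _).le
          (by positivity)
    _ = _ := by rw [Real.exp_add, Real.exp_add]; ring

/-- Any window will do here. In the reproducing formula for `f` the coefficients decay at rate `η`,
while the regularizations grow on packets at rate at most `η/2`, uniformly in `n`; this dominates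
the pointwise convergence on packets. -/
theorem tendsto_integral_pdo_mul {θ : ℝ} (hθ : 1 / 2 ≤ θ) (hθ' : θ < 1) (u : Ultra d θ)
    {g : ℕ → GS d θ} {e : ℕ → ℝ} (hg : ∀ n x, (g n : RSp d → ℂ) x = pdo (gaussSymbol (e n)) u x)
    (he : ∀ n, 0 < e n) {M : ℝ} (heM : ∀ n, e n ≤ M) (he0 : Tendsto e atTop (𝓝 0))
    (f : GS d θ) :
    Tendsto (fun n => (toUltra (g n) : GS d θ →ₗ[ℂ] ℂ) f) atTop
      (𝓝 ((u : GS d θ →ₗ[ℂ] ℂ) f)) := by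
  obtain ⟨hσ, hσ'⟩ := one_le_one_div hθ hθ'
  obtain ⟨C, hC⟩ : ∃ C : Matrix (Fin d) (Fin d) ℂ, IsWindow C := ⟨_, isWindow_smul_one one_pos⟩
  obtain ⟨l, hl, hl'⟩ := exists_norm_coef_smear_le hC
  obtain ⟨hC', -⟩ := hl' l le_rfl
  obtain ⟨K, hK, η, hη, hf⟩ := exists_decay_coef hθ hθ' f.2 hC'
  obtain ⟨K', hK', hv⟩ := norm_integral_pdo_mul_packet_le hθ hθ' (δ := η / 2) (by positivity) hC u
    ((he 0).trans_le (heM 0))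
  have hvn : ∀ n q, (toUltra (g n) : GS d θ →ₗ[ℂ] ℂ) (pkt hθ hθ' hC q) =
      ∫ x, pdo (gaussSymbol (e n)) u x * packet C q x := fun n q => by
    change ∫ x, (g n : RSp d → ℂ) x * packet C q x = _
    simp_rw [hg n]
  simp_rw [apply_eq_integral_coef hθ hθ' f hC hl hC']
  refine Tendsto.const_mul _ (tendsto_integral_of_dominated_convergence
    (fun q => K * K' * Real.exp (-(η / 2) * ‖q‖ ^ (1 / θ))) (fun n => ?_)
    ((integrable_exp_neg_rpow hσ (by positivity)).const_mul _)
    (fun n => Eventually.of_forall fun q => ?_) (Eventually.of_forall fun q => ?_))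
  · exact (stronglyMeasurable_coef _ l f.2.1.continuous).aestronglyMeasurable.mul
      (continuous_apply_pkt hθ hθ' hC _).aestronglyMeasurable
  · rw [norm_mul, hvn]
    calc _ ≤ K * Real.exp (-η * ‖q‖ ^ (1 / θ)) * (K' * Real.exp (η / 2 * ‖q‖ ^ (1 / θ))) :=
          mul_le_mul (hf q) (hv _ (he n) (heM n) q) (norm_nonneg _) (by positivity)
      _ = K * K' * (Real.exp (-η * ‖q‖ ^ (1 / θ)) * Real.exp (η / 2 * ‖q‖ ^ (1 / θ))) := by ring
      _ = _ := by rw [← Real.exp_add]; congr 2; ring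
  · simp_rw [hvn]
    exact (tendsto_integral_pdo_mul_packet hθ hθ' hC u he heM he0 q).const_mul _

/-! ### FBI transforms and wave packets -/

lemma FBIPhase.isWindow (φ : FBIPhase d) : IsWindow φ.C :=
  isWindow_of_posDef φ.symm_C φ.posDef_im_C

lemma FBIPhase.const_pos (φ : FBIPhase d) : 0 < φ.const := by
  have h1 := φ.posDef_im_C.det_pos
  have h2 := norm_pos_iff.2 φ.det_B_ne_zero
  unfold FBIPhase.const
  positivity

/-- Substituting `Bz = -ξ - Cx` and completing the square in `y` shows that, up to a constant
factor, the FBI kernel at `χ^b_φ(p)` is the packet at `p`. -/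
lemma FBIPhase.exists_eval_chi_eq (φ : FBIPhase d) (p : RSp d × RSp d) :
    ∃ c : ℂ, ∀ y, Complex.I * φ.eval (φ.chi p) y =
      c + (-Complex.I * (ofR p.2 ⬝ᵥ ofR y) +
        Complex.I / 2 * quad φ.C (ofR y - ofR p.1) (ofR y - ofR p.1)) := by
  have h := (φ.chi_eq_iff p _).1 rfl
  have hB : φ.B.mulVec (φ.chi p).ofLp = -ofR p.2 - φ.C.mulVec (ofR p.1) := by
    rw [h]; abel
  refine ⟨Complex.I * ((1 / 2) * (φ.A.mulVec (φ.chi p).ofLp ⬝ᵥ (φ.chi p).ofLp)) -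
    Complex.I / 2 * quad φ.C (ofR p.1) (ofR p.1), fun y => ?_⟩
  have h1 := quad_comm φ.symm_C (ofR y) (ofR p.1)
  rw [FBIPhase.eval, hB, sub_dotProduct, neg_dotProduct]
  change Complex.I * (_ + (_ - quad φ.C (ofR p.1) (ofR y)) + 1 / 2 * quad φ.C (ofR y) (ofR y)) = _
  rw [quad_sub_left, quad_sub_right, quad_sub_right, h1]
  ring

theorem FBIPhase.norm_transform_chi (φ : FBIPhase d) {θ : ℝ} (hθ : 1 / 2 ≤ θ) (hθ' : θ < 1)
    (u : Ultra d θ) (p : RSp d × RSp d) :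
    ‖φ.transform u (φ.chi p)‖ = φ.const * Real.exp (φ.weight (φ.chi p)) *
      ‖(u : GS d θ →ₗ[ℂ] ℂ) (pkt hθ hθ' φ.isWindow p)‖ := by
  obtain ⟨c, hc⟩ := φ.exists_eval_chi_eq p
  obtain ⟨-, a, ha, hCa⟩ := φ.isWindow
  have h1 : (fun y => Complex.exp (Complex.I * φ.eval (φ.chi p) y)) =
      Complex.exp c • packet φ.C p := by
    funext y
    rw [hc y, Complex.exp_add]
    rfl
  -- The positive form `Im C` makes `y = x` the maximum point of `-Im φ(z,y)`.
  have h2 : φ.weight (φ.chi p) = c.re := by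
    have h3 : ∀ y, -(φ.eval (φ.chi p) y).im =
        c.re - 1 / 2 * (quad φ.C (ofR (y - p.1)) (ofR (y - p.1))).im := fun y => by
      have h4 := congrArg Complex.re (hc y)
      rw [← ofR_sub] at h4
      simp only [Complex.add_re, Complex.mul_re, Complex.neg_re, Complex.I_re, Complex.neg_im,
        Complex.I_im, Complex.div_ofNat_re, Complex.div_ofNat_im, im_dotProduct_ofR_ofR] at h4
      linarith
    have h5 : ∀ y, -(φ.eval (φ.chi p) y).im ≤ c.re := fun y => by
      rw [h3]
      have := hCa (y - p.1)
      have : 0 ≤ a * ‖y - p.1‖ ^ 2 := by positivity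
      linarith
    refine le_antisymm (ciSup_le h5) ?_
    refine le_ciSup_of_le ⟨c.re, Set.forall_mem_range.2 h5⟩ p.1 ?_
    rw [h3, sub_self]
    have h0 : ofR (0 : RSp d) = 0 := by funext i; simp [ofR]
    simp [h0, quad]
  have h3 : Complex.exp c • packet φ.C p ∈ GS d θ :=
    (GS d θ).smul_mem _ (packet_mem hθ hθ' φ.isWindow p)
  have h4 : (⟨Complex.exp c • packet φ.C p, h3⟩ : GS d θ) =
      Complex.exp c • pkt hθ hθ' φ.isWindow p := rfl
  rw [FBIPhase.transform, h1, pair, dif_pos h3, h4, map_smul, norm_mul, norm_smul,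
    Complex.norm_exp, h2, Complex.norm_real, Real.norm_of_nonneg φ.const_pos.le, mul_assoc]

/-- The map `χ^b_φ` as a real linear map. -/
def FBIPhase.chiLin (φ : FBIPhase d) : RSp d × RSp d →ₗ[ℝ] CSp d where
  toFun := φ.chi
  map_add' p q := by
    apply WithLp.ofLp_injective 2
    simp only [FBIPhase.chi, Prod.fst_add, Prod.snd_add, ofR_add, Matrix.mulVec_add,
      WithLp.ofLp_add]
    abel
  map_smul' t p := by
    apply WithLp.ofLp_injective 2
    have h : ∀ x : RSp d, ofR (t • x) = (t : ℂ) • ofR x := fun x => by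
      funext i; simp [ofR]
    simp only [FBIPhase.chi, Prod.smul_fst, Prod.smul_snd, h, Matrix.mulVec_smul, ← smul_add,
      ← smul_neg, WithLp.ofLp_smul, RingHom.id_apply]
    rfl

/-- If `χ^b_φ(p) = 0` then `Cx = -ξ` is real, so `⟨Cx,x⟩` has zero imaginary part; positivity forces
`x = 0` and then `ξ = 0`. -/
lemma FBIPhase.chiLin_injective (φ : FBIPhase d) : Function.Injective φ.chiLin := by
  rw [← LinearMap.ker_eq_bot, LinearMap.ker_eq_bot']
  intro p hp
  have h : ofR p.2 = -(φ.B.mulVec (0 : CSp d).ofLp + φ.C.mulVec (ofR p.1)) :=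
    (φ.chi_eq_iff p 0).1 hp
  rw [WithLp.ofLp_zero, Matrix.mulVec_zero, zero_add] at h
  obtain ⟨-, a, ha, hCa⟩ := φ.isWindow
  have h1 : quad φ.C (ofR p.1) (ofR p.1) = -(ofR p.2 ⬝ᵥ ofR p.1) := by
    rw [h, neg_dotProduct, neg_neg, quad]
  have h2 := hCa p.1
  rw [h1, Complex.neg_im, im_dotProduct_ofR_ofR, neg_zero] at h2
  have h3 : p.1 = 0 := by
    have : ‖p.1‖ ^ 2 ≤ 0 := by nlinarith
    simpa using this.antisymm (by positivity)
  have h0 : ofR (0 : RSp d) = 0 := by funext i; simp [ofR]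
  rw [h3, h0, Matrix.mulVec_zero, neg_zero] at h
  have h4 : p.2 = 0 := by
    ext i
    have := congrFun h i
    simpa [ofR] using this
  exact Prod.ext h3 h4

/-- The map `χ^b_φ` as a linear homeomorphism. -/
def FBIPhase.chiEquiv (φ : FBIPhase d) : (RSp d × RSp d) ≃L[ℝ] CSp d :=
  (LinearEquiv.ofInjectiveOfFinrankEq φ.chiLin φ.chiLin_injective (by
    rw [Module.finrank_prod, finrank_euclideanSpace, Fintype.card_fin,
      finrank_real_of_complex, finrank_euclideanSpace, Fintype.card_fin]
    ring)).toContinuousLinearEquiv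

lemma FBIPhase.chiEquiv_apply (φ : FBIPhase d) (p : RSp d × RSp d) : φ.chiEquiv p = φ.chi p := rfl

/-- Decay of the FBI transform in a conic neighbourhood implies decay of the wave packet
transform. -/
lemma exists_packet_decay_of_notMem_WF {θ : ℝ} (hθ : 1 / 2 ≤ θ) (hθ' : θ < 1) (φ : FBIPhase d)
    {u : Ultra d θ} {p₀ : RSp d × RSp d} (hp₀ : p₀ ≠ 0) (h : p₀ ∉ WF φ u) :
    ∃ ρ : ℝ, 0 < ρ ∧ ρ ≤ ‖p₀‖ ∧ ∃ K : ℝ, 0 ≤ K ∧ ∃ ε : ℝ, 0 < ε ∧ ∀ p ∈ coneBall p₀ (2 * ρ),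
      ‖(u : GS d θ →ₗ[ℂ] ℂ) (pkt hθ hθ' φ.isWindow p)‖ ≤ K * Real.exp (-ε * ‖p‖ ^ (1 / θ)) := by
  obtain ⟨hσ, hσ'⟩ := one_le_one_div hθ hθ'
  obtain ⟨L, ⟨hLo, hLp, -, hLc⟩, ε, hε, N, hN, hL⟩ : ∃ L : Set (CSp d),
      IsOpenConicNhd L (φ.chi p₀) ∧ ∃ ε : ℝ, 0 < ε ∧ ∃ N : ℝ, 0 < N ∧ ∀ z ∈ L,
        ‖φ.transform u z‖ ≤ N * Real.exp (-ε * ‖z‖ ^ (1 / θ) + φ.weight z) := by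
    by_contra hn
    exact h ⟨hp₀, hn⟩
  obtain ⟨r, hr, hball⟩ := Metric.isOpen_iff.1 (hLo.preimage φ.chiEquiv.continuous) p₀ hLp
  set A := ‖(φ.chiEquiv.symm : CSp d →L[ℝ] RSp d × RSp d)‖ + 1 with hA
  have hA0 : 0 < A := by positivity
  have hAn : ∀ p, ‖p‖ ≤ A * ‖φ.chi p‖ := fun p => by
    have h1 := (φ.chiEquiv.symm : CSp d →L[ℝ] RSp d × RSp d).le_opNorm (φ.chiEquiv p)
    rw [ContinuousLinearEquiv.coe_coe, φ.chiEquiv.symm_apply_apply, φ.chiEquiv_apply] at h1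
    refine h1.trans ?_
    gcongr
    linarith
  have hn₀ := norm_pos_iff.2 hp₀
  -- Half of `r` because the cone of radius `2ρ` must lie in the preimage of `L`; `ρ ≤ ‖p₀‖` will
  -- keep the origin out of the cone of radius `ρ`.
  refine ⟨min (r / 2) ‖p₀‖, by positivity, min_le_right _ _, N / φ.const,
    (div_pos hN φ.const_pos).le, ε / A ^ (1 / θ), by positivity, fun p ⟨t, ht, htp⟩ => ?_⟩
  have hpL : φ.chi p ∈ L := by
    have h1 : t • p ∈ Metric.ball p₀ r := by
      rw [mem_ball_iff_norm]
      have := min_le_left (r / 2) ‖p₀‖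
      linarith
    have h2 : φ.chiEquiv (t • p) ∈ L := hball h1
    rw [map_smul, φ.chiEquiv_apply] at h2
    have h3 := hLc _ h2 t⁻¹ (inv_pos.2 ht)
    rwa [smul_smul, inv_mul_cancel₀ ht.ne', one_smul] at h3
  have h1 := hL _ hpL
  rw [φ.norm_transform_chi hθ hθ', Real.exp_add] at h1
  have h2 : ‖p‖ ^ (1 / θ) ≤ A ^ (1 / θ) * ‖φ.chi p‖ ^ (1 / θ) := by
    rw [← Real.mul_rpow hA0.le (norm_nonneg _)]
    exact Real.rpow_le_rpow (norm_nonneg _) (hAn p) (by linarith)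
  have h3 : ε / A ^ (1 / θ) * ‖p‖ ^ (1 / θ) ≤ ε * ‖φ.chi p‖ ^ (1 / θ) := by
    rw [div_mul_eq_mul_div, div_le_iff₀ (by positivity)]
    have := mul_le_mul_of_nonneg_left h2 hε.le
    linarith
  have h4 : ‖(u : GS d θ →ₗ[ℂ] ℂ) (pkt hθ hθ' φ.isWindow p)‖ ≤
      N / φ.const * Real.exp (-ε * ‖φ.chi p‖ ^ (1 / θ)) := by
    rw [div_mul_eq_mul_div, le_div_iff₀ φ.const_pos]
    refine le_of_mul_le_mul_right ?_ (Real.exp_pos (φ.weight (φ.chi p)))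
    linarith
  refine h4.trans ?_
  refine mul_le_mul_of_nonneg_left (Real.exp_le_exp.2 ?_) (div_pos hN φ.const_pos).le
  linarith

/-- Decay of the wave packet transform in a cone implies decay of the FBI transform. -/
lemma exists_transform_decay_of_packet {θ : ℝ} (hθ : 1 / 2 ≤ θ) (hθ' : θ < 1) (φ : FBIPhase d)
    {p₀ : RSp d × RSp d} {ρ K ε : ℝ} (hρ : 0 < ρ) (hρ' : ρ ≤ ‖p₀‖) (hK : 0 ≤ K) (hε : 0 < ε) :
    ∃ L : Set (CSp d), IsOpenConicNhd L (φ.chi p₀) ∧ ∃ N : ℝ, 0 < N ∧ ∃ η : ℝ, 0 < η ∧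
      ∀ u : Ultra d θ, (∀ p ∈ coneBall p₀ ρ,
        ‖(u : GS d θ →ₗ[ℂ] ℂ) (pkt hθ hθ' φ.isWindow p)‖ ≤ K * Real.exp (-ε * ‖p‖ ^ (1 / θ))) →
      ∀ z ∈ L, ‖φ.transform u z‖ ≤ N * Real.exp (-η * ‖z‖ ^ (1 / θ) + φ.weight z) := by
  obtain ⟨hσ, hσ'⟩ := one_le_one_div hθ hθ'
  set A := ‖(φ.chiEquiv : RSp d × RSp d →L[ℝ] CSp d)‖ + 1 with hA
  have hA0 : 0 < A := by positivity
  have hAn : ∀ p, ‖φ.chi p‖ ≤ A * ‖p‖ := fun p => by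
    refine ((φ.chiEquiv : RSp d × RSp d →L[ℝ] CSp d).le_opNorm p).trans ?_
    gcongr
    linarith
  have hconst := φ.const_pos
  refine ⟨φ.chiEquiv.symm ⁻¹' coneBall p₀ ρ, ⟨?_, ?_, ?_, ?_⟩, φ.const * (K + 1), by positivity,
    ε / A ^ (1 / θ), by positivity, fun u hu z hz => ?_⟩
  · refine IsOpen.preimage φ.chiEquiv.symm.continuous ?_
    have : coneBall p₀ ρ = ⋃ t ∈ Set.Ioi (0 : ℝ), {q | ‖t • q - p₀‖ < ρ} := by
      ext q; simp [coneBall]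
    rw [this]
    refine isOpen_biUnion fun t _ => isOpen_lt (by fun_prop) continuous_const
  · refine ⟨1, one_pos, ?_⟩
    rw [← φ.chiEquiv_apply, φ.chiEquiv.symm_apply_apply, one_smul, sub_self, norm_zero]
    exact hρ
  · rintro ⟨t, -, ht⟩
    rw [map_zero, smul_zero, zero_sub, norm_neg] at ht
    linarith
  · rintro w ⟨s, hs, hsw⟩ t ht
    refine ⟨s / t, div_pos hs ht, ?_⟩
    rwa [map_smul, smul_smul, div_mul_cancel₀ _ ht.ne']
  · set p := φ.chiEquiv.symm z with hp
    have hzp : φ.chi p = z := by rw [← φ.chiEquiv_apply, hp, φ.chiEquiv.apply_symm_apply]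
    rw [← hzp, φ.norm_transform_chi hθ hθ', Real.exp_add]
    have h2 : ‖φ.chi p‖ ^ (1 / θ) ≤ A ^ (1 / θ) * ‖p‖ ^ (1 / θ) := by
      rw [← Real.mul_rpow hA0.le (norm_nonneg _)]
      exact Real.rpow_le_rpow (norm_nonneg _) (hAn p) (by linarith)
    have h3 : ε / A ^ (1 / θ) * ‖φ.chi p‖ ^ (1 / θ) ≤ ε * ‖p‖ ^ (1 / θ) := by
      rw [div_mul_eq_mul_div, div_le_iff₀ (by positivity)]
      have := mul_le_mul_of_nonneg_left h2 hε.le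
      linarith
    have h4 : ‖(u : GS d θ →ₗ[ℂ] ℂ) (pkt hθ hθ' φ.isWindow p)‖ ≤
        (K + 1) * Real.exp (-(ε / A ^ (1 / θ)) * ‖φ.chi p‖ ^ (1 / θ)) := by
      refine (hu p hz).trans ?_
      refine mul_le_mul (by linarith) (Real.exp_le_exp.2 ?_) (Real.exp_pos _).le (by positivity)
      linarith
    calc _ ≤ φ.const * Real.exp (φ.weight (φ.chi p)) *
          ((K + 1) * Real.exp (-(ε / A ^ (1 / θ)) * ‖φ.chi p‖ ^ (1 / θ))) := by gcongr
      _ = _ := by ring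

/-! ### Convergence in `S'_{θ,Γ}` and the density theorem -/

theorem toUltra_mem_ultraIn {θ : ℝ} (hθ : 1 / 2 ≤ θ) (hθ' : θ < 1) (φ : FBIPhase d)
    (Γ : Set (RSp d × RSp d)) (f : GS d θ) : toUltra f ∈ UltraIn φ Γ := by
  rintro p ⟨hp, hn⟩
  obtain ⟨K, hK, ε, hε, h⟩ := exists_decay_packet_transform hθ hθ' f.2 φ.isWindow
  obtain ⟨L, hL, N, hN, η, hη, h'⟩ := exists_transform_decay_of_packet hθ hθ' φ
    (norm_pos_iff.2 hp) le_rfl hK.le hε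
  exact absurd ⟨L, hL, η, hη, N, hN, h' (toUltra f) fun q _ => h q⟩ hn

theorem tendstoIn_toUltra {θ : ℝ} (hθ : 1 / 2 ≤ θ) (hθ' : θ < 1) (φ : FBIPhase d)
    {Γ : Set (RSp d × RSp d)} {u : Ultra d θ} (hu : u ∈ UltraIn φ Γ) {g : ℕ → GS d θ}
    {e : ℕ → ℝ} (hg : ∀ n x, (g n : RSp d → ℂ) x = pdo (gaussSymbol (e n)) u x)
    (he : ∀ n, 0 < e n) (he0 : Tendsto e atTop (𝓝 0)) :
    TendstoIn φ Γ (fun n => toUltra (g n)) u := by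
  obtain ⟨M, hM⟩ := he0.bddAbove_range
  have heM : ∀ n, e n ≤ M := fun n => hM ⟨n, rfl⟩
  have hM0 : 0 < M := (he 0).trans_le (heM 0)
  refine ⟨fun n => toUltra_mem_ultraIn hθ hθ' φ Γ _, hu, fun f => ?_, fun p hp hpΓ => ?_⟩
  · have := (tendsto_integral_pdo_mul hθ hθ' u hg he heM he0 f).sub_const
      ((u : GS d θ →ₗ[ℂ] ℂ) f)
    rw [sub_self] at this
    exact this
  · obtain ⟨ρ, hρ, hρ', K₀, hK₀, ε₀, hε₀, h₀⟩ :=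
      exists_packet_decay_of_notMem_WF hθ hθ' φ hp fun h => hpΓ (hu h)
    obtain ⟨K, hK, η, hη, h⟩ := norm_integral_pdo_mul_packet_le_of_cone hθ hθ' φ.isWindow u hM0
      hρ hK₀ hε₀ h₀
    obtain ⟨L, hL, N, hN, η', hη', h'⟩ := exists_transform_decay_of_packet (p₀ := p) hθ hθ' φ
      hρ hρ' (add_nonneg hK hK₀) (lt_min hη hε₀)
    -- `L`, `N` and `η'` were produced before the ultradistribution was chosen, so one choice serves
    -- all `n`.
    refine ⟨L, hL, N, hN, η', hη', fun n => h' _ fun q hq => ?_⟩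
    have hq2 : q ∈ coneBall p (2 * ρ) := by
      obtain ⟨t, ht, htq⟩ := hq
      exact ⟨t, ht, by linarith⟩
    have h1 : ((toUltra (g n) - u : Ultra d θ) : GS d θ →ₗ[ℂ] ℂ) (pkt hθ hθ' φ.isWindow q) =
        (∫ x, pdo (gaussSymbol (e n)) u x * packet φ.C q x) -
          (u : GS d θ →ₗ[ℂ] ℂ) (pkt hθ hθ' φ.isWindow q) := by
      change (∫ x, (g n : RSp d → ℂ) x * packet φ.C q x) - _ = _
      simp_rw [hg n]
    rw [h1, add_mul]
    refine (norm_sub_le _ _).trans (add_le_add ((h _ (he n) (heM n) q hq).trans ?_)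
      ((h₀ q hq2).trans ?_))
    · gcongr
      exact min_le_left _ _
    · gcongr
      exact min_le_right _ _

end GSWF
end

theorem mainTheorem10 (d : ℕ) (θ : ℝ) (hθ : 1 / 2 ≤ θ) (hθ' : θ < 1)
    (φ : GSWF.FBIPhase d) (Γ : Set (GSWF.RSp d × GSWF.RSp d)) (hΓ : GSWF.IsClosedCone Γ) :
    (∀ f : GSWF.GS d θ, GSWF.toUltra f ∈ GSWF.UltraIn φ Γ) ∧
    (∀ u : GSWF.Ultra d θ, u ∈ GSWF.UltraIn φ Γ →
      (∃ f : ℕ → GSWF.GS d θ, GSWF.TendstoIn φ Γ (fun n => GSWF.toUltra (f n)) u) ∧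
      (∃ g : ℝ → GSWF.GS d θ,
        (∀ ε : ℝ, 0 < ε → ∀ x : GSWF.RSp d,
          (g ε : GSWF.RSp d → ℂ) x = GSWF.pdo (GSWF.gaussSymbol ε) u x) ∧
        ∀ e : ℕ → ℝ, (∀ n, 0 < e n) → Filter.Tendsto e Filter.atTop (nhds 0) →
          GSWF.TendstoIn φ Γ (fun n => GSWF.toUltra (g (e n))) u)) := by
  refine ⟨GSWF.toUltra_mem_ultraIn hθ hθ' φ Γ, fun u hu => ?_⟩
  have hg : ∀ ε : ℝ, ∃ g : GSWF.GS d θ, 0 < ε → ∀ x : GSWF.RSp d,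
      (g : GSWF.RSp d → ℂ) x = GSWF.pdo (GSWF.gaussSymbol ε) u x := fun ε => by
    by_cases hε : 0 < ε
    · exact ⟨⟨_, GSWF.pdo_mem hθ hθ' hε u⟩, fun _ _ => rfl⟩
    · exact ⟨0, fun h => absurd h hε⟩
  choose g hg using hg
  have hconv : ∀ e : ℕ → ℝ, (∀ n, 0 < e n) → Tendsto e atTop (𝓝 0) →
      GSWF.TendstoIn φ Γ (fun n => GSWF.toUltra (g (e n))) u := fun e he he0 =>
    GSWF.tendstoIn_toUltra hθ hθ' φ hu (fun n => hg (e n) (he n)) he he0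
  exact ⟨⟨fun n => g (1 / ((n : ℝ) + 1)), hconv _ (fun n => by positivity)
    tendsto_one_div_add_atTop_nhds_zero_nat⟩, g, hg, hconv⟩
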